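/- Work over $\mathbb{C}$. Let $C \subset \mathbb{P}^3$ be a smooth irreducible curve contained in a smooth cubic surface $S \subset \mathbb{P}^3$, and let $\pi \colon X = \operatorname{Bl}_C \mathbb{P}^3 \to \mathbb{P}^3$ be the blowup of $\mathbb{P}^3$ along $C$. Let $m \geq 3$ and let $L \subset \mathbb{P}^3$ be an $m$-secant line to $C$, that is, a line whose scheme-theoretic intersection with $C$ is a zero-dimensional scheme of length $m$; if $m = 3$, assume moreover that $L \subset S$. Let $l \subset X$ be the strict transform of $L$, that is, the closure of $\pi^{-1}(L \setminus C)$ with its reduced structure, with ideal sheaf $\mathcal{I}$. Then $l \cong \mathbb{P}^1$ over $\mathbb{C}$ and, under a suitable such isomorphism, the normal bundle $N_{l/X} = \mathcal{H}om(\mathcal{I}/\mathcal{I}^2, \mathcal{O}_l)$ satisfies \[ N_{l/X} \cong \mathcal{O}_{\mathbb{P}^1}(-1) \oplus \mathcal{O}_{\mathbb{P}^1}(3-m). \] -/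

import Mathlib

open CategoryTheory CategoryTheory.Limits AlgebraicGeometry TopologicalSpace Opposite

noncomputable section

namespace NormalBundleLines

universe u

/-! ### Sheaves of modules: the sheaf `Hom(M, N)`, the dual, the normal sheaf -/

section HomSheaf

variable {X : Scheme.{u}}

/-- The structure sheaf `𝒪_X` as a module over itself. -/
abbrev structureModule (X : Scheme.{u}) : X.Modules := SheafOfModules.unit X.ringCatSheaf

/-- Build an `𝒪_X`-module from a sheaf of abelian groups with compatible module structures. -/
def mkModules (F : TopCat.Presheaf Ab.{u} X) (inst : ∀ U : X.Opens, Module Γ(X, U) (F.obj (op U)))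
    (map_smul : ∀ (U V : X.Opens) (i : V ⟶ U) (r : Γ(X, U)) (m : F.obj (op U)),
      F.map i.op (r • m) = X.presheaf.map i.op r • F.map i.op m)
    (hF : F.IsSheaf) : X.Modules :=
  letI : ∀ U : X.Opensᵒᵖ, Module (X.ringCatSheaf.obj.obj U) (F.obj U) := fun U => inst U.unop
  { val := PresheafOfModules.ofPresheaf F (fun U V i r m => map_smul U.unop V.unop i.unop r m)
    isSheaf := hF }

/-- All families of linear maps `M(V) → N(V)`, for `V` an open subset of `U`. -/
abbrev HomFamily (M N : X.Modules) (U : X.Opens) : Type u :=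
  ∀ V : {V : X.Opens // V ≤ U}, Γ(M, V.1) →ₗ[Γ(X, V.1)] Γ(N, V.1)

/-- The families compatible with restriction, that is, the `𝒪_U`-linear maps
`M|_U → N|_U`. -/
def homSections (M N : X.Modules) (U : X.Opens) : AddSubgroup (HomFamily M N U) where
  carrier := {φ | ∀ (V W : {V : X.Opens // V ≤ U}) (i : W.1 ⟶ V.1) (m : Γ(M, V.1)),
    φ W (M.presheaf.map i.op m) = N.presheaf.map i.op (φ V m)}
  zero_mem' := fun V W i m => by simp
  add_mem' := fun {φ ψ} hφ hψ V W i m => by simp [hφ V W i m, hψ V W i m]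
  neg_mem' := fun {φ} hφ V W i m => by simp [hφ V W i m]

instance (M N : X.Modules) (U : X.Opens) : SMul Γ(X, U) (homSections M N U) where
  smul r φ := ⟨fun V => X.presheaf.map (homOfLE V.2).op r • φ.1 V, fun V W i m => by
    have h : X.presheaf.map (homOfLE W.2).op r =
        X.presheaf.map i.op (X.presheaf.map (homOfLE V.2).op r) := by
      rw [← ConcreteCategory.comp_apply, ← Functor.map_comp]; rfl
    simp only [LinearMap.smul_apply, Scheme.Modules.map_smul]
    rw [φ.2 V W i m, h]⟩

lemma homSections_smul_apply (M N : X.Modules) (U : X.Opens) (r : Γ(X, U))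
    (φ : homSections M N U) (V : {V : X.Opens // V ≤ U}) :
    (r • φ).1 V = X.presheaf.map (homOfLE V.2).op r • φ.1 V := rfl

instance (M N : X.Modules) (U : X.Opens) : Module Γ(X, U) (homSections M N U) where
  one_smul φ := by
    apply Subtype.ext; funext V; simp [homSections_smul_apply]
  mul_smul r s φ := by
    apply Subtype.ext; funext V; simp [homSections_smul_apply, mul_smul]
  smul_zero r := by
    apply Subtype.ext; funext V; simp [homSections_smul_apply]
  smul_add r φ ψ := by
    apply Subtype.ext; funext V; simp [homSections_smul_apply]
  add_smul r s φ := by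
    apply Subtype.ext; funext V; simp [homSections_smul_apply, add_smul]
  zero_smul φ := by
    apply Subtype.ext; funext V; simp [homSections_smul_apply]

/-- Restriction of `𝒪_U`-linear maps to a smaller open subset. -/
def homRestrict (M N : X.Modules) {U U' : X.Opens} (h : U' ≤ U) :
    homSections M N U →+ homSections M N U' where
  toFun φ := ⟨fun V => φ.1 ⟨V.1, V.2.trans h⟩,
    fun V W i m => φ.2 ⟨V.1, V.2.trans h⟩ ⟨W.1, W.2.trans h⟩ i m⟩
  map_zero' := rfl
  map_add' _ _ := rfl

/-- The presheaf `U ↦ Hom_{𝒪_U}(M|_U, N|_U)`. -/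
def homPresheaf (M N : X.Modules) : TopCat.Presheaf Ab.{u} X where
  obj U := AddCommGrpCat.of (homSections M N U.unop)
  map i := AddCommGrpCat.ofHom (homRestrict M N i.unop.le)
  map_id _ := rfl
  map_comp _ _ := by ext; rfl

lemma homPresheaf_map_apply (M N : X.Modules) {U U' : X.Opens} (i : U' ⟶ U)
    (φ : homSections M N U) (V : {V : X.Opens // V ≤ U'}) :
    (show homSections M N U' from (homPresheaf M N).map i.op φ).1 V =
      φ.1 ⟨V.1, V.2.trans i.le⟩ := rfl

/-- Restriction of sections of an `𝒪_X`-module. -/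
def res (N : X.Modules) {U V : X.Opens} (h : V ≤ U) (m : Γ(N, U)) : Γ(N, V) :=
  N.presheaf.map (homOfLE h).op m

lemma res_res (N : X.Modules) {U V W : X.Opens} (h : V ≤ U) (h' : W ≤ V) (m : Γ(N, U)) :
    res N h' (res N h m) = res N (h'.trans h) m := by
  unfold res
  rw [← ConcreteCategory.comp_apply, ← Functor.map_comp]; rfl

lemma res_add (N : X.Modules) {U V : X.Opens} (h : V ≤ U) (m m' : Γ(N, U)) :
    res N h (m + m') = res N h m + res N h m' := map_add _ _ _

lemma res_smul (N : X.Modules) {U V : X.Opens} (h : V ≤ U) (r : Γ(X, U)) (m : Γ(N, U)) :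
    res N h (r • m) = X.presheaf.map (homOfLE h).op r • res N h m :=
  Scheme.Modules.map_smul N _ _ _

lemma homSections_res {M N : X.Modules} {U : X.Opens} (φ : homSections M N U) {V W : X.Opens}
    (hV : V ≤ U) (hW : W ≤ U) (h : W ≤ V) (m : Γ(M, V)) :
    φ.1 ⟨W, hW⟩ (res M h m) = res N h (φ.1 ⟨V, hV⟩ m) := φ.2 ⟨V, hV⟩ ⟨W, hW⟩ (homOfLE h) m

lemma existsUnique_res (N : X.Modules) {ι : Type u} (V : X.Opens) (W : ι → X.Opens)
    (hW : ∀ i, W i ≤ V) (hV : V ≤ iSup W) (s : ∀ i, Γ(N, W i))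
    (hs : ∀ i j, res N inf_le_left (s i) = res N (inf_le_right : W i ⊓ W j ≤ W j) (s j)) :
    ∃! t : Γ(N, V), ∀ i, res N (hW i) t = s i :=
  TopCat.Sheaf.existsUnique_gluing' (⟨N.presheaf, N.isSheaf⟩ : TopCat.Sheaf Ab.{u} X) W V
    (fun i => homOfLE (hW i)) hV s hs

lemma homPresheaf_isSheaf (M N : X.Modules) : (homPresheaf M N).IsSheaf := by
  rw [TopCat.Presheaf.isSheaf_iff_isSheafUniqueGluing]
  intro ι U sf hsf
  let f : ∀ i, homSections M N (U i) := sf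
  have hf : ∀ (i j : ι) (V : X.Opens) (hi : V ≤ U i) (hj : V ≤ U j),
      (f i).1 ⟨V, hi⟩ = (f j).1 ⟨V, hj⟩ := by
    intro i j V hi hj
    exact congrFun (congrArg Subtype.val (hsf i j)) ⟨V, le_inf hi hj⟩
  have hcov : ∀ V : {V : X.Opens // V ≤ iSup U}, V.1 ≤ ⨆ i, V.1 ⊓ U i := by
    intro V
    rw [← inf_iSup_eq]; exact le_inf le_rfl V.2
  have key : ∀ (V : {V : X.Opens // V ≤ iSup U}) (m : Γ(M, V.1)), ∃! s : Γ(N, V.1),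
      ∀ i, res N (inf_le_left : V.1 ⊓ U i ≤ V.1) s =
        (f i).1 ⟨V.1 ⊓ U i, inf_le_right⟩ (res M inf_le_left m) := by
    intro V m
    refine existsUnique_res N V.1 (fun i => V.1 ⊓ U i) (fun i => inf_le_left) (hcov V) _ ?_
    intro i j
    rw [← homSections_res (f i) _ (inf_le_left.trans inf_le_right) _,
      ← homSections_res (f j) _ (inf_le_right.trans inf_le_right) _, res_res, res_res,
      hf i j _ _ (inf_le_right.trans inf_le_right)]
  choose g hg hg' using key
  have hsep : ∀ (V : {V : X.Opens // V ≤ iSup U}) (s t : Γ(N, V.1)),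
      (∀ i, res N (inf_le_left : V.1 ⊓ U i ≤ V.1) s = res N inf_le_left t) → s = t := by
    intro V s t h
    refine (existsUnique_res N V.1 (fun i => V.1 ⊓ U i) (fun i => inf_le_left) (hcov V)
      (fun i => res N inf_le_left t) fun i j => ?_).unique h fun i => rfl
    rw [res_res, res_res]
  let G : HomFamily M N (iSup U) := fun V =>
    { toFun := g V
      map_add' := fun m m' => hsep V _ _ fun i => by
        rw [res_add, hg, hg, hg, res_add, map_add]
      map_smul' := fun r m => hsep V _ _ fun i => by
        rw [RingHom.id_apply, hg, res_smul, res_smul, hg, map_smul] }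
  have hG : G ∈ homSections M N (iSup U) := by
    intro V W i m
    refine hsep W _ _ fun k => ?_
    change res N _ (g W (res M i.le m)) = res N _ (res N i.le (g V m))
    have e1 : (W.1 ⊓ U k) ≤ V.1 ⊓ U k := inf_le_inf_right _ i.le
    rw [hg, res_res, res_res, ← res_res N inf_le_left e1, hg,
      ← homSections_res (f k) _ inf_le_right _, res_res]
  refine ⟨(⟨G, hG⟩ : homSections M N (iSup U)), ?_, ?_⟩
  · intro i
    apply Subtype.ext
    funext V
    apply LinearMap.ext
    intro m
    change g ⟨V.1, _⟩ m = (f i).1 V m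
    refine hsep ⟨V.1, V.2.trans (le_iSup U i)⟩ _ _ fun k => ?_
    rw [hg, ← homSections_res (f i) V.2 (inf_le_left.trans V.2) _,
      hf i k _ (inf_le_left.trans V.2) inf_le_right]
  · intro s hs
    let s' : homSections M N (iSup U) := s
    have hs' : ∀ i (V : {V : X.Opens // V ≤ U i}),
        s'.1 ⟨V.1, V.2.trans (le_iSup U i)⟩ = (f i).1 V := fun i V =>
      congrFun (congrArg Subtype.val (hs i)) V
    apply Subtype.ext
    funext V
    apply LinearMap.ext
    intro m
    change s'.1 V m = g V m
    refine hg' V m _ fun i => ?_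
    rw [← hs' i ⟨V.1 ⊓ U i, inf_le_right⟩]
    exact (homSections_res s' V.2 (inf_le_left.trans V.2) inf_le_left m).symm

/-- The sheaf of homomorphisms `Hom_{𝒪_X}(M, N)`. -/
def homModule (M N : X.Modules) : X.Modules :=
  mkModules (homPresheaf M N)
    (fun U => inferInstanceAs (Module Γ(X, U) (homSections M N U)))
    (fun U V i r φ => by
      refine Subtype.ext (funext fun W => ?_)
      change X.presheaf.map (homOfLE (W.2.trans i.le)).op r • _ =
        X.presheaf.map (homOfLE W.2).op (X.presheaf.map i.op r) • _
      rw [← ConcreteCategory.comp_apply, ← Functor.map_comp]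
      rfl)
    (homPresheaf_isSheaf M N)

/-- The dual `Hom_{𝒪_X}(M, 𝒪_X)`. -/
def dualModule (M : X.Modules) : X.Modules := homModule M (structureModule X)

/-- The map `𝒪_Y → i_* 𝒪_Z` belonging to a morphism `i : Z ⟶ Y`. -/
def structureMap {Z Y : Scheme.{u}} (i : Z ⟶ Y) :
    structureModule Y ⟶ (Scheme.Modules.pushforward i).obj (structureModule Z) :=
  SheafOfModules.unitToPushforwardObjUnit i.toRingCatSheafHom

/-- The ideal sheaf `ker (𝒪_Y → i_* 𝒪_Z)`, as an `𝒪_Y`-module. -/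
def idealModule {Z Y : Scheme.{u}} (i : Z ⟶ Y) : Y.Modules := kernel (structureMap i)

/-- The conormal sheaf `i^* 𝓘 = 𝓘 / 𝓘²` of a closed immersion `i : Z ⟶ Y` with ideal sheaf
`𝓘`. -/
def conormalModule {Z Y : Scheme.{u}} (i : Z ⟶ Y) : Z.Modules :=
  (Scheme.Modules.pullback i).obj (idealModule i)

/-- The normal sheaf `Hom(𝓘 / 𝓘², 𝒪_Z)` of a closed immersion `i : Z ⟶ Y` with ideal
sheaf `𝓘`; it is the sheaf of sections of the normal bundle when `i` is regular. -/
def normalModule {Z Y : Scheme.{u}} (i : Z ⟶ Y) : Z.Modules := dualModule (conormalModule i)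

end HomSheaf

/-! ### The twisting sheaves `𝒪(d)` on `Proj` -/

section Twist

variable {R A : Type u} [CommRing R] [CommRing A] [Algebra R A]
variable (𝒜 : ℕ → Submodule R A) [GradedAlgebra 𝒜]

variable {𝒜} in
/-- A point of `Proj`, as a homogeneous prime ideal. -/
def pt (x : Proj 𝒜) : ProjectiveSpectrum 𝒜 := x

/-- The localization `A_x` of the graded ring `A` at the homogeneous prime ideal `x`. -/
abbrev LocAt (x : ProjectiveSpectrum 𝒜) : Type u :=
  Localization.AtPrime x.asHomogeneousIdeal.toIdeal

/-- A function on `V` is a fraction of degree `d` if it is of the form `x ↦ a / b` with `a`, `b`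
homogeneous, `deg a = deg b + d`, and `b` outside every prime `x` in `V`. -/
def IsFractionOfDegree (d : ℤ) (V : (Proj 𝒜).Opens) (s : ∀ x : V, LocAt 𝒜 (pt x.1)) : Prop :=
  ∃ (p q : ℕ) (_ : (p : ℤ) = q + d) (a b : A) (_ : a ∈ 𝒜 p) (_ : b ∈ 𝒜 q)
    (hb : ∀ x : V, b ∈ (pt x.1).asHomogeneousIdeal.toIdeal.primeCompl),
    ∀ x : V, s x = Localization.mk a ⟨b, hb x⟩

/-- The condition of being locally a fraction of degree `d`. -/
def IsLocallyFractionOfDegree (d : ℤ) (U : (Proj 𝒜).Opens) (s : ∀ x : U, LocAt 𝒜 (pt x.1)) :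
    Prop :=
  ∀ x : U, ∃ (V : (Proj 𝒜).Opens) (_ : x.1 ∈ V) (h : V ≤ U),
    IsFractionOfDegree 𝒜 d V (fun y => s ⟨y.1, h y.2⟩)

/-- The value in `A_x` of a section of the structure sheaf of `Proj`. -/
def valueAt (U : (Proj 𝒜).Opens) (x : U) : Γ(Proj 𝒜, U) →+* LocAt 𝒜 (pt x.1) :=
  (algebraMap (HomogeneousLocalization.AtPrime 𝒜 (pt x.1).asHomogeneousIdeal.toIdeal)
    (LocAt 𝒜 (pt x.1))).comp (openToLocalization 𝒜 U (pt x.1) x.2).hom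

lemma valueAt_isLocallyFraction (U : (Proj 𝒜).Opens) (r : Γ(Proj 𝒜, U)) :
    IsLocallyFractionOfDegree 𝒜 0 U (fun x => valueAt 𝒜 U x r) := by
  intro x
  obtain ⟨V, hxV, i, n, a, b, hb, e⟩ := r.2 x
  refine ⟨V, hxV, i.le, n, n, by simp, a.1, b.1, a.2, b.2, fun y => hb y, fun y => ?_⟩
  exact (congrArg HomogeneousLocalization.val (e y)).trans (HomogeneousLocalization.val_mk _)

variable {𝒜} in
lemma IsLocallyFractionOfDegree.mul {d e : ℤ} {U : (Proj 𝒜).Opens}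
    {s t : ∀ x : U, LocAt 𝒜 (pt x.1)} (hs : IsLocallyFractionOfDegree 𝒜 d U s)
    (ht : IsLocallyFractionOfDegree 𝒜 e U t) :
    IsLocallyFractionOfDegree 𝒜 (d + e) U (fun x => s x * t x) := by
  intro x
  obtain ⟨V, hxV, hV, p, q, hpq, a, b, ha, hb, hbV, hab⟩ := hs x
  obtain ⟨V', hxV', hV', p', q', hpq', a', b', ha', hb', hbV', hab'⟩ := ht x
  refine ⟨V ⊓ V', ⟨hxV, hxV'⟩, inf_le_left.trans hV, p + p', q + q', by push_cast; omega,
    a * a', b * b', SetLike.mul_mem_graded ha ha', SetLike.mul_mem_graded hb hb',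
    fun y => mul_mem (hbV ⟨y.1, y.2.1⟩) (hbV' ⟨y.1, y.2.2⟩), fun y => ?_⟩
  have h := hab ⟨y.1, y.2.1⟩
  have h' := hab' ⟨y.1, y.2.2⟩
  dsimp only at h h' ⊢
  rw [h, h', Localization.mk_mul]
  rfl

variable {𝒜} in
lemma IsLocallyFractionOfDegree.add {d : ℤ} {U : (Proj 𝒜).Opens}
    {s t : ∀ x : U, LocAt 𝒜 (pt x.1)} (hs : IsLocallyFractionOfDegree 𝒜 d U s)
    (ht : IsLocallyFractionOfDegree 𝒜 d U t) :
    IsLocallyFractionOfDegree 𝒜 d U (fun x => s x + t x) := by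
  intro x
  obtain ⟨V, hxV, hV, p, q, hpq, a, b, ha, hb, hbV, hab⟩ := hs x
  obtain ⟨V', hxV', hV', p', q', hpq', a', b', ha', hb', hbV', hab'⟩ := ht x
  refine ⟨V ⊓ V', ⟨hxV, hxV'⟩, inf_le_left.trans hV, p + q', q + q', by push_cast; omega,
    b * a' + b' * a, b * b', ?_, SetLike.mul_mem_graded hb hb',
    fun y => mul_mem (hbV ⟨y.1, y.2.1⟩) (hbV' ⟨y.1, y.2.2⟩), fun y => ?_⟩
  · refine add_mem ?_ ?_
    · have := SetLike.mul_mem_graded hb ha'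
      rwa [show q + p' = p + q' by omega] at this
    · have := SetLike.mul_mem_graded hb' ha
      rwa [show q' + p = p + q' by omega] at this
  have h := hab ⟨y.1, y.2.1⟩
  have h' := hab' ⟨y.1, y.2.2⟩
  dsimp only at h h' ⊢
  rw [h, h', Localization.add_mk]
  rfl

lemma exists_homogeneous_notMem (x : Proj 𝒜) :
    ∃ (k : ℕ) (_ : 0 < k) (f : A) (_ : f ∈ 𝒜 k), f ∉ (pt x).asHomogeneousIdeal.toIdeal := by
  obtain ⟨f, hf, hfx⟩ := SetLike.not_le_iff_exists.mp (pt x).not_irrelevant_le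
  by_contra! H
  refine hfx ?_
  change f ∈ (pt x).asHomogeneousIdeal.toIdeal
  classical
  rw [← DirectSum.sum_support_decompose 𝒜 f]
  refine Ideal.sum_mem _ fun k _ => ?_
  rcases Nat.eq_zero_or_pos k with rfl | hk
  · have : ((DirectSum.decompose 𝒜 f) 0 : A) = 0 := by
      rwa [HomogeneousIdeal.mem_irrelevant_iff, GradedRing.proj_apply] at hf
    rw [this]; exact zero_mem _
  · exact H k hk _ (SetLike.coe_mem _)

lemma isLocallyFractionOfDegree_zero (d : ℤ) (U : (Proj 𝒜).Opens) :
    IsLocallyFractionOfDegree 𝒜 d U (fun _ => 0) := by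
  intro x
  obtain ⟨k, hk, f, hf, hfx⟩ := exists_homogeneous_notMem 𝒜 x.1
  refine ⟨U ⊓ Proj.basicOpen 𝒜 f, ⟨x.2, hfx⟩, inf_le_left,
    (((d.natAbs * k : ℕ) : ℤ) + d).toNat, d.natAbs * k, ?_, 0, f ^ d.natAbs, zero_mem _, ?_,
    fun y => pow_mem (show f ∈ (pt y.1).asHomogeneousIdeal.toIdeal.primeCompl from y.2.2) _,
    fun y => (Localization.mk_zero _).symm⟩
  · have : (d.natAbs : ℤ) ≤ ((d.natAbs * k : ℕ) : ℤ) := by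
      exact_mod_cast Nat.le_mul_of_pos_right _ hk
    omega
  · simpa using SetLike.pow_mem_graded d.natAbs hf

/-- Sections of `𝒪(d)` over `U`: the functions `x ↦ s(x) ∈ A_x` that are locally fractions of
degree `d`. -/
def twistSections (d : ℤ) (U : (Proj 𝒜).Opens) : AddSubgroup (∀ x : U, LocAt 𝒜 (pt x.1)) where
  carrier := {s | IsLocallyFractionOfDegree 𝒜 d U s}
  zero_mem' := isLocallyFractionOfDegree_zero 𝒜 d U
  add_mem' := fun hs ht => hs.add ht
  neg_mem' := fun {s} hs x => by
    obtain ⟨V, hxV, hV, p, q, hpq, a, b, ha, hb, hbV, hab⟩ := hs x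
    refine ⟨V, hxV, hV, p, q, hpq, -a, b, neg_mem ha, hb, hbV, fun y => ?_⟩
    have h := hab y
    dsimp only [Pi.neg_apply] at h ⊢
    rw [h, Localization.neg_mk]

instance (d : ℤ) (U : (Proj 𝒜).Opens) : SMul Γ(Proj 𝒜, U) (twistSections 𝒜 d U) where
  smul r s := ⟨fun x => valueAt 𝒜 U x r * s.1 x, by
    have := (valueAt_isLocallyFraction 𝒜 U r).mul s.2
    rwa [zero_add] at this⟩

lemma twistSections_smul_apply (d : ℤ) (U : (Proj 𝒜).Opens) (r : Γ(Proj 𝒜, U))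
    (s : twistSections 𝒜 d U) (x : U) : (r • s).1 x = valueAt 𝒜 U x r * s.1 x := rfl

instance (d : ℤ) (U : (Proj 𝒜).Opens) : Module Γ(Proj 𝒜, U) (twistSections 𝒜 d U) where
  one_smul s := Subtype.ext (funext fun x => by simp [twistSections_smul_apply])
  mul_smul r r' s := Subtype.ext (funext fun x => by simp [twistSections_smul_apply, mul_assoc])
  smul_zero r := Subtype.ext (funext fun x => by simp [twistSections_smul_apply])
  smul_add r s t := Subtype.ext (funext fun x => by simp [twistSections_smul_apply, mul_add])
  add_smul r r' s := Subtype.ext (funext fun x => by simp [twistSections_smul_apply, add_mul])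
  zero_smul s := Subtype.ext (funext fun x => by simp [twistSections_smul_apply])

/-- Restriction of sections of `𝒪(d)`. -/
def twistRestrict (d : ℤ) {U U' : (Proj 𝒜).Opens} (h : U' ≤ U) :
    twistSections 𝒜 d U →+ twistSections 𝒜 d U' where
  toFun s := ⟨fun x => s.1 ⟨x.1, h x.2⟩, fun x => by
    obtain ⟨V, hxV, hV, p, q, hpq, a, b, ha, hb, hbV, hab⟩ := s.2 ⟨x.1, h x.2⟩
    exact ⟨V ⊓ U', ⟨hxV, x.2⟩, inf_le_right, p, q, hpq, a, b, ha, hb,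
      fun y => hbV ⟨y.1, y.2.1⟩, fun y => hab ⟨y.1, y.2.1⟩⟩⟩
  map_zero' := rfl
  map_add' _ _ := rfl

/-- The presheaf of abelian groups underlying `𝒪(d)`. -/
def twistPresheaf (d : ℤ) : TopCat.Presheaf Ab.{u} (Proj 𝒜) where
  obj U := AddCommGrpCat.of (twistSections 𝒜 d U.unop)
  map i := AddCommGrpCat.ofHom (twistRestrict 𝒜 d i.unop.le)
  map_id _ := rfl
  map_comp _ _ := by ext; rfl

lemma twistPresheaf_isSheaf (d : ℤ) : (twistPresheaf 𝒜 d).IsSheaf := by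
  rw [TopCat.Presheaf.isSheaf_iff_isSheafUniqueGluing]
  intro ι U sf hsf
  let f : ∀ i, twistSections 𝒜 d (U i) := sf
  have hf : ∀ (i j : ι) (x : Proj 𝒜) (hi : x ∈ U i) (hj : x ∈ U j),
      (f i).1 ⟨x, hi⟩ = (f j).1 ⟨x, hj⟩ := fun i j x hi hj =>
    congrFun (congrArg Subtype.val (hsf i j)) ⟨x, hi, hj⟩
  have hU : ∀ x : (iSup U : (Proj 𝒜).Opens), ∃ i, x.1 ∈ U i := fun x => Opens.mem_iSup.mp x.2
  choose c hc using hU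
  let g : ∀ x : (iSup U : (Proj 𝒜).Opens), LocAt 𝒜 (pt x.1) := fun x => (f (c x)).1 ⟨x.1, hc x⟩
  have hg : IsLocallyFractionOfDegree 𝒜 d (iSup U) g := by
    intro x
    obtain ⟨V, hxV, hV, p, q, hpq, a, b, ha, hb, hbV, hab⟩ := (f (c x)).2 ⟨x.1, hc x⟩
    exact ⟨V, hxV, hV.trans (le_iSup U _), p, q, hpq, a, b, ha, hb, hbV,
      fun y =>
        (hf (c ⟨y.1, (hV.trans (le_iSup U _)) y.2⟩) (c x) y.1 (hc _) (hV y.2)).trans (hab y)⟩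
  refine ⟨(⟨g, hg⟩ : twistSections 𝒜 d (iSup U)), fun i => ?_, fun s hs => ?_⟩
  · exact Subtype.ext (funext fun x => hf _ _ x.1 _ _)
  · exact Subtype.ext (funext fun x =>
      congrFun (congrArg Subtype.val (hs (c x))) ⟨x.1, hc x⟩)

/-- Serre's twisting sheaf `𝒪(d)` on `Proj`, for `d` an integer. -/
def twistModule (d : ℤ) : (Proj 𝒜).Modules :=
  mkModules (twistPresheaf 𝒜 d)
    (fun U => inferInstanceAs (Module Γ(Proj 𝒜, U) (twistSections 𝒜 d U)))
    (fun _ _ _ _ _ => rfl)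
    (twistPresheaf_isSheaf 𝒜 d)

end Twist

/-! ### Projective space and its closed subschemes -/

section Projective

/-- The grading of the homogeneous coordinate ring `ℂ[x₀, …, xₙ]`. -/
abbrev coordGrading (n : ℕ) : ℕ → Submodule ℂ (MvPolynomial (Fin (n + 1)) ℂ) :=
  MvPolynomial.homogeneousSubmodule (Fin (n + 1)) ℂ

instance coordGradedAlgebra (n : ℕ) : GradedAlgebra (coordGrading n) :=
  MvPolynomial.gradedAlgebra

/-- The projective space `ℙⁿ` over `ℂ`. -/
abbrev PSpace (n : ℕ) : Scheme.{0} := Proj (coordGrading n)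

/-- The structure morphism `ℙⁿ → Spec ℂ`. -/
def PSpace.toSpec (n : ℕ) : PSpace n ⟶ Spec (CommRingCat.of ℂ) :=
  Proj.toSpecZero (coordGrading n) ≫
    Spec.map (CommRingCat.ofHom (algebraMap ℂ (coordGrading n 0)))

lemma X_mem_coordGrading {n : ℕ} (i : Fin (n + 1)) :
    (MvPolynomial.X i : MvPolynomial (Fin (n + 1)) ℂ) ∈ coordGrading n 1 :=
  MvPolynomial.isHomogeneous_X ℂ i

/-- The standard affine chart `D₊(xᵢ)`. -/
def chart {n : ℕ} (i : Fin (n + 1)) : (PSpace n).affineOpens :=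
  ⟨Proj.basicOpen (coordGrading n) (MvPolynomial.X i),
    Proj.isAffineOpen_basicOpen (coordGrading n) _ (X_mem_coordGrading i) one_pos⟩

/-- The function `f / xᵢᵈ` on the chart `D₊(xᵢ)`, for `f` homogeneous of degree `d`. -/
def dehomogenize {n d : ℕ} (i : Fin (n + 1)) (f : MvPolynomial (Fin (n + 1)) ℂ)
    (hf : f ∈ coordGrading n d) : Γ(PSpace n, (chart i).1) :=
  (Proj.awayToSection (coordGrading n) (MvPolynomial.X i)).hom
    (HomogeneousLocalization.Away.mk (coordGrading n) (X_mem_coordGrading i) d f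
      (by simpa using hf))

/-- `Z` is the closed subscheme `V(f₁, …, f_r)` of `ℙⁿ`, where all `f_j` are homogeneous of
degree `d`: on each chart `D₊(xᵢ)` its ideal is generated by the `f_j / xᵢᵈ`. -/
def IsZeroScheme {n d r : ℕ} (Z : (PSpace n).IdealSheafData)
    (f : Fin r → MvPolynomial (Fin (n + 1)) ℂ) (hf : ∀ j, f j ∈ coordGrading n d) : Prop :=
  ∀ i : Fin (n + 1), Z.ideal (chart i) =
    Ideal.span (Set.range fun j => dehomogenize i (f j) (hf j))

/-- The structure morphism to `Spec ℂ` of a closed subscheme of `ℙⁿ`. -/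
def subschemeToSpec {n : ℕ} (Z : (PSpace n).IdealSheafData) :
    Z.subscheme ⟶ Spec (CommRingCat.of ℂ) := Z.subschemeι ≫ PSpace.toSpec n

/-- `S` is a smooth cubic surface in `ℙ³`. -/
def IsSmoothCubicSurface (S : (PSpace 3).IdealSheafData) : Prop :=
  (∃ (F : MvPolynomial (Fin 4) ℂ) (hF : F ∈ coordGrading 3 3), F ≠ 0 ∧
    IsZeroScheme S (fun _ : Fin 1 => F) (fun _ => hF)) ∧
  SmoothOfRelativeDimension 2 (subschemeToSpec S)

/-- `C` is a smooth (irreducible) curve in `ℙ³`. -/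
def IsSmoothCurve (C : (PSpace 3).IdealSheafData) : Prop :=
  IsIntegral C.subscheme ∧ SmoothOfRelativeDimension 1 (subschemeToSpec C)

/-- `L` is a line in `ℙ³`: the zero scheme of two linearly independent linear forms. -/
def IsLine (L : (PSpace 3).IdealSheafData) : Prop :=
  ∃ (f : Fin 2 → MvPolynomial (Fin 4) ℂ) (hf : ∀ j, f j ∈ coordGrading 3 1),
    LinearIndependent ℂ f ∧ IsZeroScheme L f hf

/-- The ring homomorphism `ℂ → Γ(Z, 𝒪_Z)` of a scheme over `Spec ℂ`. -/
def constants {Z : Scheme.{0}} (p : Z ⟶ Spec (CommRingCat.of ℂ)) : ℂ →+* Γ(Z, ⊤) :=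
  ((Scheme.ΓSpecIso (CommRingCat.of ℂ)).inv ≫ p.appTop).hom

/-- `Z` is a finite `ℂ`-scheme of length `m`, that is, `dim_ℂ Γ(Z, 𝒪_Z) = m`. -/
def HasLength {Z : Scheme.{0}} (p : Z ⟶ Spec (CommRingCat.of ℂ)) (m : ℕ) : Prop :=
  IsFinite p ∧ letI := (constants p).toAlgebra; Module.finrank ℂ Γ(Z, ⊤) = m

/-- `L` is an `m`-secant line to `C`: a line whose scheme-theoretic intersection with `C` (with
ideal sheaf the sum of the two ideal sheaves) is a zero-dimensional scheme of length `m`. -/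
def IsSecantLine (C L : (PSpace 3).IdealSheafData) (m : ℕ) : Prop :=
  IsLine L ∧ HasLength (subschemeToSpec (C ⊔ L)) m

end Projective

/-! ### Blowups and strict transforms -/

section Blowup

/-- The closed subscheme with ideal sheaf `I` is an effective Cartier divisor: locally, `I` is
generated by one nonzerodivisor. -/
def IsEffectiveCartier {X : Scheme.{u}} (I : X.IdealSheafData) : Prop :=
  ∀ x : X, ∃ U : X.affineOpens, x ∈ U.1 ∧
    ∃ f ∈ nonZeroDivisors Γ(X, U.1), I.ideal U = Ideal.span {f}

/-- `π : X ⟶ Y` is the blowup of `Y` along the closed subscheme with ideal sheaf `I`: it is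
universal among the morphisms for which the inverse image of that closed subscheme is an
effective Cartier divisor. -/
def IsBlowup {X Y : Scheme.{u}} (I : Y.IdealSheafData) (π : X ⟶ Y) : Prop :=
  IsEffectiveCartier (I.comap π) ∧
    ∀ (Z : Scheme.{u}) (g : Z ⟶ Y), IsEffectiveCartier (I.comap g) → ∃! h : Z ⟶ X, h ≫ π = g

/-- The strict transform under `π`, the blowup along `I`, of a reduced closed subscheme with ideal
sheaf `J`: the closure of the inverse image of its part outside the centre, with the reduced
structure. -/
def strictTransform {X Y : Scheme.{u}} (π : X ⟶ Y) (I J : Y.IdealSheafData) : X.IdealSheafData :=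
  Scheme.IdealSheafData.vanishingIdeal
    ⟨closure (π ⁻¹' ((J.support : Set Y) \ (I.support : Set Y))), isClosed_closure⟩

end Blowup

end NormalBundleLines

end

/-! Choose coordinates y₀, …, y₃ with L = {y₂ = y₃ = 0}. The cubic form F defining S vanishes on L:
for m = 3 this is the assumption L ⊂ S, and for m ≥ 4 a cubic form cannot vanish on a subscheme of
length m of a line without vanishing on the line (`toLine_eq_zero`). Hence F = y₂A + y₃B with
quadratic forms A and B. Along L the differential of F is A dy₂ + B dy₃, so smoothness of S means
that the restrictions a, b of A, B to L have no common zero (`span_dehomogenize_eq_top`). The scheme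
C ∩ L is the zero scheme on L of a binary form s of degree m (`exists_form`).

Since C is a smooth curve on the smooth surface S, near each of its points its ideal is generated by
F and one further function g (`exists_generator_of_smooth`); away from C one takes g = 1. As F
vanishes on L, the restriction of g to L is s up to a unit. Because s ≠ 0, the inverse image of C in
L is a Cartier divisor and L → ℙ³ lifts to X; the lift is a closed immersion onto the strict
transform l (`exists_iso_strictTransform`), which gives l ≅ ℙ¹. Along l the exceptional divisor has
the equation g, so l lies in the chart of X with coordinate v = F/g, and v = 0 on l.

In this chart the ideal of l is generated by y₂, y₃ and v, and every relation between these
generators becomes, on l, proportional to the one given by gv = y₂A + y₃B (`exists_generators`,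
`exists_mem_span_sq`, `relation_apply`). A normal section is therefore a pair (u, u') of sections of
𝒪(1), its values at y₂ and y₃, such that au + bu' is divisible by s
(`existsUnique_normalSection_of_chart`, `exists_normalSections_chart_of_iso`). In other words, N is
the kernel of (a, b) : 𝒪(1)² → 𝒪(3)/s𝒪(3 − m).

The kernel of (a, b) : 𝒪(1)² → 𝒪(3) itself is 𝒪(−1), embedded by (b, −a). Since a and b are coprime
quadratic forms and m ≥ 3, one can write s = ap + bq with p, q of degree m − 2
(`exists_eq_mul_add_mul`), and then (p, q) embeds 𝒪(3 − m) in N as a complement. So (t, w) ↦ (bt +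
pw, −at + qw) is an isomorphism 𝒪(−1) ⊕ 𝒪(3 − m) ≅ N (`existsUnique_isTwistRel`). It is handled
through its graph, a local relation between sections on the two sides, so that bijectivity need only
be checked on small open sets (`nonempty_iso_of_local_graph`, `Frame.nonempty_iso_normalModule`). -/

noncomputable section

namespace NormalBundleLines

universe u

/-! ### Generators of the ideal of a smooth subvariety -/

section SmoothIdeals

open TensorProduct KaehlerDifferential

variable {k P Q K : Type u} [CommRing k] [CommRing P] [CommRing Q] [Field K] [Algebra k P]
  [Algebra k Q] [Algebra P Q] [IsScalarTower k P Q] [Algebra Q K] [Algebra P K]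
  [IsScalarTower P Q K]

-- When P and its quotient Q are both formally smooth over k, the conormal map into Q ⊗ Ω[P⁄k] is a
-- split injection, and a split injection remains injective after tensoring with K. Through this,
-- smoothness of S and of C becomes a statement about differentials at a point.
variable (k P Q K) in
lemma cotangentComplexBaseChange_injective [Algebra.FormallySmooth k P]
    [Algebra.FormallySmooth k Q] (hsurj : Function.Surjective (algebraMap P Q)) :
    Function.Injective (cotangentComplexBaseChange k Q P K) := by
  let P' : Algebra.Extension k Q :=
    { Ring := P, σ := _, algebraMap_σ := Function.surjInv_eq hsurj }
  obtain ⟨l, hl⟩ := P'.formallySmooth_iff_split_injection.mp ‹_›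
  change Function.Injective (cotangentComplexBaseChange k Q P'.Ring K)
  rw [P'.cotangentComplexBaseChange_eq_lTensor_cotangentComplex K]
  have h : Function.Injective (P'.cotangentComplex.baseChange K) := by
    have h2 : (l.baseChange K) ∘ₗ (P'.cotangentComplex.baseChange K) = LinearMap.id := by
      rw [← LinearMap.baseChange_comp, hl, LinearMap.baseChange_id]
    exact Function.LeftInverse.injective (g := l.baseChange K) fun x => DFunLike.congr_fun h2 x
  simp only [LinearMap.coe_comp]
  exact (LinearEquiv.injective _).comp (h.comp (LinearEquiv.injective _))

/-- Elements of a finitely generated ideal `J` spanning its fibre at a prime `p` generate `J`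
in a neighbourhood of `p`. -/
lemma exists_mul_mem_of_span_fiber {p : Ideal P} [p.IsPrime] {J J' : Ideal P} (hJ : J.FG)
    (h : ∀ j (hj : j ∈ J), (1 : p.ResidueField) ⊗ₜ[P] (⟨j, hj⟩ : J) ∈
      Submodule.span p.ResidueField
        {x | ∃ j' : J, j'.1 ∈ J' ∧ x = (1 : p.ResidueField) ⊗ₜ[P] j'}) :
    ∃ a ∉ p, ∀ j ∈ J, a * j ∈ J' := by
  have : Module.Finite P J := Module.Finite.iff_fg.mpr hJ
  -- Nakayama: the finite module J/(J ∩ J') has zero fibre at p, so p is not in its support and some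
  -- a outside p annihilates it.
  let N : Submodule P J := Submodule.comap (Submodule.subtype J) J'
  have hsub : Subsingleton (p.ResidueField ⊗[P] (J ⧸ N)) := by
    refine subsingleton_of_forall_eq 0 fun x => ?_
    have hx : ∀ j : J, (N.mkQ.baseChange p.ResidueField) (1 ⊗ₜ j) = 0 := by
      intro j
      have : Submodule.span p.ResidueField
        {x | ∃ j' : J, j'.1 ∈ J' ∧ x = (1 : p.ResidueField) ⊗ₜ[P] j'} ≤
          LinearMap.ker (N.mkQ.baseChange p.ResidueField) := by
        rw [Submodule.span_le]
        rintro _ ⟨j', hj', rfl⟩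
        simp only [SetLike.mem_coe, LinearMap.mem_ker, LinearMap.baseChange_tmul]
        rw [(Submodule.Quotient.mk_eq_zero N).mpr (show j' ∈ N from hj') |> fun h => (h : N.mkQ j' = 0),
          tmul_zero]
      exact this (h j.1 j.2)
    induction x using TensorProduct.induction_on with
    | zero => rfl
    | add a b ha hb => rw [ha, hb, add_zero]
    | tmul c m =>
      obtain ⟨j, rfl⟩ := N.mkQ_surjective m
      have := hx j
      rw [LinearMap.baseChange_tmul] at this
      rw [← mul_one c, ← smul_eq_mul, ← TensorProduct.smul_tmul', this, smul_zero]
  have hns : (⟨p, ‹_›⟩ : PrimeSpectrum P) ∉ Module.support P (J ⧸ N) := by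
    rw [Module.mem_support_iff_nontrivial_residueField_tensorProduct]
    exact not_nontrivial_iff_subsingleton.mpr hsub
  rw [Module.support_eq_zeroLocus, PrimeSpectrum.mem_zeroLocus, Set.not_subset] at hns
  obtain ⟨a, ha, hap⟩ := hns
  refine ⟨a, hap, fun j hj => ?_⟩
  have := Module.mem_annihilator.mp ha (N.mkQ ⟨j, hj⟩)
  rw [← map_smul] at this
  exact (Submodule.Quotient.mk_eq_zero N).mp this

/-- The differential of an equation of a smooth hypersurface does not vanish at its points. -/
lemma tmul_D_ne_zero [IsDomain P] [Algebra.FormallySmooth k P] {F : P} (hF : F ≠ 0)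
    {p : Ideal P} [p.IsPrime] (hFp : F ∈ p)
    [Algebra.FormallySmooth k (P ⧸ Ideal.span {F})] :
    (1 : p.ResidueField) ⊗ₜ[P] D k P F ≠ 0 := by
  intro h0
  have hle : Ideal.span {F} ≤ p := (Ideal.span_singleton_le_iff_mem _).mpr hFp
  let : Algebra (P ⧸ Ideal.span {F}) p.ResidueField :=
    (Ideal.Quotient.lift _ (algebraMap P p.ResidueField)
      fun a ha => Ideal.algebraMap_residueField_eq_zero.mpr (hle ha)).toAlgebra
  have : IsScalarTower P (P ⧸ Ideal.span {F}) p.ResidueField :=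
    IsScalarTower.of_algebraMap_eq fun x => rfl
  have hinj := cotangentComplexBaseChange_injective k P (P ⧸ Ideal.span {F}) p.ResidueField
    Ideal.Quotient.mk_surjective
  have hker : RingHom.ker (algebraMap P (P ⧸ Ideal.span {F})) = Ideal.span {F} := Ideal.mk_ker
  have hFk : F ∈ RingHom.ker (algebraMap P (P ⧸ Ideal.span {F})) :=
    hker.symm.le (Ideal.mem_span_singleton_self F)
  have key : (1 : p.ResidueField) ⊗ₜ[P]
      (⟨F, hFk⟩ : RingHom.ker (algebraMap P (P ⧸ Ideal.span {F}))) = 0 := by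
    apply hinj
    rw [map_zero, cotangentComplexBaseChange_tmul]
    simpa using h0
  -- The fibre of the ideal (F) at p is zero, so taking J' = ⊥ gives a ∉ p with aF = 0, impossible
  -- in a domain.
  obtain ⟨a, hap, ha⟩ := exists_mul_mem_of_span_fiber (p := p)
    (J := RingHom.ker (algebraMap P (P ⧸ Ideal.span {F}))) (J' := ⊥)
    (by rw [hker]; exact ⟨{F}, by simp⟩) (by
      intro j hj
      obtain ⟨c, rfl⟩ := Ideal.mem_span_singleton'.mp (hker.le hj)
      have : (⟨c * F, hj⟩ : RingHom.ker (algebraMap P (P ⧸ Ideal.span {F}))) = c • ⟨F, hFk⟩ := rfl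
      rw [this, tmul_smul, key, smul_zero]
      exact zero_mem _)
  have := ha F hFk
  rw [Ideal.mem_bot, mul_eq_zero] at this
  rcases this with rfl | h
  · exact hap p.zero_mem
  · exact hF h

/-- A smooth curve in a smooth threefold is locally cut out by two equations, one of which
can be prescribed up to second order. -/
lemma exists_generator_of_smooth [IsNoetherianRing P] [Algebra.FormallySmooth k P]
    [Module.Free P Ω[P⁄k]] [Module.Finite P Ω[P⁄k]] (hrank : Module.finrank P Ω[P⁄k] = 3)
    {J : Ideal P} [Algebra.FormallySmooth k (P ⧸ J)]
    {p : Ideal P} [p.IsPrime] (hJp : J ≤ p) {F : P} (hF : F ∈ J)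
    (hdF : (1 : p.ResidueField) ⊗ₜ[P] D k P F ≠ 0)
    (δ : Ω[P⁄k] →ₗ[P] p.ResidueField) (hδ : δ ≠ 0) (hδJ : ∀ j ∈ J, δ (D k P j) = 0) :
    ∃ g ∈ J, ∃ a ∉ p, ∀ j ∈ J, a * j ∈ Ideal.span {F, g} := by
  let : Algebra (P ⧸ J) p.ResidueField :=
    (Ideal.Quotient.lift _ (algebraMap P p.ResidueField)
      fun a ha => Ideal.algebraMap_residueField_eq_zero.mpr (hJp ha)).toAlgebra
  have : IsScalarTower P (P ⧸ J) p.ResidueField := IsScalarTower.of_algebraMap_eq fun x => rfl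
  have hinj := cotangentComplexBaseChange_injective k P (P ⧸ J) p.ResidueField
    Ideal.Quotient.mk_surjective
  set J₁ := RingHom.ker (algebraMap P (P ⧸ J)) with hJ₁
  have hker : J₁ = J := Ideal.mk_ker
  set c := cotangentComplexBaseChange k (P ⧸ J) P p.ResidueField with hc
  let δK : p.ResidueField ⊗[P] Ω[P⁄k] →ₗ[p.ResidueField] p.ResidueField :=
    LinearMap.liftBaseChange p.ResidueField δ
  have hδK : δK ≠ 0 := by
    intro h
    apply hδ
    ext x
    have := DFunLike.congr_fun h ((1 : p.ResidueField) ⊗ₜ[P] D k P x)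
    simpa [δK] using this
  -- The functional δ is tangent to the subscheme, so the conormal fibre embeds in its kernel, of
  -- dimension 3 − 1 = 2.
  have hrange : LinearMap.range c ≤ LinearMap.ker δK := by
    rintro _ ⟨x, rfl⟩
    rw [LinearMap.mem_ker]
    induction x using TensorProduct.induction_on with
    | zero => simp
    | add a b ha hb => rw [map_add, map_add, ha, hb, add_zero]
    | tmul b j =>
      rw [hc, cotangentComplexBaseChange_tmul, map_smul]
      have : δK ((1 : p.ResidueField) ⊗ₜ[P] D k P j.1) = 0 := by
        simpa [δK] using hδJ j.1 (hker.le j.2)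
      rw [kerToTensor_apply, this, smul_zero]
  have : Nontrivial P := ⟨1, 0, fun h => (Ideal.ne_top_iff_one p).mp (Ideal.IsPrime.ne_top ‹_›)
    (h ▸ p.zero_mem)⟩
  have hfin : Module.finrank p.ResidueField (p.ResidueField ⊗[P] Ω[P⁄k]) = 3 := by
    rw [Module.finrank_baseChange, hrank]
  have hkerfin : Module.finrank p.ResidueField (LinearMap.ker δK) = 2 := by
    have h1 := LinearMap.finrank_range_add_finrank_ker δK
    rw [LinearMap.range_eq_top.mpr (LinearMap.surjective hδK), finrank_top, Module.finrank_self,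
      hfin] at h1
    omega
  have hV : Module.finrank p.ResidueField (p.ResidueField ⊗[P] J₁) ≤ 2 := by
    rw [← hkerfin, ← LinearMap.finrank_range_of_inj hinj]
    exact Submodule.finrank_mono hrange
  have : Module.Finite p.ResidueField (p.ResidueField ⊗[P] J₁) :=
    Module.Finite.of_injective c hinj
  have hFk : F ∈ J₁ := hker.symm.le hF
  set v : p.ResidueField ⊗[P] J₁ := (1 : p.ResidueField) ⊗ₜ[P] (⟨F, hFk⟩ : J₁) with hv
  have hv0 : v ≠ 0 := by
    intro h
    apply hdF
    have := congrArg c h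
    rw [map_zero, hv, hc, cotangentComplexBaseChange_tmul, kerToTensor_apply, one_smul] at this
    exact this
  -- If the class v of F already spans the fibre, g = 0 serves; otherwise any g outside its span
  -- completes it to a basis, the dimension being at most 2.
  have hspan : ∃ g : J₁, ∀ j : J₁, (1 : p.ResidueField) ⊗ₜ[P] j ∈
      Submodule.span p.ResidueField {v, (1 : p.ResidueField) ⊗ₜ[P] g} := by
    by_cases h : ∀ j : J₁, (1 : p.ResidueField) ⊗ₜ[P] j ∈ Submodule.span p.ResidueField {v}
    · exact ⟨0, fun j => Submodule.span_mono (by simp) (h j)⟩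
    · push Not at h
      obtain ⟨g, hg⟩ := h
      have hli : LinearIndependent p.ResidueField ![v, (1 : p.ResidueField) ⊗ₜ[P] g] := by
        rw [LinearIndependent.pair_iff' hv0]
        intro a ha
        exact hg (ha ▸ Submodule.smul_mem _ _ (Submodule.mem_span_singleton_self v))
      have htop := hli.span_eq_top_of_card_eq_finrank' (by
        have := hli.fintype_card_le_finrank
        simp at this ⊢
        omega)
      refine ⟨g, fun j => ?_⟩
      have hmem : (1 : p.ResidueField) ⊗ₜ[P] j ∈ (⊤ : Submodule p.ResidueField _) := trivial
      rw [← htop] at hmem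
      simpa [Matrix.range_cons, Set.pair_comm] using hmem
  obtain ⟨g, hg⟩ := hspan
  obtain ⟨a, hap, ha⟩ := exists_mul_mem_of_span_fiber (p := p) (J := J₁)
    (J' := Ideal.span {F, g.1}) (IsNoetherian.noetherian _) (by
      intro j hj
      refine Submodule.span_mono ?_ (hg ⟨j, hj⟩)
      rintro _ (rfl | rfl)
      · exact ⟨⟨F, hFk⟩, Ideal.subset_span (by simp), rfl⟩
      · exact ⟨g, Ideal.subset_span (by simp), rfl⟩)
  exact ⟨g.1, hker.le g.2, a, hap, fun j hj => ha j (hker.symm.le hj)⟩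

/-- A standard smooth algebra of positive relative dimension has a nonzero derivation at every
point. -/
lemma exists_linearMap_kaehler_ne_zero {k P Q K : Type u} [CommRing k] [CommRing P] [CommRing Q]
    [Field K] [Algebra k P] [Algebra k Q] [Algebra P Q] [IsScalarTower k P Q] [Algebra Q K]
    [Algebra P K] [IsScalarTower P Q K] (hsurj : Function.Surjective (algebraMap P Q)) {n : ℕ}
    (hn : 0 < n)
    (h : RingHom.Locally (RingHom.IsStandardSmoothOfRelativeDimension n) (algebraMap k Q)) :
    ∃ δ : Ω[P⁄k] →ₗ[P] K, δ ≠ 0 ∧ ∀ j, algebraMap P Q j = 0 → δ (D k P j) = 0 := by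
  obtain ⟨s, hs, H⟩ := h
  -- Standard smoothness is only given on a cover of Spec Q; one passes to a member of the cover
  -- containing the chosen K-point.
  obtain ⟨t, hts, ht⟩ : ∃ t ∈ s, algebraMap Q K t ≠ 0 := by
    by_contra! hcon
    have : Ideal.span s ≤ RingHom.ker (algebraMap Q K) := Ideal.span_le.mpr hcon
    rw [hs] at this
    exact one_ne_zero ((map_one (algebraMap Q K)).symm.trans (this (Submodule.mem_top (x := 1))))
  let φ : Localization.Away t →+* K := IsLocalization.Away.lift t (IsUnit.mk0 _ ht)
  have hφ : ∀ q, φ (algebraMap Q _ q) = algebraMap Q K q := IsLocalization.Away.lift_eq t _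
  let : Algebra (Localization.Away t) K := φ.toAlgebra
  have : IsScalarTower Q (Localization.Away t) K := IsScalarTower.of_algebraMap_eq
    fun x => (hφ x).symm
  have : Nontrivial (Localization.Away t) := φ.domain_nontrivial
  have hsm : Algebra.IsStandardSmoothOfRelativeDimension n k (Localization.Away t) := by
    have := H t hts
    rwa [← IsScalarTower.algebraMap_eq, RingHom.isStandardSmoothOfRelativeDimension_algebraMap]
      at this
  have := hsm.isStandardSmooth
  have hrk := Algebra.IsStandardSmoothOfRelativeDimension.rank_kaehlerDifferential (R := k)
    (S := Localization.Away t) n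
  let b := Module.Free.chooseBasis (Localization.Away t) Ω[Localization.Away t⁄k]
  have hne : Nonempty (Module.Free.ChooseBasisIndex (Localization.Away t)
      Ω[Localization.Away t⁄k]) := by
    by_contra hcon
    rw [not_nonempty_iff] at hcon
    rw [← b.mk_eq_rank'', Cardinal.mk_eq_zero] at hrk
    exact hn.ne (by exact_mod_cast hrk)
  obtain ⟨i⟩ := hne
  let δ₁ : Ω[Localization.Away t⁄k] →ₗ[Localization.Away t] K :=
    (Algebra.linearMap (Localization.Away t) K) ∘ₗ b.coord i
  have hδ₁ : δ₁ (b i) = 1 := by simp [δ₁]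
  have : IsScalarTower P (Localization.Away t) K := IsScalarTower.of_algebraMap_eq fun x => by
    rw [IsScalarTower.algebraMap_apply P Q K, IsScalarTower.algebraMap_apply P Q
      (Localization.Away t), ← IsScalarTower.algebraMap_apply Q (Localization.Away t) K]
  have : IsScalarTower k P (Localization.Away t) := IsScalarTower.of_algebraMap_eq fun x => by
    rw [IsScalarTower.algebraMap_apply P Q (Localization.Away t),
      ← IsScalarTower.algebraMap_apply k P Q, ← IsScalarTower.algebraMap_apply]
  refine ⟨(δ₁.restrictScalars P) ∘ₗ KaehlerDifferential.map k k P (Localization.Away t), ?_, ?_⟩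
  · intro h0
    have h1 : ∀ q : Q, δ₁ (D k _ (algebraMap Q (Localization.Away t) q)) = 0 := fun q => by
      obtain ⟨x, rfl⟩ := hsurj q
      have := DFunLike.congr_fun h0 (D k P x)
      simpa [← IsScalarTower.algebraMap_apply] using this
    -- By the quotient rule, vanishing on the differentials from Q forces vanishing on those of the
    -- localization, against `δ₁ (b i) = 1`.
    have h2 : ∀ z : Localization.Away t, δ₁ (D k _ z) = 0 := by
      intro z
      obtain ⟨m, a, hz⟩ := IsLocalization.Away.surj t z
      have e1 := h1 a
      rw [← hz, Derivation.leibniz, map_add, map_smul, map_smul, ← map_pow, h1 (t ^ m), smul_zero,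
        zero_add, Algebra.smul_def, mul_eq_zero] at e1
      refine e1.resolve_left ?_
      rw [← IsScalarTower.algebraMap_apply, map_pow]
      exact pow_ne_zero _ ht
    have h3 : δ₁ = 0 := by
      rw [← LinearMap.ker_eq_top, ← top_le_iff, ← KaehlerDifferential.span_range_derivation,
        Submodule.span_le]
      rintro _ ⟨z, rfl⟩
      exact h2 z
    rw [h3] at hδ₁
    exact zero_ne_one hδ₁
  · intro j hj
    simp [IsScalarTower.algebraMap_apply P Q (Localization.Away t), hj]

end SmoothIdeals

/-! ### Binary forms -/

section BinaryForms

open Polynomial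

variable {k : Type*} [Field k]

/-- The point [1 : 0] at infinity sees only the coefficient of top degree: a form vanishes there
exactly when its dehomogenization drops in degree. -/
lemma eval_homogenize_one_zero (p : k[X]) (n : ℕ) :
    MvPolynomial.eval ![1, 0] (p.homogenize n) = p.coeff n := by
  rw [Polynomial.homogenize, map_sum, Finset.sum_eq_single (n, 0)]
  · simp [MvPolynomial.eval_monomial, Finsupp.prod_fintype, Fin.prod_univ_two]
  · rintro ⟨i, j⟩ hij hne
    have hj : j ≠ 0 := by
      rintro rfl
      simp only [Finset.HasAntidiagonal.mem_antidiagonal, add_zero] at hij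
      exact hne (by rw [hij])
    simp [MvPolynomial.eval_monomial, Finsupp.prod_fintype, Fin.prod_univ_two, hj]
  · intro h
    exact absurd (Finset.HasAntidiagonal.mem_antidiagonal.mpr (add_zero n)) h

lemma eval_homogenize_right_one {p : k[X]} {n : ℕ} (hn : p.natDegree ≤ n) (t : k) :
    MvPolynomial.eval ![t, 1] (p.homogenize n) = p.eval t := by
  exact Polynomial.eval₂_homogenize_of_eq_one hn (RingHom.id k) ![t, 1] rfl

lemma natDegree_aeval_le {f : MvPolynomial (Fin 2) k} {n : ℕ} (hf : f.IsHomogeneous n) :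
    (MvPolynomial.aeval ![(X : k[X]), 1] f).natDegree ≤ n := by
  rw [f.as_sum, map_sum]
  refine Polynomial.natDegree_sum_le_of_forall_le _ _ fun d hd => ?_
  have hdeg : d.degree = n := by
    have := hf (MvPolynomial.mem_support_iff.mp hd)
    rw [Finsupp.degree_eq_weight_one]
    exact this
  rw [MvPolynomial.aeval_monomial, Finsupp.prod_fintype _ _ (by simp), Fin.prod_univ_two]
  simp only [Matrix.cons_val_zero, Matrix.cons_val_one, one_pow, mul_one]
  refine (Polynomial.natDegree_C_mul_X_pow_le _ _).trans ?_
  rw [← hdeg, Finsupp.degree_eq_sum, Fin.sum_univ_two]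
  exact Nat.le_add_right _ _

lemma homogenize_aeval {f : MvPolynomial (Fin 2) k} {n : ℕ} (hf : f.IsHomogeneous n) :
    (MvPolynomial.aeval ![(X : k[X]), 1] f).homogenize n = f :=
  Polynomial.homogenize_eq_of_isHomogeneous hf rfl

/-- From 1 = ua + vb one gets s = a(su) + b(sv). Reducing sv modulo a leaves a coefficient q of b of
degree at most 1; then ap = s − bq has degree at most m, because 2 + 1 ≤ m, and this bounds the
degree of p. -/
lemma exists_eq_mul_add_mul_of_natDegree_eq {a b s : k[X]} (ha : a.natDegree = 2)
    (hb : b.natDegree ≤ 2) (hab : IsCoprime a b) {m : ℕ} (hm : 3 ≤ m) (hs : s.natDegree ≤ m) :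
    ∃ p q : k[X], p.natDegree ≤ m - 2 ∧ q.natDegree ≤ m - 2 ∧ s = a * p + b * q := by
  obtain ⟨u, v, huv⟩ := hab
  have ha0 : a ≠ 0 := by rintro rfl; simp at ha
  have hq : (s * v % a).natDegree ≤ 1 := by
    have := Polynomial.natDegree_mod_lt (s * v) (q := a) (by omega)
    omega
  have heq : s = a * (s * u + b * (s * v / a)) + b * (s * v % a) := by
    have h1 : s * v = a * (s * v / a) + s * v % a := (EuclideanDomain.div_add_mod _ _).symm
    linear_combination (-s) * huv + b * h1
  refine ⟨_, _, ?_, by omega, heq⟩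
  set p := s * u + b * (s * v / a)
  by_cases hp : p = 0
  · simp [hp]
  have h1 : a * p = s - b * (s * v % a) := by rw [eq_sub_iff_add_eq]; exact heq.symm
  have h2 : (a * p).natDegree ≤ m := by
    rw [h1]
    refine (Polynomial.natDegree_sub_le _ _).trans (max_le hs ?_)
    exact Polynomial.natDegree_mul_le.trans (by omega)
  rw [Polynomial.natDegree_mul ha0 hp] at h2
  omega

/-- Two binary quadratic forms without common zeros generate all forms of degree at least `3`. -/
lemma exists_eq_mul_add_mul [IsAlgClosed k] {a b s : MvPolynomial (Fin 2) k}
    (ha : a.IsHomogeneous 2) (hb : b.IsHomogeneous 2) {m : ℕ} (hm : 3 ≤ m)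
    (hs : s.IsHomogeneous m)
    (hab : ∀ c : Fin 2 → k, c ≠ 0 → MvPolynomial.eval c a = 0 → MvPolynomial.eval c b ≠ 0) :
    ∃ p q : MvPolynomial (Fin 2) k, p.IsHomogeneous (m - 2) ∧ q.IsHomogeneous (m - 2) ∧
      s = a * p + b * q := by
  -- If a drops in degree it vanishes at infinity, where b then does not; so a and b can be
  -- exchanged.
  wlog h2 : (MvPolynomial.aeval ![(X : k[X]), 1] a).natDegree = 2 generalizing a b
  · have h2' : (MvPolynomial.aeval ![(X : k[X]), 1] b).natDegree = 2 := by
      refine le_antisymm (natDegree_aeval_le hb) (Polynomial.le_natDegree_of_ne_zero ?_)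
      rw [← eval_homogenize_one_zero, homogenize_aeval hb]
      refine hab _ (fun h => one_ne_zero (congrFun h 0)) ?_
      rw [← homogenize_aeval ha, eval_homogenize_one_zero]
      exact Polynomial.coeff_eq_zero_of_natDegree_lt
        (lt_of_le_of_ne (natDegree_aeval_le ha) h2)
    obtain ⟨p, q, hp, hq, h⟩ := this hb ha (fun c hc h h' => hab c hc h' h) h2'
    exact ⟨q, p, hq, hp, by rw [h, add_comm]⟩
  have hcop : IsCoprime (MvPolynomial.aeval ![(X : k[X]), 1] a)
      (MvPolynomial.aeval ![(X : k[X]), 1] b) := by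
    classical
    by_contra hcon
    have h0 : MvPolynomial.aeval ![(X : k[X]), 1] a ≠ 0 := by intro h; simp [h] at h2
    set g := EuclideanDomain.gcd (MvPolynomial.aeval ![(X : k[X]), 1] a)
      (MvPolynomial.aeval ![(X : k[X]), 1] b) with hg
    have hgu : ¬ IsUnit g := by rwa [hg, EuclideanDomain.gcd_isUnit_iff]
    -- A common root t would make [t : 1] a common zero of the two forms.
    obtain ⟨t, ht⟩ := IsAlgClosed.exists_root g (fun hd => hgu (by
      refine Polynomial.isUnit_iff_degree_eq_zero.mpr hd))
    have e1 := ht.dvd (EuclideanDomain.gcd_dvd_left _ _)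
    have e2 := ht.dvd (EuclideanDomain.gcd_dvd_right _ _)
    refine hab ![t, 1] (fun h => one_ne_zero (congrFun h 1)) ?_ ?_
    · rw [← homogenize_aeval ha, eval_homogenize_right_one (natDegree_aeval_le ha)]
      exact e1
    · rw [← homogenize_aeval hb, eval_homogenize_right_one (natDegree_aeval_le hb)]
      exact e2
  obtain ⟨p, q, hp, hq, h⟩ := exists_eq_mul_add_mul_of_natDegree_eq h2 (natDegree_aeval_le hb)
    hcop hm (natDegree_aeval_le hs)
  refine ⟨p.homogenize (m - 2), q.homogenize (m - 2), Polynomial.isHomogeneous_homogenize _,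
    Polynomial.isHomogeneous_homogenize _, ?_⟩
  have hm2 : m = 2 + (m - 2) := by omega
  have e : ∀ {c p : k[X]}, c.natDegree ≤ 2 → p.natDegree ≤ m - 2 →
      (c * p).homogenize m = c.homogenize 2 * p.homogenize (m - 2) := fun hc hp => by
    conv_lhs => rw [hm2]
    exact Polynomial.homogenize_mul _ _ hc hp
  rw [← homogenize_aeval hs, h, Polynomial.homogenize_add, e (natDegree_aeval_le ha) hp,
    e (natDegree_aeval_le hb) hq, homogenize_aeval ha, homogenize_aeval hb]

end BinaryForms

/-! ### Morphisms of sheaves of modules -/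

section ModuleHoms

variable {X : Scheme.{u}}

lemma presheaf_map_map {U V W : X.Opens} (h : V ≤ U) (h' : W ≤ V) (r : Γ(X, U)) :
    X.presheaf.map (homOfLE h').op (X.presheaf.map (homOfLE h).op r) =
      X.presheaf.map (homOfLE (h'.trans h)).op r := by
  rw [← ConcreteCategory.comp_apply, ← Functor.map_comp]; rfl

/-- A morphism of `𝒪_X`-modules from compatible linear maps on sections. -/
def mkHom {M N : X.Modules} (φ : ∀ U : X.Opens, Γ(M, U) →ₗ[Γ(X, U)] Γ(N, U))
    (hφ : ∀ (U V : X.Opens) (h : V ≤ U) (m : Γ(M, U)), φ V (res M h m) = res N h (φ U m)) :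
    M ⟶ N :=
  (⟨PresheafOfModules.homMk (M₁ := M.val) (M₂ := N.val)
    { app := fun U => AddCommGrpCat.ofHom (φ U.unop).toAddMonoidHom
      naturality := fun U V i => by
        ext m
        exact hφ U.unop V.unop i.unop.le m }
    (fun U r m => (φ U.unop).map_smul r m)⟩ : SheafOfModules.Hom M N)

lemma app_res {M N : X.Modules} (g : M ⟶ N) {U V : X.Opens} (h : V ≤ U) (m : Γ(M, U)) :
    g.app V (res M h m) = res N h (g.app U m) :=
  ConcreteCategory.congr_hom (g.mapPresheaf.naturality (homOfLE h).op) m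

lemma res_self (N : X.Modules) {U : X.Opens} (h : U ≤ U) (m : Γ(N, U)) : res N h m = m := by
  unfold res
  rw [Subsingleton.elim (homOfLE h).op (𝟙 _), CategoryTheory.Functor.map_id]
  rfl

/-- Sections agreeing locally are equal. -/
lemma eq_of_locally_eq (N : X.Modules) {U : X.Opens} (s t : Γ(N, U))
    (h : ∀ x ∈ U, ∃ (V : X.Opens) (hV : V ≤ U), x ∈ V ∧ res N hV s = res N hV t) : s = t := by
  choose! V hV hxV hst using h
  let W : U → X.Opens := fun x => V x.1
  have hW : ∀ x, W x ≤ U := fun x => hV x.1 x.2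
  refine (existsUnique_res N U W hW (fun x hx => Opens.mem_iSup.mpr ⟨⟨x, hx⟩, hxV x hx⟩)
    (fun x => res N (hW x) t) fun i j => ?_).unique (fun x => hst x.1 x.2) fun x => rfl
  rw [res_res, res_res]

/-- A relation between the sections of two sheaves that is local, compatible with restriction, and
locally the graph of a map, is the graph of a map. -/
lemma existsUnique_of_local_graph (M N : X.Modules)
    (R : ∀ U : X.Opens, Γ(M, U) → Γ(N, U) → Prop)
    (hres : ∀ {U V : X.Opens} (h : V ≤ U) {m n}, R U m n → R V (res M h m) (res N h n))
    (hloc : ∀ (U : X.Opens) (m : Γ(M, U)) (n : Γ(N, U)), (∀ x ∈ U, ∃ (V : X.Opens) (h : V ≤ U),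
      x ∈ V ∧ R V (res M h m) (res N h n)) → R U m n)
    (hgraph : ∀ x : X, ∃ V : X.Opens, x ∈ V ∧ ∀ V' ≤ V, ∀ m : Γ(M, V'), ∃! n, R V' m n)
    (U : X.Opens) (m : Γ(M, U)) : ∃! n, R U m n := by
  choose V hxV hV using hgraph
  let W : U → X.Opens := fun x => U ⊓ V x.1
  have hW : ∀ x, W x ≤ U := fun x => inf_le_left
  have hcov : U ≤ iSup W := fun x hx => Opens.mem_iSup.mpr ⟨⟨x, hx⟩, hx, hxV x⟩
  choose n hn hn' using fun x : U => hV x.1 (W x) inf_le_right (res M (hW x) m)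
  obtain ⟨t, ht, ht'⟩ := existsUnique_res N U W hW hcov n fun x y => by
    refine (hV x.1 (W x ⊓ W y) (inf_le_left.trans inf_le_right) _).unique
      (y₁ := res N inf_le_left (n x)) (hres inf_le_left (hn x)) ?_
    have := hres (inf_le_right : W x ⊓ W y ≤ W y) (hn y)
    rwa [res_res] at this ⊢
  refine ⟨t, hloc U m t fun x hx => ⟨W ⟨x, hx⟩, hW _, ⟨hx, hxV x⟩, ?_⟩, fun t' ht'' => ?_⟩
  · rw [ht]; exact hn _
  · exact ht' _ fun x => hn' x _ (hres (hW x) ht'')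

/-- Two sheaves of modules are isomorphic as soon as there is a local relation between them,
compatible with the module structures, that is the graph of a bijection on small open subsets. -/
lemma nonempty_iso_of_local_graph (M N : X.Modules)
    (R : ∀ U : X.Opens, Γ(M, U) → Γ(N, U) → Prop)
    (hadd : ∀ {U m m' n n'}, R U m n → R U m' n' → R U (m + m') (n + n'))
    (hsmul : ∀ {U : X.Opens} (r : Γ(X, U)) {m n}, R U m n → R U (r • m) (r • n))
    (hres : ∀ {U V : X.Opens} (h : V ≤ U) {m n}, R U m n → R V (res M h m) (res N h n))
    (hloc : ∀ (U : X.Opens) (m : Γ(M, U)) (n : Γ(N, U)), (∀ x ∈ U, ∃ (V : X.Opens) (h : V ≤ U),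
      x ∈ V ∧ R V (res M h m) (res N h n)) → R U m n)
    (hgraph : ∀ x : X, ∃ V : X.Opens, x ∈ V ∧ ∀ V' ≤ V, (∀ m : Γ(M, V'), ∃! n, R V' m n) ∧
      ∀ n : Γ(N, V'), ∃! m, R V' m n) : Nonempty (M ≅ N) := by
  have h1 := existsUnique_of_local_graph M N R hres hloc fun x => by
    obtain ⟨V, hx, hV⟩ := hgraph x
    exact ⟨V, hx, fun V' h => (hV V' h).1⟩
  have h2 := existsUnique_of_local_graph N M (fun U n m => R U m n) (fun h _ _ => hres h)
    (fun U n m h => hloc U m n h) fun x => by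
    obtain ⟨V, hx, hV⟩ := hgraph x
    exact ⟨V, hx, fun V' h => (hV V' h).2⟩
  choose φ hφ hφ' using h1
  let Φ : M ⟶ N := mkHom
    (fun U =>
      { toFun := φ U
        map_add' := fun m m' => (hφ' U _ _ (hadd (hφ U m) (hφ U m'))).symm
        map_smul' := fun r m => (hφ' U _ _ (hsmul r (hφ U m))).symm })
    (fun U V h m => (hφ' V _ _ (hres h (hφ U m))).symm)
  have : IsIso Φ := by
    rw [Scheme.Modules.Hom.isIso_iff_isIso_app]
    intro U
    rw [ConcreteCategory.isIso_iff_bijective]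
    refine ⟨fun m m' h => (h2 U (φ U m)).unique (hφ U m) ?_, fun n => ?_⟩
    · rw [show φ U m = φ U m' from h]; exact hφ U m'
    · obtain ⟨m, hm, -⟩ := h2 U n
      exact ⟨m, (hφ' U m n hm).symm⟩
  exact ⟨asIso Φ⟩

end ModuleHoms

/-! ### Homomorphisms out of an inverse image -/

section HomPullback

variable {X Z : Scheme.{u}}

/-- The sheaf `V ↦ N(U ∩ V)`. -/
def infModule (N : Z.Modules) (U : Z.Opens) : Z.Modules :=
  mkModules
    { obj := fun V => AddCommGrpCat.of Γ(N, U ⊓ V.unop)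
      map := fun i => AddCommGrpCat.ofHom
        (AddMonoidHom.mk' (res N (inf_le_inf_left U i.unop.le)) (res_add N _))
      map_id := fun V => by
        ext m
        exact res_self N _ m
      map_comp := fun i j => by
        ext m
        exact (res_res N _ _ m).symm }
    (fun V => Module.compHom Γ(N, U ⊓ V) (Z.presheaf.map (homOfLE (inf_le_right : U ⊓ V ≤ V)).op).hom)
    (fun V W i r m => by
      refine (res_smul N _ _ m).trans (congrArg
        (fun t : Γ(Z, U ⊓ W) => t • res N (inf_le_inf_left U i.le) m) ?_)
      exact (presheaf_map_map inf_le_right (inf_le_inf_left U i.le) r).trans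
        (presheaf_map_map i.le inf_le_right r).symm)
    (by
      rw [TopCat.Presheaf.isSheaf_iff_isSheafUniqueGluing]
      intro ι V sf hsf
      exact existsUnique_res N (U ⊓ iSup V) (fun i => U ⊓ V i)
        (fun i => inf_le_inf_left U (le_iSup V i)) (by rw [inf_iSup_eq]) sf (fun i j => by
          have h := hsf i j
          have e : (U ⊓ V i) ⊓ (U ⊓ V j) ≤ U ⊓ (V i ⊓ V j) :=
            le_inf (inf_le_left.trans inf_le_left)
              (le_inf (inf_le_left.trans inf_le_right) (inf_le_right.trans inf_le_right))
          have h' := congrArg (fun s : Γ(N, U ⊓ (V i ⊓ V j)) => res N e s) h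
          have e1 := res_res N (inf_le_inf_left U (inf_le_left : V i ⊓ V j ≤ V i)) e (sf i)
          have e2 := res_res N (inf_le_inf_left U (inf_le_right : V i ⊓ V j ≤ V j)) e (sf j)
          exact e1.symm.trans (h'.trans e2)))

lemma infModule_smul (N : Z.Modules) (U V : Z.Opens) (r : Γ(Z, V)) (m : Γ(infModule N U, V)) :
    r • m = (show Γ(N, U ⊓ V) from Z.presheaf.map (homOfLE (inf_le_right : U ⊓ V ≤ V)).op r •
      (show Γ(N, U ⊓ V) from m)) := rfl

lemma infModule_res (N : Z.Modules) (U : Z.Opens) {V W : Z.Opens} (h : W ≤ V)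
    (m : Γ(infModule N U, V)) :
    res (infModule N U) h m = (show Γ(N, U ⊓ W) from
      res N (inf_le_inf_left U h) (show Γ(N, U ⊓ V) from m)) := rfl

/-- The `𝒪_Z`-linear map `P → N(U ∩ -)` given by a map `P|_U → N|_U`. -/
def toInfHom (P N : Z.Modules) {U : Z.Opens} (φ : homSections P N U) : P ⟶ infModule N U :=
  mkHom
    (fun V =>
      { toFun := fun m => φ.1 ⟨U ⊓ V, inf_le_left⟩ (res P inf_le_right m)
        map_add' := fun m m' => (congrArg (φ.1 ⟨U ⊓ V, inf_le_left⟩) (res_add P _ m m')).trans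
          (map_add _ _ _)
        map_smul' := fun r m => (congrArg (φ.1 ⟨U ⊓ V, inf_le_left⟩) (res_smul P _ r m)).trans
          (map_smul _ _ _) })
    (fun V W h m => by
      refine Eq.trans ?_ (homSections_res φ inf_le_left inf_le_left (inf_le_inf_left U h) _)
      exact congrArg (φ.1 ⟨U ⊓ W, inf_le_left⟩)
        ((res_res P _ _ m).trans (res_res P _ _ m).symm))

lemma toInfHom_app (P N : Z.Modules) {U : Z.Opens} (φ : homSections P N U) (V : Z.Opens)
    (m : Γ(P, V)) :
    (toInfHom P N φ).app V m = φ.1 ⟨U ⊓ V, inf_le_left⟩ (res P inf_le_right m) := rfl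

/-- The map `P|_U → N|_U` given by an `𝒪_Z`-linear map `P → N(U ∩ -)`. -/
def ofInfHom (P N : Z.Modules) {U : Z.Opens} (g : P ⟶ infModule N U) : homSections P N U :=
  ⟨fun V =>
    { toFun := fun m => res N (le_inf V.2 le_rfl) (show Γ(N, U ⊓ V.1) from g.app V.1 m)
      map_add' := fun m m' => by rw [map_add]; exact res_add N _ _ _
      map_smul' := fun r m => by
        rw [Scheme.Modules.Hom.app_smul, infModule_smul]
        refine (res_smul N _ _ _).trans (congrArg
          (fun t : Γ(Z, V.1) => t • res N _ (show Γ(N, U ⊓ V.1) from g.app V.1 m)) ?_)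
        rw [← ConcreteCategory.comp_apply, ← Functor.map_comp]
        exact congrArg (fun f => f r) (congrArg DFunLike.coe (congrArg CommRingCat.Hom.hom
          (Z.presheaf.map_id (op V.1)))) },
    fun V W i m => by
      have h := app_res g i.le m
      change res N _ (show Γ(N, U ⊓ W.1) from g.app W.1 (res P i.le m)) = res N i.le _
      rw [h, infModule_res]
      exact (res_res N _ _ _).trans (res_res N _ _ _).symm⟩

lemma ofInfHom_apply (P N : Z.Modules) {U : Z.Opens} (g : P ⟶ infModule N U)
    (V : {V : Z.Opens // V ≤ U}) (m : Γ(P, V.1)) :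
    (ofInfHom P N g).1 V m =
      res N (le_inf V.2 le_rfl) (show Γ(N, U ⊓ V.1) from g.app V.1 m) := rfl

/-- The pullback of a section of a sheaf of modules. -/
def pullbackSection (i : Z ⟶ X) (M : X.Modules) (W : X.Opens) (h : Γ(M, W)) :
    Γ((Scheme.Modules.pullback i).obj M, i ⁻¹ᵁ W) :=
  ((Scheme.Modules.pullbackPushforwardAdjunction i).unit.app M).app W h

lemma pullbackSection_add (i : Z ⟶ X) (M : X.Modules) (W : X.Opens) (h h' : Γ(M, W)) :
    pullbackSection i M W (h + h') = pullbackSection i M W h + pullbackSection i M W h' :=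
  map_add _ _ _

lemma pullbackSection_smul (i : Z ⟶ X) (M : X.Modules) (W : X.Opens) (r : Γ(X, W)) (h : Γ(M, W)) :
    pullbackSection i M W (r • h) = i.app W r • pullbackSection i M W h :=
  Scheme.Modules.Hom.app_smul _ _ _

lemma pullbackSection_res (i : Z ⟶ X) (M : X.Modules) {W W' : X.Opens} (hW : W' ≤ W) (h : Γ(M, W)) :
    pullbackSection i M W' (res M hW h) =
      res _ (i.preimage_mono hW) (pullbackSection i M W h) :=
  app_res ((Scheme.Modules.pullbackPushforwardAdjunction i).unit.app M) hW h

/-- A map out of an inverse image is determined by its values on inverse images of sections. -/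
lemma homSections_pullback_ext (i : Z ⟶ X) (M : X.Modules) (N : Z.Modules) {U : Z.Opens}
    (φ φ' : homSections ((Scheme.Modules.pullback i).obj M) N U)
    (h : ∀ (W : X.Opens) (m : Γ(M, W)),
      φ.1 ⟨U ⊓ i ⁻¹ᵁ W, inf_le_left⟩ (res _ inf_le_right (pullbackSection i M W m)) =
      φ'.1 ⟨U ⊓ i ⁻¹ᵁ W, inf_le_left⟩ (res _ inf_le_right (pullbackSection i M W m))) :
    φ = φ' := by
  -- A map P|_U → N|_U is the same as a map P → N(U ∩ -) of sheaves on all of Z. The latter form is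
  -- accessible to the adjunction between pullback and pushforward.
  have h1 : toInfHom _ N φ = toInfHom _ N φ' := by
    apply ((Scheme.Modules.pullbackPushforwardAdjunction i).homEquiv _ _).injective
    rw [Adjunction.homEquiv_unit, Adjunction.homEquiv_unit]
    ext W m
    exact h W m
  apply Subtype.ext
  funext V
  ext m
  have h2 : (toInfHom _ N φ).app V.1 m = (toInfHom _ N φ').app V.1 m := by rw [h1]
  rw [toInfHom_app, toInfHom_app] at h2
  have h3 := congrArg (res N (le_inf V.2 le_rfl)) h2
  rw [← homSections_res φ _ V.2, ← homSections_res φ' _ V.2] at h3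
  rwa [res_res, res_self] at h3

/-- Compatible linear maps on the sections of `M` define a map out of the inverse image. -/
lemma exists_homSections_pullback (i : Z ⟶ X) (M : X.Modules) (N : Z.Modules) (U : Z.Opens)
    (ψ : ∀ W : X.Opens, Γ(M, W) → Γ(N, U ⊓ i ⁻¹ᵁ W))
    (hadd : ∀ W m m', ψ W (m + m') = ψ W m + ψ W m')
    (hsmul : ∀ W (r : Γ(X, W)) m, ψ W (r • m) =
      Z.presheaf.map (homOfLE (inf_le_right : U ⊓ i ⁻¹ᵁ W ≤ _)).op (i.app W r) • ψ W m)
    (hres : ∀ {W W' : X.Opens} (h : W' ≤ W) m,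
      ψ W' (res M h m) = res N (inf_le_inf_left U (i.preimage_mono h)) (ψ W m)) :
    ∃ φ : homSections ((Scheme.Modules.pullback i).obj M) N U, ∀ (W : X.Opens) (m : Γ(M, W)),
      φ.1 ⟨U ⊓ i ⁻¹ᵁ W, inf_le_left⟩ (res _ inf_le_right (pullbackSection i M W m)) = ψ W m := by
  let g : M ⟶ (Scheme.Modules.pushforward i).obj (infModule N U) :=
    mkHom (fun W =>
      { toFun := ψ W
        map_add' := hadd W
        map_smul' := hsmul W }) (fun W W' h m => hres h m)
  let g' := ((Scheme.Modules.pullbackPushforwardAdjunction i).homEquiv _ _).symm g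
  refine ⟨ofInfHom _ N g', fun W m => ?_⟩
  have h1 : (Scheme.Modules.pullbackPushforwardAdjunction i).homEquiv _ _ g' = g :=
    Equiv.apply_symm_apply _ _
  rw [Adjunction.homEquiv_unit] at h1
  have h2 : (g'.app (i ⁻¹ᵁ W)) (pullbackSection i M W m) = ψ W m :=
    congrArg (fun f : M ⟶ _ => f.app W m) h1
  rw [ofInfHom_apply, app_res g', h2]
  exact (res_res N (inf_le_inf_left U inf_le_right) _ (ψ W m)).trans (res_self N _ _)

end HomPullback

/-! ### The ideal sheaf -/

section IdealModule

variable {Y Z : Scheme.{u}}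

/-- The inclusion of the ideal sheaf in the structure sheaf. -/
def idealVal (i : Z ⟶ Y) (W : Y.Opens) (h : Γ(idealModule i, W)) : Γ(Y, W) :=
  (kernel.ι (structureMap i)).app W h

lemma idealVal_add (i : Z ⟶ Y) (W : Y.Opens) (h h' : Γ(idealModule i, W)) :
    idealVal i W (h + h') = idealVal i W h + idealVal i W h' :=
  map_add ((kernel.ι (structureMap i)).app W).hom _ _

lemma idealVal_smul (i : Z ⟶ Y) (W : Y.Opens) (r : Γ(Y, W)) (h : Γ(idealModule i, W)) :
    idealVal i W (r • h) = r * idealVal i W h :=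
  Scheme.Modules.Hom.app_smul _ _ _

lemma idealVal_res (i : Z ⟶ Y) {W W' : Y.Opens} (hW : W' ≤ W) (h : Γ(idealModule i, W)) :
    idealVal i W' (res _ hW h) = Y.presheaf.map (homOfLE hW).op (idealVal i W h) :=
  app_res (kernel.ι (structureMap i)) hW h

lemma app_idealVal (i : Z ⟶ Y) (W : Y.Opens) (h : Γ(idealModule i, W)) :
    i.app W (idealVal i W h) = 0 :=
  congrArg (fun f : idealModule i ⟶ _ => f.app W h) (kernel.condition (structureMap i))

/-- The ideal sheaf is an abstract kernel. Passing to presheaves and evaluating at W both preserve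
kernels, which makes its sections over W the functions on W that vanish on Z. -/
lemma exact_idealVal (i : Z ⟶ Y) (W : Y.Opens) : Function.Injective (idealVal i W) ∧
    ∀ r : Γ(Y, W), i.app W r = 0 → ∃ h, idealVal i W h = r := by
  let F : Y.Modules ⥤ AddCommGrpCat.{u} :=
    Scheme.Modules.toPresheaf Y ⋙ (evaluation _ _).obj (op W)
  let f := structureMap i
  have hF : PreservesLimitsOfShape WalkingParallelPair F := by
    have : PreservesLimitsOfShape WalkingParallelPair (Scheme.Modules.toPresheaf Y) :=
      inferInstance
    have : PreservesLimitsOfShape WalkingParallelPair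
        ((evaluation (Opens Y)ᵒᵖ AddCommGrpCat.{u}).obj (op W)) :=
      evaluation_preservesLimitsOfShape _
    exact comp_preservesLimitsOfShape _ _
  have hF' : F.PreservesZeroMorphisms := ⟨fun _ _ => rfl⟩
  have hlim := KernelFork.mapIsLimit _ (kernelIsKernel f) F
  let S : ShortComplex AddCommGrpCat.{u} := ShortComplex.mk (F.map (kernel.ι f)) (F.map f)
    (by rw [← F.map_comp, kernel.condition]; rfl)
  have hex : S.Exact := ShortComplex.exact_of_f_is_kernel S hlim
  constructor
  · have : Mono (F.map (kernel.ι f)) :=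
      mono_of_isLimit_fork (hlim : IsLimit (KernelFork.ofι _ S.zero))
    exact (AddCommGrpCat.mono_iff_injective _).mp this
  · intro r hr
    exact (ShortComplex.ab_exact_iff S).mp hex r hr

/-- Along an isomorphism the pullback is a restriction functor, which undoes the pushforward. The
comparison can thus be made on Z, where the sections of a pushforward are explicit. -/
lemma nonempty_pullback_iso {P Z : Scheme.{u}} (e : P ≅ Z) {N : Z.Modules} {Q : P.Modules}
    (h : Nonempty (N ≅ (Scheme.Modules.pushforward e.hom).obj Q)) :
    Nonempty ((Scheme.Modules.pullback e.hom).obj N ≅ Q) := by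
  obtain ⟨φ⟩ := h
  exact ⟨((Scheme.Modules.restrictFunctorIsoPullback e.hom).app N).symm ≪≫
    (Scheme.Modules.restrictFunctor e.hom).mapIso φ ≪≫
    (Scheme.Modules.restrictFunctorAdjCounitIso e.hom).app Q⟩

end IdealModule

/-! ### Sections of the normal sheaf -/

section NormalSections

variable {X Z : Scheme.{u}}

/-- Restriction of functions. -/
def rs {U V : X.Opens} (h : V ≤ U) : Γ(X, U) →+* Γ(X, V) := (X.presheaf.map (homOfLE h).op).hom

lemma rs_rs {U V W : X.Opens} (h : V ≤ U) (h' : W ≤ V) (r : Γ(X, U)) :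
    rs h' (rs h r) = rs (h'.trans h) r := presheaf_map_map h h' r

lemma rs_self {U : X.Opens} (h : U ≤ U) (r : Γ(X, U)) : rs h r = r :=
  res_self (structureModule X) h r

lemma app_rs (i : Z ⟶ X) {U V : X.Opens} (h : V ≤ U) (r : Γ(X, U)) :
    i.app V (rs h r) = rs (i.preimage_mono h) (i.app U r) :=
  ConcreteCategory.congr_hom (i.naturality (homOfLE h).op) r

lemma res_smul' (N : X.Modules) {U V : X.Opens} (h : V ≤ U) (r : Γ(X, U)) (m : Γ(N, U)) :
    res N h (r • m) = rs h r • res N h m := res_smul N h r m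

lemma res_sum (N : X.Modules) {U V : X.Opens} (h : V ≤ U) {σ : Type*} (s : Finset σ)
    (m : σ → Γ(N, U)) : res N h (∑ j ∈ s, m j) = ∑ j ∈ s, res N h (m j) :=
  map_sum (AddMonoidHom.mk' (res N h) (res_add N h)) m s

lemma eq_of_locally_eq_rs {U : X.Opens} (s t : Γ(X, U))
    (h : ∀ x ∈ U, ∃ (V : X.Opens) (hV : V ≤ U), x ∈ V ∧ rs hV s = rs hV t) : s = t :=
  eq_of_locally_eq (structureModule X) s t h

lemma existsUnique_rs {ι : Type u} (V : X.Opens) (W : ι → X.Opens)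
    (hW : ∀ i, W i ≤ V) (hV : V ≤ iSup W) (s : ∀ i, Γ(X, W i))
    (hs : ∀ i j, rs inf_le_left (s i) = rs (inf_le_right : W i ⊓ W j ≤ W j) (s j)) :
    ∃! t : Γ(X, V), ∀ i, rs (hW i) t = s i :=
  existsUnique_res (structureModule X) V W hW hV s hs

/-- The type of sections of the normal sheaf over `U`. -/
abbrev NormalSections (i : Z ⟶ X) (U : Z.Opens) : Type u :=
  homSections ((Scheme.Modules.pullback i).obj (idealModule i)) (structureModule Z) U

/-- The value of a section of the normal sheaf at a section of the ideal sheaf. -/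
def normalEval (i : Z ⟶ X) {U : Z.Opens} (φ : NormalSections i U) (W : X.Opens)
    (h : Γ(idealModule i, W)) : Γ(Z, U ⊓ i ⁻¹ᵁ W) :=
  φ.1 ⟨U ⊓ i ⁻¹ᵁ W, inf_le_left⟩ (res _ inf_le_right (pullbackSection i _ W h))

lemma normalEval_add (i : Z ⟶ X) {U : Z.Opens} (φ : NormalSections i U) (W : X.Opens)
    (h h' : Γ(idealModule i, W)) :
    normalEval i φ W (h + h') = normalEval i φ W h + normalEval i φ W h' := by
  unfold normalEval
  rw [pullbackSection_add, res_add, map_add]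
  rfl

lemma normalEval_smul (i : Z ⟶ X) {U : Z.Opens} (φ : NormalSections i U) (W : X.Opens)
    (r : Γ(X, W)) (h : Γ(idealModule i, W)) :
    normalEval i φ W (r • h) = rs inf_le_right (i.app W r) * normalEval i φ W h := by
  unfold normalEval
  rw [pullbackSection_smul, res_smul, map_smul]
  rfl

lemma normalEval_res (i : Z ⟶ X) {U : Z.Opens} (φ : NormalSections i U) {W W' : X.Opens}
    (hW : W' ≤ W) (h : Γ(idealModule i, W)) :
    normalEval i φ W' (res _ hW h) =
      rs (inf_le_inf_left U (i.preimage_mono hW)) (normalEval i φ W h) := by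
  unfold normalEval
  rw [pullbackSection_res]
  refine Eq.trans ?_ (homSections_res φ inf_le_left inf_le_left
    (inf_le_inf_left U (i.preimage_mono hW)) _)
  rw [res_res, res_res]

lemma normalEval_sum (i : Z ⟶ X) {U : Z.Opens} (φ : NormalSections i U) (W : X.Opens)
    {σ : Type*} (s : Finset σ) (a : σ → Γ(X, W)) (h : σ → Γ(idealModule i, W)) :
    normalEval i φ W (∑ j ∈ s, a j • h j) =
      ∑ j ∈ s, rs inf_le_right (i.app W (a j)) * normalEval i φ W (h j) := by
  refine (map_sum (AddMonoidHom.mk' (normalEval i φ W) (normalEval_add i φ W)) _ s).trans ?_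
  exact Finset.sum_congr rfl fun j _ => normalEval_smul i φ W _ _

/-- The restriction to a smaller open subset. -/
lemma normalEval_restrict (i : Z ⟶ X) {U V : Z.Opens} (hV : V ≤ U) (φ : NormalSections i U)
    (W : X.Opens) (h : Γ(idealModule i, W)) :
    normalEval i (homRestrict _ _ hV φ) W h = rs (inf_le_inf_right _ hV) (normalEval i φ W h) := by
  unfold normalEval
  refine Eq.trans ?_ (homSections_res φ inf_le_left (inf_le_left.trans hV)
    (inf_le_inf_right _ hV) _)
  rw [res_res]
  rfl

lemma normalEval_add_left (i : Z ⟶ X) {U : Z.Opens} (φ φ' : NormalSections i U) (W : X.Opens)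
    (h : Γ(idealModule i, W)) :
    normalEval i (φ + φ') W h = normalEval i φ W h + normalEval i φ' W h := rfl

lemma normalEval_smul_left (i : Z ⟶ X) {U : Z.Opens} (r : Γ(Z, U)) (φ : NormalSections i U)
    (W : X.Opens) (h : Γ(idealModule i, W)) :
    normalEval i (r • φ) W h = rs inf_le_left r * normalEval i φ W h := rfl

lemma normalEval_ext (i : Z ⟶ X) {U : Z.Opens} {φ φ' : NormalSections i U}
    (h : ∀ W m, normalEval i φ W m = normalEval i φ' W m) : φ = φ' :=
  homSections_pullback_ext i (idealModule i) (structureModule Z) φ φ' h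

/-- Sections of the normal sheaf over a small open subset are given by their values on generators
of the ideal sheaf, subject to the relations between these generators. -/
theorem existsUnique_normalSection (i : Z ⟶ X) {W : X.Opens} {U : Z.Opens} {σ : Type u}
    [Fintype σ] (y : σ → Γ(idealModule i, W)) (v : σ → Γ(Z, U))
    (gen : ∀ (W' : X.Opens) (h : Γ(idealModule i, W')), ∀ x ∈ U, i x ∈ W' →
      ∃ (D : X.Opens) (hD : D ≤ W') (hDW : D ≤ W) (α : σ → Γ(X, D)), i x ∈ D ∧
        res _ hD h = ∑ j, α j • res _ hDW (y j))
    (rel : ∀ (D : X.Opens) (hD : D ≤ W) (α : σ → Γ(X, D)), ∑ j, α j • res _ hD (y j) = 0 →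
      ∑ j, rs (inf_le_right : U ⊓ i ⁻¹ᵁ D ≤ _) (i.app D (α j)) * rs inf_le_left (v j) = 0) :
    ∃! φ : NormalSections i U, ∀ j, normalEval i φ W (y j) = rs inf_le_left (v j) := by
  -- The value ∑ αⱼvⱼ prescribed at ∑ αⱼyⱼ does not depend on the expression chosen: `rel` applies
  -- to the difference of two expressions.
  have rel' : ∀ (D D' E : X.Opens) (hD : D ≤ W) (hD' : D' ≤ W) (hE : E ≤ D) (hE' : E ≤ D')
      (α : σ → Γ(X, D)) (α' : σ → Γ(X, D')),
      res _ hE (∑ j, α j • res _ hD (y j)) = res _ hE' (∑ j, α' j • res _ hD' (y j)) →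
      rs (inf_le_inf_left U (i.preimage_mono hE))
        (∑ j, rs (inf_le_right : U ⊓ i ⁻¹ᵁ D ≤ _) (i.app D (α j)) * rs inf_le_left (v j)) =
      rs (inf_le_inf_left U (i.preimage_mono hE'))
        (∑ j, rs (inf_le_right : U ⊓ i ⁻¹ᵁ D' ≤ _) (i.app D' (α' j)) * rs inf_le_left (v j)) := by
    intro D D' E hD hD' hE hE' α α' heq
    have h := rel E (hE.trans hD) (fun j => rs hE (α j) - rs hE' (α' j)) (by
      simp only [sub_smul, Finset.sum_sub_distrib]
      rw [sub_eq_zero]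
      simpa only [res_sum, res_smul', res_res] using heq)
    simp only [map_sub, sub_mul, Finset.sum_sub_distrib, sub_eq_zero, app_rs, rs_rs] at h
    simpa only [map_sum, map_mul, rs_rs] using h
  -- "t is the value at h", tested locally on expressions of h through the generators. Values exist
  -- by gluing, are unique by `rel'`, and uniqueness then yields additivity, linearity and
  -- compatibility with restriction.
  let Rel : ∀ W' : X.Opens, Γ(idealModule i, W') → Γ(Z, U ⊓ i ⁻¹ᵁ W') → Prop := fun W' h t =>
    ∀ x ∈ U, i x ∈ W' → ∃ (D : X.Opens) (hD : D ≤ W') (hDW : D ≤ W) (α : σ → Γ(X, D)), i x ∈ D ∧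
      res _ hD h = ∑ j, α j • res _ hDW (y j) ∧
      rs (inf_le_inf_left U (i.preimage_mono hD)) t =
        ∑ j, rs (inf_le_right : U ⊓ i ⁻¹ᵁ D ≤ _) (i.app D (α j)) * rs inf_le_left (v j)
  have huniq : ∀ W' h t t', Rel W' h t → Rel W' h t' → t = t' := by
    intro W' h t t' ht ht'
    refine eq_of_locally_eq_rs _ _ fun x hx => ?_
    obtain ⟨D, hD, hDW, α, hxD, h1, h2⟩ := ht x hx.1 hx.2
    obtain ⟨D', hD', hDW', α', hxD', h1', h2'⟩ := ht' x hx.1 hx.2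
    refine ⟨U ⊓ i ⁻¹ᵁ (D ⊓ D'), inf_le_inf_left U (i.preimage_mono (inf_le_left.trans hD)),
      ⟨hx.1, hxD, hxD'⟩, ?_⟩
    have := rel' D D' (D ⊓ D') hDW hDW' inf_le_left inf_le_right α α' (by
      rw [← h1, ← h1', res_res, res_res])
    rwa [← h2, ← h2', rs_rs, rs_rs] at this
  have hex : ∀ W' h, ∃ t, Rel W' h t := by
    intro W' h
    choose D hD hDW α hxD hα using fun x : (U ⊓ i ⁻¹ᵁ W' : Z.Opens) => gen W' h x.1 x.2.1 x.2.2
    obtain ⟨t, ht, -⟩ := existsUnique_rs (U ⊓ i ⁻¹ᵁ W') (fun x => U ⊓ i ⁻¹ᵁ D x)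
      (fun x => inf_le_inf_left U (i.preimage_mono (hD x)))
      (fun x hx => Opens.mem_iSup.mpr ⟨⟨x, hx⟩, hx.1, hxD ⟨x, hx⟩⟩)
      (fun x => ∑ j, rs (inf_le_right : U ⊓ i ⁻¹ᵁ D x ≤ _) (i.app (D x) (α x j)) *
        rs inf_le_left (v j)) (fun x x' => by
        have := rel' (D x) (D x') (D x ⊓ D x') (hDW x) (hDW x') inf_le_left inf_le_right (α x)
          (α x') (by rw [← hα, ← hα, res_res, res_res])
        have e : (U ⊓ i ⁻¹ᵁ D x) ⊓ (U ⊓ i ⁻¹ᵁ D x') ≤ U ⊓ i ⁻¹ᵁ (D x ⊓ D x') :=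
          fun z hz => ⟨hz.1.1, hz.1.2, hz.2.2⟩
        have := congrArg (rs e) this
        rwa [rs_rs, rs_rs] at this)
    exact ⟨t, fun x hx hxW => ⟨D ⟨x, hx, hxW⟩, hD _, hDW _, α _, hxD _, hα _, ht ⟨x, hx, hxW⟩⟩⟩
  choose ψ hψ using hex
  obtain ⟨φ, hφ⟩ := exists_homSections_pullback i (idealModule i) (structureModule Z) U ψ
    (fun W' m m' => by
      refine huniq _ _ _ _ (hψ _ _) fun x hx hxW => ?_
      obtain ⟨D, hD, hDW, α, hxD, h1, h2⟩ := hψ W' m x hx hxW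
      obtain ⟨D', hD', hDW', α', hxD', h1', h2'⟩ := hψ W' m' x hx hxW
      refine ⟨D ⊓ D', inf_le_left.trans hD, inf_le_left.trans hDW,
        fun j => rs inf_le_left (α j) + rs inf_le_right (α' j), ⟨hxD, hxD'⟩, ?_, ?_⟩
      · have e1 := congrArg (res _ (inf_le_left : D ⊓ D' ≤ D)) h1
        have e2 := congrArg (res _ (inf_le_right : D ⊓ D' ≤ D')) h1'
        simp only [res_sum, res_smul', res_res] at e1 e2
        simp only [add_smul, Finset.sum_add_distrib]
        rw [← e1, ← e2, res_add]
      · have e1 := congrArg (rs (inf_le_inf_left U (i.preimage_mono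
          (inf_le_left : D ⊓ D' ≤ D)))) h2
        have e2 := congrArg (rs (inf_le_inf_left U (i.preimage_mono
          (inf_le_right : D ⊓ D' ≤ D')))) h2'
        simp only [map_sum, map_mul, rs_rs] at e1 e2
        simp only [map_add, add_mul, Finset.sum_add_distrib, app_rs, rs_rs]
        rw [← e1, ← e2]
        exact map_add (rs _) _ _)
    (fun W' r m => by
      refine huniq _ _ _ _ (hψ _ _) fun x hx hxW => ?_
      obtain ⟨D, hD, hDW, α, hxD, h1, h2⟩ := hψ W' m x hx hxW
      refine ⟨D, hD, hDW, fun j => rs hD r * α j, hxD, ?_, ?_⟩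
      · rw [res_smul', h1, Finset.smul_sum]
        simp only [mul_smul]
      · refine (map_mul (rs (inf_le_inf_left U (i.preimage_mono hD))) _ _).trans ?_
        rw [h2, Finset.mul_sum]
        refine Finset.sum_congr rfl fun j _ => ?_
        rw [map_mul, map_mul, app_rs, rs_rs, mul_assoc]
        congr 1
        exact rs_rs _ _ _)
    (fun {W' W''} hW m => by
      refine huniq _ _ _ _ (hψ _ _) fun x hx hxW => ?_
      obtain ⟨D, hD, hDW, α, hxD, h1, h2⟩ := hψ W' m x hx (hW hxW)
      refine ⟨D ⊓ W'', inf_le_right, inf_le_left.trans hDW, fun j => rs inf_le_left (α j),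
        ⟨hxD, hxW⟩, ?_, ?_⟩
      · have e1 := congrArg (res _ (inf_le_left : D ⊓ W'' ≤ D)) h1
        simp only [res_sum, res_smul', res_res] at e1
        rw [← e1, res_res]
      · have e1 := congrArg (rs (inf_le_inf_left U (i.preimage_mono
          (inf_le_left : D ⊓ W'' ≤ D)))) h2
        simp only [map_sum, map_mul, rs_rs] at e1
        simp only [app_rs, rs_rs]
        rw [← e1]
        exact rs_rs _ _ _)
  have hφ' : ∀ W' m, normalEval i φ W' m = ψ W' m := hφ
  refine ⟨φ, fun j => ?_, fun φ' hφ'' => ?_⟩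
  · rw [hφ']
    refine huniq _ _ _ _ (hψ _ _) fun x hx hxW => ?_
    classical
    refine ⟨W, le_rfl, le_rfl, Pi.single j 1, hxW, ?_, ?_⟩
    · rw [Finset.sum_eq_single j]
      · simp
      · intro b _ hb; simp [hb]
      · simp
    · rw [Finset.sum_eq_single j]
      · simp [rs_rs]
      · intro b _ hb; simp [hb]
      · simp
  · refine normalEval_ext i fun W' m => ?_
    rw [hφ']
    refine huniq W' m _ _ (fun x hx hxW => ?_) (hψ _ _)
    obtain ⟨D, hD, hDW, α, hxD, h1⟩ := gen W' m x hx hxW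
    refine ⟨D, hD, hDW, α, hxD, h1, ?_⟩
    rw [← normalEval_res i φ' hD m, h1, normalEval_sum]
    refine Finset.sum_congr rfl fun j _ => ?_
    rw [normalEval_res, hφ'', rs_rs]

end NormalSections

/-! ### Inverse images of ideal sheaves -/

section Comap

variable {X Y : Scheme.{u}}

/-- Both inclusions come from the Galois connection between inverse and direct images of ideal
sheaves, an ideal sheaf on an affine scheme being determined by its global sections. -/
lemma ideal_comap_top [IsAffine X] [IsAffine Y] (I : Y.IdealSheafData) (f : X ⟶ Y) :
    (I.comap f).ideal ⟨⊤, isAffineOpen_top X⟩ =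
      (I.ideal ⟨⊤, isAffineOpen_top Y⟩).map f.appTop.hom := by
  apply le_antisymm
  · have : I.comap f ≤ Scheme.IdealSheafData.ofIdealTop
        ((I.ideal ⟨⊤, isAffineOpen_top Y⟩).map f.appTop.hom) := by
      rw [← Scheme.IdealSheafData.le_map_iff_comap_le]
      apply Scheme.IdealSheafData.le_of_isAffine
      rw [Scheme.IdealSheafData.ideal_map _ _ _ (isAffineOpen_top X)]
      refine Ideal.le_comap_map.trans (Ideal.comap_mono ?_)
      exact (Scheme.IdealSheafData.equivOfIsAffine.apply_symm_apply
        ((I.ideal ⟨⊤, isAffineOpen_top Y⟩).map f.appTop.hom)).ge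
    refine (this ⟨⊤, isAffineOpen_top X⟩).trans ?_
    exact (Scheme.IdealSheafData.equivOfIsAffine.apply_symm_apply
        ((I.ideal ⟨⊤, isAffineOpen_top Y⟩).map f.appTop.hom)).le
  · rw [Ideal.map_le_iff_le_comap]
    have := (I.le_map_comap f) ⟨⊤, isAffineOpen_top Y⟩
    rwa [Scheme.IdealSheafData.ideal_map _ _ _ (isAffineOpen_top X)] at this

lemma ideal_comap_ι (I : X.IdealSheafData) (U : X.affineOpens) :
    (I.comap U.1.ι).ideal ⟨⊤, @isAffineOpen_top _ U.2⟩ =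
      (I.ideal U).map (U.1.topIso.inv).hom := by
  rw [Scheme.IdealSheafData.ideal_comap_of_isOpenImmersion]
  have h : (⟨U.1.ι ''ᵁ ⊤, (@isAffineOpen_top _ U.2).image_of_isOpenImmersion U.1.ι⟩ :
    X.affineOpens) ≤ U := by simp
  rw [← I.map_ideal h, Scheme.Opens.ι_appIso]
  exact Ideal.comap_id _

/-- The inverse image of an ideal sheaf on affine open subsets. -/
lemma ideal_comap (I : Y.IdealSheafData) (f : X ⟶ Y) (U : Y.affineOpens) (V : X.affineOpens)
    (e : V.1 ≤ f ⁻¹ᵁ U.1) :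
    (I.comap f).ideal V = (I.ideal U).map (f.appLE U.1 V.1 e).hom := by
  have : IsAffine U.1 := U.2
  have : IsAffine V.1 := V.2
  have h1 := congrArg (fun g => I.comap g) (f.resLE_comp_ι e)
  simp only [Scheme.IdealSheafData.comap_comp] at h1
  have h2 := congrArg (fun J => J.ideal ⟨⊤, isAffineOpen_top _⟩) h1
  dsimp only at h2
  rw [ideal_comap_top, ideal_comap_ι, ideal_comap_ι, Ideal.map_map] at h2
  have h3 := congrArg (Ideal.map V.1.topIso.hom.hom) h2
  rw [Ideal.map_map, Ideal.map_map] at h3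
  have e1 : V.1.topIso.hom.hom.comp V.1.topIso.inv.hom = RingHom.id _ := by
    rw [← CommRingCat.hom_comp, Iso.inv_hom_id]; rfl
  rw [e1, Ideal.map_id] at h3
  rw [← h3]
  congr 1
  rw [← CommRingCat.hom_comp, ← CommRingCat.hom_comp]
  congr 1
  rw [Scheme.Hom.appTop, Scheme.Hom.resLE_app_top]
  simp only [Category.assoc, Iso.inv_hom_id, Category.comp_id, Iso.inv_hom_id_assoc]

end Comap

/-! ### Affine blowup algebras -/

section BlowupAlgebra

/-- `B` is the algebra `P[1/a, F/g]`, with `v = F/g`. -/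
structure IsBlowupAlgebra {P B : Type u} [CommRing P] [CommRing B] (F g a : P) (ι : P →+* B)
    (v : B) : Prop where
  injective : Function.Injective ι
  mul_eq : ι g * v = ι F
  isUnit : IsUnit (ι a)
  exists_eq : ∀ b, ∃ (n : ℕ) (q : Polynomial P), ι a ^ n * b = q.eval₂ ι v
  exists_lift : ∀ (S : Type u) [CommRing S] (φ : P →+* S) (w : S), φ g ∈ nonZeroDivisors S →
    φ g * w = φ F → IsUnit (φ a) → ∃ ψ : B →+* S, ψ.comp ι = φ

variable {P : Type u} [CommRing P]

/-- With n = deg q, clearing denominators in q(F/g) = 0 gives ∑ qᵢFⁱgⁿ⁻ⁱ = 0 in P. Its image under φ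
is φ(g)ⁿ times the value of q at w, and φ(g) is a nonzerodivisor. -/
lemma eval₂_eq_zero_of_aeval_div_eq_zero [IsDomain P] {F g : P} (hg : g ≠ 0) {S : Type u}
    [CommRing S] (φ : P →+* S) (w : S) (hφ : φ g ∈ nonZeroDivisors S) (hw : φ g * w = φ F)
    (q : Polynomial P) (hq : Polynomial.aeval (algebraMap P (FractionRing P) F /
      algebraMap P (FractionRing P) g) q = 0) : q.eval₂ φ w = 0 := by
  have hg' : algebraMap P (FractionRing P) g ≠ 0 := by
    simpa using hg
  have h1 : (∑ i ∈ Finset.range (q.natDegree + 1),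
      q.coeff i * F ^ i * g ^ (q.natDegree - i)) = 0 := by
    apply IsFractionRing.injective P (FractionRing P)
    rw [Polynomial.aeval_eq_sum_range] at hq
    rw [map_sum, map_zero, ← mul_zero (algebraMap P (FractionRing P) g ^ q.natDegree), ← hq,
      Finset.mul_sum]
    refine Finset.sum_congr rfl fun i hi => ?_
    have hi' : i ≤ q.natDegree := by simpa [Nat.lt_succ_iff] using hi
    rw [Algebra.smul_def, div_pow, map_mul, map_mul, map_pow, map_pow]
    conv_rhs => rw [← Nat.sub_add_cancel hi', pow_add]
    field_simp
  have h2 : φ g ^ q.natDegree * q.eval₂ φ w = 0 := by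
    rw [Polynomial.eval₂_eq_sum_range, Finset.mul_sum, ← map_zero φ, ← h1, map_sum]
    refine Finset.sum_congr rfl fun i hi => ?_
    have hi' : i ≤ q.natDegree := by simpa [Nat.lt_succ_iff] using hi
    rw [map_mul, map_mul, map_pow, map_pow, ← hw]
    conv_lhs => rw [← Nat.sub_add_cancel hi', pow_add]
    ring
  exact (mul_left_mem_nonZeroDivisors_eq_zero_iff (pow_mem hφ _)).mp h2

/-- B is the subring P[F/g] of the fraction field, localized at a. Homomorphisms out of P[F/g] are
obtained from the polynomial ring, where `eval₂_eq_zero_of_aeval_div_eq_zero` says that they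
descend. -/
lemma exists_isBlowupAlgebra [IsDomain P] (F g a : P) (hg : g ≠ 0) (ha : a ≠ 0) :
    ∃ (B : Type u) (_ : CommRing B) (_ : IsDomain B) (ι : P →+* B) (v : B),
      IsBlowupAlgebra F g a ι v := by
  let K := FractionRing P
  let v : K := algebraMap P K F / algebraMap P K g
  have hg' : algebraMap P K g ≠ 0 := by simpa using hg
  let A : Subalgebra P K := (Polynomial.aeval v).range
  let θ : Polynomial P →+* A := (Polynomial.aeval v).rangeRestrict.toRingHom
  have hθ : Function.Surjective θ := (Polynomial.aeval v).rangeRestrict_surjective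
  have hθC : ∀ p, θ (Polynomial.C p) = algebraMap P A p := fun p => by
    apply Subtype.ext
    exact Polynomial.aeval_C v p
  have hθv : ∀ q, (θ q : K) = Polynomial.aeval v q := fun q => rfl
  have hinj : Function.Injective (algebraMap P A) := by
    intro p p' h
    exact IsFractionRing.injective P K (congrArg Subtype.val h)
  have ha' : algebraMap P A a ≠ 0 := by
    simpa using hinj.ne ha
  let B := Localization.Away (algebraMap P A a)
  have hle : Submonoid.powers (algebraMap P A a) ≤ nonZeroDivisors A :=
    powers_le_nonZeroDivisors_of_noZeroDivisors ha'
  have hB : IsDomain B := IsLocalization.isDomain_localization hle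
  have hAB : Function.Injective (algebraMap A B) := IsLocalization.injective B hle
  refine ⟨B, inferInstance, hB, (algebraMap A B).comp (algebraMap P A),
    algebraMap A B (θ Polynomial.X), hAB.comp hinj, ?_, ?_, ?_, ?_⟩
  · rw [RingHom.comp_apply, RingHom.comp_apply, ← map_mul]
    congr 1
    apply Subtype.ext
    change algebraMap P K g * (θ Polynomial.X : K) = algebraMap P K F
    rw [hθv, Polynomial.aeval_X]
    exact mul_div_cancel₀ _ hg'
  · exact IsLocalization.Away.algebraMap_isUnit (algebraMap P A a)
  · intro b
    obtain ⟨n, x, hx⟩ := IsLocalization.Away.surj (algebraMap P A a) b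
    obtain ⟨q, rfl⟩ := hθ x
    refine ⟨n, q, ?_⟩
    rw [RingHom.comp_apply, mul_comm, hx, ← Polynomial.hom_eval₂]
    congr 1
    rw [← Polynomial.eval₂_C_X (p := q), Polynomial.hom_eval₂, Polynomial.eval₂_C_X]
    congr 1
    exact RingHom.ext hθC
  · intro S _ φ w hφ hw hφa
    let e : Polynomial P →+* S := Polynomial.eval₂RingHom φ w
    have hker : ∀ q, θ q = 0 → e q = 0 := fun q hq =>
      eval₂_eq_zero_of_aeval_div_eq_zero hg φ w hφ hw q
        (by rw [← hθv, hq]; rfl)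
    let ψ : A →+* S := RingHom.liftOfSurjective θ hθ ⟨e, hker⟩
    have hψ : ∀ q, ψ (θ q) = e q := fun q =>
      RingHom.liftOfRightInverse_comp_apply _ _ _ ⟨e, hker⟩ q
    have hψP : ∀ p, ψ (algebraMap P A p) = φ p := fun p => by
      rw [← hθC, hψ]; exact Polynomial.eval₂_C _ _
    refine ⟨IsLocalization.Away.lift (S := B) (algebraMap P A a) (g := ψ) (by rwa [hψP]), ?_⟩
    ext p
    simp [hψP]

/-- The equation gv = F fixes the image of v as soon as g maps to a nonzerodivisor; inverting a adds
no freedom. -/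
lemma IsBlowupAlgebra.hom_ext {B : Type u} [CommRing B] {F g a : P} {ι : P →+* B} {v : B}
    (h : IsBlowupAlgebra F g a ι v) {S : Type u} [CommRing S] {ψ ψ' : B →+* S}
    (heq : ψ.comp ι = ψ'.comp ι) (hg : ψ (ι g) ∈ nonZeroDivisors S) : ψ = ψ' := by
  have hp : ∀ p, ψ (ι p) = ψ' (ι p) := fun p => RingHom.congr_fun heq p
  have hv : ψ v = ψ' v := by
    apply (mul_cancel_left_mem_nonZeroDivisors hg).mp
    conv_rhs => rw [hp]
    rw [← map_mul, ← map_mul, h.mul_eq, hp]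
  ext b
  obtain ⟨n, q, hq⟩ := h.exists_eq b
  have hu : IsUnit (ψ (ι a)) := h.isUnit.map ψ
  apply (hu.pow n).mul_left_cancel
  have hpn : ψ (ι a) ^ n * ψ' b = ψ' (ι a ^ n * b) := by rw [hp, map_mul, map_pow]
  rw [hpn, ← map_pow, ← map_mul, hq, Polynomial.hom_eval₂, Polynomial.hom_eval₂,
    heq, hv]

end BlowupAlgebra

/-! ### Charts of a blowup -/

section BlowupChart

/-- The ring homomorphism given by a morphism to an affine scheme. -/
def specHom {E : Scheme.{u}} {B : Type u} [CommRing B] (p : E ⟶ Spec (CommRingCat.of B)) :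
    B →+* Γ(E, ⊤) := ((Scheme.ΓSpecIso (CommRingCat.of B)).inv ≫ p.appTop).hom

lemma specHom_injective {E : Scheme.{u}} {B : Type u} [CommRing B]
    {p p' : E ⟶ Spec (CommRingCat.of B)} (h : specHom p = specHom p') : p = p' := by
  apply ext_of_isAffine
  rw [← cancel_epi (Scheme.ΓSpecIso (CommRingCat.of B)).inv]
  exact CommRingCat.hom_ext h

lemma specHom_comp {E : Scheme.{u}} {A B : Type u} [CommRing A] [CommRing B]
    (p : E ⟶ Spec (CommRingCat.of B)) (φ : A →+* B) :
    specHom (p ≫ Spec.map (CommRingCat.ofHom φ)) = (specHom p).comp φ := by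
  have : (Scheme.ΓSpecIso (CommRingCat.of A)).inv ≫ (Spec.map (CommRingCat.ofHom φ)).appTop =
      CommRingCat.ofHom φ ≫ (Scheme.ΓSpecIso (CommRingCat.of B)).inv :=
    (Scheme.ΓSpecIso_inv_naturality (CommRingCat.ofHom φ)).symm
  unfold specHom
  rw [Scheme.Hom.comp_appTop, reassoc_of% this]
  rfl

lemma mem_basicOpen_specHom {E : Scheme.{u}} {B : Type u} [CommRing B]
    (p : E ⟶ Spec (CommRingCat.of B)) (b : B) (x : E) :
    x ∈ E.basicOpen (specHom p b) ↔ b ∉ (p x).asIdeal := by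
  change x ∈ E.basicOpen (p.appTop.hom ((Scheme.ΓSpecIso (CommRingCat.of B)).inv.hom b)) ↔ _
  have := Scheme.preimage_basicOpen_top p ((Scheme.ΓSpecIso (CommRingCat.of B)).inv.hom b)
  rw [← this, basicOpen_eq_of_affine]
  exact (PrimeSpectrum.mem_basicOpen b (p x)).trans Iff.rfl

/-- Either E is empty, or it is integral and its image, open in the irreducible Spec B, meets the
locus where b is invertible. -/
lemma specHom_mem_nonZeroDivisors {E : Scheme.{u}} {B : Type u} [CommRing B] [IsDomain B]
    (p : E ⟶ Spec (CommRingCat.of B)) [IsOpenImmersion p] {b : B} (hb : b ≠ 0) :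
    specHom p b ∈ nonZeroDivisors Γ(E, ⊤) := by
  rcases isEmpty_or_nonempty E with h | h
  · rw [mem_nonZeroDivisors_iff_right]
    intro x _
    exact Subsingleton.elim _ _
  · have : AlgebraicGeometry.IsIntegral E := isIntegral_of_isOpenImmersion p
    rw [mem_nonZeroDivisors_iff_ne_zero]
    intro h0
    have h1 : ∀ x : E, b ∈ (p x).asIdeal := fun x => by
      by_contra hx
      rw [← mem_basicOpen_specHom, h0, Scheme.basicOpen_zero] at hx
      exact hx
    have h2 : (Set.range p ∩ (PrimeSpectrum.basicOpen b : Set (PrimeSpectrum B))).Nonempty := by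
      refine nonempty_preirreducible_inter p.isOpenEmbedding.isOpen_range
        (PrimeSpectrum.basicOpen b).isOpen (Set.range_nonempty _) ?_
      exact ⟨(⊥ : PrimeSpectrum B), (PrimeSpectrum.mem_basicOpen _ _).mpr (by simpa using hb)⟩
    obtain ⟨_, ⟨x, rfl⟩, hx⟩ := h2
    exact hx (h1 x)

variable {X Y : Scheme.{u}} {C : Y.IdealSheafData} {π : X ⟶ Y}

/-- The ideal sheaf `C` is generated by `F` and `g` on the locus where `a` is invertible. -/
def IsGeneratedBy (C : Y.IdealSheafData) (U : Y.affineOpens) (F g a : Γ(Y, U.1)) : Prop :=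
  a * F ∈ C.ideal U ∧ a * g ∈ C.ideal U ∧ ∀ c ∈ C.ideal U, a * c ∈ Ideal.span {F, g}

lemma IsGeneratedBy.map_eq {U : Y.affineOpens} {F g a : Γ(Y, U.1)} (h : IsGeneratedBy C U F g a)
    {S : Type u} [CommRing S] (φ : Γ(Y, U.1) →+* S) (ha : IsUnit (φ a)) :
    (C.ideal U).map φ = Ideal.span {φ F, φ g} := by
  apply le_antisymm
  · rw [Ideal.map_le_iff_le_comap]
    intro c hc
    rw [Ideal.mem_comap, ← Ideal.unit_mul_mem_iff_mem _ ha, ← map_mul]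
    have := Ideal.mem_map_of_mem φ (h.2.2 c hc)
    rwa [Ideal.map_span, Set.image_pair] at this
  · rw [Ideal.span_le]
    rintro x (rfl | rfl)
    · rw [SetLike.mem_coe, ← Ideal.unit_mul_mem_iff_mem _ ha, ← map_mul]
      exact Ideal.mem_map_of_mem φ h.1
    · rw [SetLike.mem_coe, ← Ideal.unit_mul_mem_iff_mem _ ha, ← map_mul]
      exact Ideal.mem_map_of_mem φ h.2.1

lemma ideal_comap_fromSpec (U : Y.affineOpens) {S : Type u} [CommRing S]
    (φ : Γ(Y, U.1) →+* S) :
    (C.comap (Spec.map (CommRingCat.ofHom φ) ≫ U.2.fromSpec)).ideal ⟨⊤, isAffineOpen_top _⟩ =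
      (C.ideal U).map ((Scheme.ΓSpecIso (CommRingCat.of S)).inv.hom.comp φ) := by
  have e : (⊤ : (Spec (CommRingCat.of S)).Opens) ≤
      (Spec.map (CommRingCat.ofHom φ) ≫ U.2.fromSpec) ⁻¹ᵁ U.1 := by
    rw [Scheme.Hom.comp_preimage, U.2.fromSpec_preimage_self]
    exact le_rfl
  rw [ideal_comap C _ U ⟨⊤, isAffineOpen_top _⟩ e]
  congr 1
  rw [Scheme.Hom.comp_appLE, U.2.fromSpec_app_self]
  have : (Scheme.ΓSpecIso Γ(Y, U.1)).inv ≫ (Spec.map (CommRingCat.ofHom φ)).appTop =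
      CommRingCat.ofHom φ ≫ (Scheme.ΓSpecIso (CommRingCat.of S)).inv :=
    (Scheme.ΓSpecIso_inv_naturality (CommRingCat.ofHom φ)).symm
  have h2 := congrArg CommRingCat.Hom.hom this
  rw [CommRingCat.hom_comp, CommRingCat.hom_comp] at h2
  refine Eq.trans ?_ h2
  rw [← CommRingCat.hom_comp]
  congr 1

/-- Since F = gv in B, the ideal of C becomes (g) on Spec B, and the universal property gives h :
Spec B → X. Conversely, where the exceptional ideal is (g), F is a multiple of g, so V maps to Spec
B over Y. This map is the projection of V ×_X Spec B, that is, a base change of the open immersion V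
→ X; nothing needs to be known about h itself. -/
lemma exists_blowupChart (hπ : IsBlowup C π) {U : Y.affineOpens} {F g a : Γ(Y, U.1)}
    (hg : g ≠ 0) (hgen : IsGeneratedBy C U F g a) {B : Type u} [CommRing B] [IsDomain B]
    {ι : Γ(Y, U.1) →+* B} {v : B} (hB : IsBlowupAlgebra F g a ι v) :
    ∃ h : Spec (CommRingCat.of B) ⟶ X, ∀ (V : X.affineOpens) (e : V.1 ≤ π ⁻¹ᵁ U.1),
      (C.comap π).ideal V = Ideal.span {(π.appLE U.1 V.1 e).hom g} →
      (π.appLE U.1 V.1 e).hom g ∈ nonZeroDivisors Γ(X, V.1) →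
      IsUnit ((π.appLE U.1 V.1 e).hom a) →
      ∃ ψ : B →+* Γ(X, V.1), ψ.comp ι = (π.appLE U.1 V.1 e).hom ∧
        IsOpenImmersion (Spec.map (CommRingCat.ofHom ψ)) ∧
        Spec.map (CommRingCat.ofHom ψ) ≫ h = V.2.fromSpec := by
  have hUo : IsOpenImmersion U.2.fromSpec := U.2.isOpenImmersion_fromSpec
  have hιg : ι g ≠ 0 := fun h0 => hg (hB.injective (h0.trans (map_zero ι).symm))
  let q : Spec (CommRingCat.of B) ⟶ Y := Spec.map (CommRingCat.ofHom ι) ≫ U.2.fromSpec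
  have hq : IsEffectiveCartier (C.comap q) := by
    intro x
    refine ⟨⟨⊤, isAffineOpen_top _⟩, trivial, (Scheme.ΓSpecIso (CommRingCat.of B)).inv.hom (ι g),
      ?_, ?_⟩
    · have := specHom_mem_nonZeroDivisors (𝟙 (Spec (CommRingCat.of B))) hιg
      simpa [specHom] using this
    · rw [ideal_comap_fromSpec, ← Ideal.map_map, hgen.map_eq ι hB.isUnit, ← hB.mul_eq,
        Ideal.map_span, Set.image_pair]
      rw [Ideal.span_pair_eq_span_right_iff_dvd.mpr (by rw [map_mul]; exact dvd_mul_right _ _)]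
  obtain ⟨h, hh, -⟩ := hπ.2 _ q hq
  refine ⟨h, fun V e hV hVg hVa => ?_⟩
  have hF : (π.appLE U.1 V.1 e).hom F ∈ Ideal.span {(π.appLE U.1 V.1 e).hom g} := by
    rw [← hV, ideal_comap C π U V e, hgen.map_eq _ hVa]
    exact Ideal.subset_span (by simp)
  have hVo : IsOpenImmersion V.2.fromSpec := V.2.isOpenImmersion_fromSpec
  obtain ⟨w, hw⟩ := Ideal.mem_span_singleton'.mp hF
  obtain ⟨ψ, hψ⟩ := hB.exists_lift Γ(X, V.1) (π.appLE U.1 V.1 e).hom w hVg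
    ((mul_comm _ _).trans hw) hVa
  have hkq : Spec.map (CommRingCat.ofHom ψ) ≫ q = V.2.fromSpec ≫ π := by
    rw [← IsAffineOpen.SpecMap_appLE_fromSpec π U.2 V.2 e, ← Category.assoc, ← Spec.map_comp,
      ← CommRingCat.ofHom_comp, hψ]
    rfl
  have hCart : IsEffectiveCartier (C.comap (V.2.fromSpec ≫ π)) := by
    intro x
    refine ⟨⟨⊤, isAffineOpen_top _⟩, trivial,
      (Scheme.ΓSpecIso Γ(X, V.1)).inv.hom ((π.appLE U.1 V.1 e).hom g), ?_, ?_⟩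
    · have := MulEquivClass.map_nonZeroDivisors
        ((Scheme.ΓSpecIso Γ(X, V.1)).symm.commRingCatIsoToRingEquiv)
      exact this.le ⟨_, hVg, rfl⟩
    · rw [Scheme.IdealSheafData.comap_comp]
      have := ideal_comap_fromSpec (C := C.comap π) V (RingHom.id Γ(X, V.1))
      rw [CommRingCat.ofHom_id, Spec.map_id, Category.id_comp, RingHom.comp_id] at this
      refine this.trans ?_
      rw [hV, Ideal.map_span, Set.image_singleton]
      rfl
  have hkh : Spec.map (CommRingCat.ofHom ψ) ≫ h = V.2.fromSpec := by
    refine (hπ.2 _ _ hCart).unique ?_ rfl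
    rw [Category.assoc, hh, hkq]
  refine ⟨ψ, hψ, ?_, hkh⟩
  let k := Spec.map (CommRingCat.ofHom ψ)
  -- Two maps to Spec B that agree over Y: `hom_ext` applies because the fibre product is open in
  -- Spec B, so g remains a nonzerodivisor on it.
  have h1 : pullback.fst V.2.fromSpec h ≫ k = pullback.snd V.2.fromSpec h := by
    apply specHom_injective
    have h2 : (specHom (pullback.fst V.2.fromSpec h ≫ k)).comp ι =
        (specHom (pullback.snd V.2.fromSpec h)).comp ι := by
      rw [← specHom_comp, ← specHom_comp]
      congr 1
      rw [← cancel_mono U.2.fromSpec]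
      change ((pullback.fst V.2.fromSpec h ≫ k) ≫ Spec.map (CommRingCat.ofHom ι)) ≫
        U.2.fromSpec = (pullback.snd V.2.fromSpec h ≫ Spec.map (CommRingCat.ofHom ι)) ≫
        U.2.fromSpec
      have e1 : pullback.fst V.2.fromSpec h ≫ k ≫ q = pullback.snd V.2.fromSpec h ≫ q := by
        rw [hkq, ← hh, pullback.condition_assoc]
      simpa only [Category.assoc] using e1
    refine (hB.hom_ext h2.symm ?_).symm
    exact specHom_mem_nonZeroDivisors (pullback.snd V.2.fromSpec h) hιg
  let s : Spec Γ(X, V.1) ⟶ pullback V.2.fromSpec h := pullback.lift (𝟙 _) k (by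
    rw [Category.id_comp]; exact hkh.symm)
  have hs1 : s ≫ pullback.fst V.2.fromSpec h = 𝟙 _ := pullback.lift_fst _ _ _
  have hs2 : pullback.fst V.2.fromSpec h ≫ s = 𝟙 _ := by
    rw [← cancel_mono (pullback.snd V.2.fromSpec h), Category.assoc, pullback.lift_snd, h1,
      Category.id_comp]
  have : IsIso s := ⟨_, hs1, hs2⟩
  have hk : k = s ≫ pullback.snd V.2.fromSpec h := (pullback.lift_snd _ _ _).symm
  change IsOpenImmersion k
  rw [hk]
  infer_instance

end BlowupChart

/-! ### Lifting a closed immersion to a blowup -/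

section Lift

lemma mem_basicOpen_appLE {X Y : Scheme.{u}} (π : X ⟶ Y) {U : Y.Opens} {V : X.Opens}
    (e : V ≤ π ⁻¹ᵁ U) (p : Γ(Y, U)) (z : X) :
    z ∈ X.basicOpen ((π.appLE U V e).hom p) ↔ z ∈ V ∧ π z ∈ Y.basicOpen p := by
  have := congrArg (fun D : X.Opens => z ∈ D) (Scheme.basicOpen_appLE π V U e p)
  exact iff_of_eq this

lemma appLE_appLE {W X Y : Scheme.{u}} (f : W ⟶ X) (π : X ⟶ Y) {U : Y.Opens} {V : X.Opens}
    {V' : W.Opens} (e : V ≤ π ⁻¹ᵁ U) (e' : V' ≤ f ⁻¹ᵁ V) (e'' : V' ≤ (f ≫ π) ⁻¹ᵁ U) (p : Γ(Y, U)) :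
    (f.appLE V V' e').hom ((π.appLE U V e).hom p) = ((f ≫ π).appLE U V' e'').hom p := by
  rw [← Scheme.Hom.appLE_comp_appLE _ _ U V V' e e']
  rfl

lemma rs_appLE {X Y : Scheme.{u}} (π : X ⟶ Y) {U : Y.Opens} {V V' : X.Opens}
    (e : V ≤ π ⁻¹ᵁ U) (h : V' ≤ V) (p : Γ(Y, U)) :
    rs h ((π.appLE U V e).hom p) = (π.appLE U V' (h.trans e)).hom p := by
  rw [← Scheme.Hom.appLE_map π e (homOfLE h).op]
  rfl

lemma appLE_rs {X Y : Scheme.{u}} (π : X ⟶ Y) {U U' : Y.Opens} {V : X.Opens}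
    (h : U' ≤ U) (e : V ≤ π ⁻¹ᵁ U') (p : Γ(Y, U)) :
    (π.appLE U' V e).hom (rs h p) = (π.appLE U V (e.trans (π.preimage_mono h))).hom p := by
  rw [← Scheme.Hom.map_appLE π e (homOfLE h).op]
  rfl

lemma isUnit_appLE {X Y : Scheme.{u}} (π : X ⟶ Y) {U : Y.Opens} {V : X.Opens}
    (a : Γ(Y, U)) (e : V ≤ π ⁻¹ᵁ Y.basicOpen a) :
    IsUnit ((π.appLE U V (e.trans (π.preimage_mono (Y.basicOpen_le a)))).hom a) := by
  rw [← appLE_rs π (Y.basicOpen_le a) e]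
  exact IsUnit.map _ (RingedSpace.isUnit_res_basicOpen _ a)

lemma rs_mem_nonZeroDivisors {X : Scheme.{u}} (V : X.affineOpens) (r : Γ(X, V.1))
    {d : Γ(X, V.1)} (hd : d ∈ nonZeroDivisors Γ(X, V.1)) :
    rs (X.basicOpen_le r) d ∈ nonZeroDivisors Γ(X, X.basicOpen r) := by
  have := V.2.isLocalization_basicOpen r
  exact IsLocalization.map_nonZeroDivisors_le (Submonoid.powers r) Γ(X, X.basicOpen r) ⟨d, hd, rfl⟩

lemma appLE_ne_zero {P Y : Scheme.{u}} [AlgebraicGeometry.IsIntegral P] (j : P ⟶ Y) {U : Y.Opens}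
    {g : Γ(Y, U)} (hg : j.app U g ≠ 0) {V : P.Opens} (e : V ≤ j ⁻¹ᵁ U) (hV : (V : Set P).Nonempty) :
    (j.appLE U V e).hom g ≠ 0 := by
  have : Nonempty V := hV.to_subtype
  intro h0
  exact hg (map_injective_of_isIntegral P (homOfLE e)
    (h0.trans (map_zero (P.presheaf.map (homOfLE e).op).hom).symm))

variable {X Y : Scheme.{u}} {C : Y.IdealSheafData} {π : X ⟶ Y}

/-- The affine open subset `V` of the blowup lies in the chart where the exceptional divisor is
given by `g`. -/
structure InChart (C : Y.IdealSheafData) (π : X ⟶ Y) (U : Y.affineOpens) (g a : Γ(Y, U.1))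
    (V : X.affineOpens) : Prop where
  le : V.1 ≤ π ⁻¹ᵁ U.1
  ideal_eq : (C.comap π).ideal V = Ideal.span {(π.appLE U.1 V.1 le).hom g}
  mem_nonZeroDivisors : (π.appLE U.1 V.1 le).hom g ∈ nonZeroDivisors Γ(X, V.1)
  isUnit : IsUnit ((π.appLE U.1 V.1 le).hom a)

/-- Near z the exceptional ideal has a generator d, with F = F'd and g = g'd. Since F and g generate
the same ideal as d, the functions F' and g' generate the unit ideal, so one of them is invertible
at z. -/
lemma exists_inChart_or (hE : IsEffectiveCartier (C.comap π)) {U : Y.affineOpens}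
    {F g a : Γ(Y, U.1)} (hgen : IsGeneratedBy C U F g a) {z : X} (ha : π z ∈ Y.basicOpen a) :
    ∃ V : X.affineOpens, z ∈ V.1 ∧ (InChart C π U g a V ∨ ∃ e : V.1 ≤ π ⁻¹ᵁ U.1,
      (π.appLE U.1 V.1 e).hom g ∈ Ideal.span {(π.appLE U.1 V.1 e).hom F}) := by
  obtain ⟨V₀, hz, d₀, hd₀, hid₀⟩ := hE z
  obtain ⟨r, hr, hzr⟩ := V₀.2.exists_basicOpen_le (V := π ⁻¹ᵁ Y.basicOpen a) ⟨z, ha⟩ hz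
  let V₁ : X.affineOpens := ⟨X.basicOpen r, V₀.2.basicOpen r⟩
  have h10 : V₁ ≤ V₀ := X.basicOpen_le r
  let d : Γ(X, V₁.1) := rs (X.basicOpen_le r) d₀
  have hd : d ∈ nonZeroDivisors Γ(X, V₁.1) := rs_mem_nonZeroDivisors V₀ r hd₀
  have e : V₁.1 ≤ π ⁻¹ᵁ U.1 := hr.trans (π.preimage_mono (Y.basicOpen_le a))
  have hid : (C.comap π).ideal V₁ = Ideal.span {d} := by
    rw [← (C.comap π).map_ideal h10, hid₀, Ideal.map_span, Set.image_singleton]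
    rfl
  have hua : IsUnit ((π.appLE U.1 V₁.1 e).hom a) := isUnit_appLE π a hr
  have hspan := ideal_comap C π U V₁ e
  rw [hid, hgen.map_eq _ hua] at hspan
  obtain ⟨F', hF'⟩ := Ideal.mem_span_singleton'.mp
    (hspan.ge (Ideal.subset_span (by simp) : (π.appLE U.1 V₁.1 e).hom F ∈ _))
  obtain ⟨g', hg'⟩ := Ideal.mem_span_singleton'.mp
    (hspan.ge (Ideal.subset_span (by simp) : (π.appLE U.1 V₁.1 e).hom g ∈ _))
  obtain ⟨α, β, hαβ⟩ := Ideal.mem_span_pair.mp (hspan.le (Ideal.mem_span_singleton_self d))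
  have h1 : α * F' + β * g' = 1 := by
    apply (mul_cancel_right_mem_nonZeroDivisors hd).mp
    rw [← hF', ← hg'] at hαβ
    linear_combination hαβ
  by_cases hzg : z ∈ X.basicOpen g'
  · refine ⟨⟨X.basicOpen g', V₁.2.basicOpen g'⟩, hzg, Or.inl ?_⟩
    have h21 : X.basicOpen g' ≤ V₁.1 := X.basicOpen_le g'
    have hug : IsUnit (rs h21 g') := RingedSpace.isUnit_res_basicOpen _ g'
    have hgd : (π.appLE U.1 (X.basicOpen g') (h21.trans e)).hom g = rs h21 g' * rs h21 d := by
      rw [← rs_appLE π e h21, ← hg', map_mul]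
    refine ⟨h21.trans e, ?_, ?_, ?_⟩
    · rw [← (C.comap π).map_ideal (U := ⟨X.basicOpen g', V₁.2.basicOpen g'⟩) (V := V₁) h21, hid,
        Ideal.map_span, Set.image_singleton, hgd, Ideal.span_singleton_mul_left_unit hug]
      rfl
    · rw [hgd]
      exact mul_mem hug.mem_nonZeroDivisors (rs_mem_nonZeroDivisors V₁ g' hd)
    · rw [← rs_appLE π e h21]
      exact hua.map _
  · have hzF : z ∈ X.basicOpen F' := by
      rw [Scheme.mem_basicOpen X _ z (show z ∈ V₁.1 from hzr)] at hzg ⊢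
      have h2 := congrArg (X.presheaf.germ V₁.1 z hzr).hom h1
      rw [map_add, map_mul, map_mul, map_one] at h2
      rcases IsLocalRing.isUnit_or_isUnit_of_add_one h2 with h3 | h3
      · exact isUnit_of_mul_isUnit_right h3
      · exact absurd (isUnit_of_mul_isUnit_right h3) hzg
    refine ⟨⟨X.basicOpen F', V₁.2.basicOpen F'⟩, hzF, Or.inr ?_⟩
    have h21 : X.basicOpen F' ≤ V₁.1 := X.basicOpen_le F'
    have huF : IsUnit (rs h21 F') := RingedSpace.isUnit_res_basicOpen _ F'
    refine ⟨h21.trans e, ?_⟩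
    rw [← rs_appLE π e h21, ← rs_appLE π e h21, ← hF', ← hg', map_mul, map_mul,
      Ideal.span_singleton_mul_left_unit huF]
    exact Ideal.mul_mem_left _ _ (Ideal.mem_span_singleton_self _)

/-- A chart of the blowup along `C` adapted to the morphism `j`. -/
structure IsAdapted {P : Scheme.{u}} (C : Y.IdealSheafData) (j : P ⟶ Y) (U : Y.affineOpens)
    (F g a : Γ(Y, U.1)) : Prop where
  isGeneratedBy : IsGeneratedBy C U F g a
  app_eq_zero : j.app U.1 F = 0
  app_ne_zero : j.app U.1 g ≠ 0

/-- In the other chart g is a multiple of F. Pulled back to P this would make g zero on a nonempty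
open subset, hence zero on the preimage of U, as F is. -/
lemma exists_inChart_of_mem_closure {P : Scheme.{u}} [AlgebraicGeometry.IsIntegral P] {f : P ⟶ X}
    (hE : IsEffectiveCartier (C.comap π)) {U : Y.affineOpens} {F g a : Γ(Y, U.1)}
    (hA : IsAdapted C (f ≫ π) U F g a) {z : X} (ha : π z ∈ Y.basicOpen a)
    (hz : z ∈ closure (Set.range f)) :
    ∃ V : X.affineOpens, z ∈ V.1 ∧ InChart C π U g a V := by
  obtain ⟨V, hzV, h | ⟨e, hg⟩⟩ := exists_inChart_or hE hA.isGeneratedBy ha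
  · exact ⟨V, hzV, h⟩
  exfalso
  obtain ⟨_, hx, ⟨x, rfl⟩⟩ := mem_closure_iff.mp hz V.1 V.1.isOpen hzV
  obtain ⟨c, hc⟩ := Ideal.mem_span_singleton'.mp hg
  have h1 := congrArg (f.appLE V.1 (f ⁻¹ᵁ V.1) le_rfl).hom hc
  have e' : f ⁻¹ᵁ V.1 ≤ (f ≫ π) ⁻¹ᵁ U.1 := f.preimage_mono e
  rw [map_mul, appLE_appLE _ _ _ _ e', appLE_appLE _ _ _ _ e'] at h1
  have h0 : ((f ≫ π).appLE U.1 (f ⁻¹ᵁ V.1) e').hom F = 0 :=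
    (congrArg (rs e') hA.app_eq_zero).trans (map_zero _)
  rw [h0, mul_zero] at h1
  exact appLE_ne_zero _ hA.app_ne_zero e' ⟨x, hx⟩ h1.symm

/-- The point of the chart of the blowup algebra. -/
lemma exists_chartPoint {U : Y.affineOpens} {B : Type u} [CommRing B]
    {ι : Γ(Y, U.1) →+* B} {V : X.affineOpens} (e : V.1 ≤ π ⁻¹ᵁ U.1) {ψ : B →+* Γ(X, V.1)}
    (hψ : ψ.comp ι = (π.appLE U.1 V.1 e).hom) {h : Spec (CommRingCat.of B) ⟶ X}
    (hh : Spec.map (CommRingCat.ofHom ψ) ≫ h = V.2.fromSpec) {z : X} (hz : z ∈ V.1) :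
    ∃ t : PrimeSpectrum B, h t = z ∧ (∀ b, b ∈ t.asIdeal ↔ z ∉ X.basicOpen (ψ b)) ∧
      ∀ p, ι p ∈ t.asIdeal ↔ π z ∉ Y.basicOpen p := by
  have h1 : ∀ b, b ∈ (PrimeSpectrum.comap ψ (V.2.primeIdealOf ⟨z, hz⟩)).asIdeal ↔
      z ∉ X.basicOpen (ψ b) := fun b => by
    have h2 := V.2.fromSpec_primeIdealOf ⟨z, hz⟩
    have h3 : V.2.primeIdealOf ⟨z, hz⟩ ∈ V.2.fromSpec ⁻¹ᵁ X.basicOpen (ψ b) ↔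
        ψ b ∉ (V.2.primeIdealOf ⟨z, hz⟩).asIdeal := by
      rw [V.2.fromSpec_preimage_basicOpen]
      exact PrimeSpectrum.mem_basicOpen _ _
    rw [PrimeSpectrum.comap_asIdeal, Ideal.mem_comap, ← not_iff_not, ← h3, not_not]
    change V.2.fromSpec (V.2.primeIdealOf ⟨z, hz⟩) ∈ X.basicOpen (ψ b) ↔ _
    rw [h2]
  refine ⟨PrimeSpectrum.comap ψ (V.2.primeIdealOf ⟨z, hz⟩), ?_, h1, fun p => ?_⟩
  · have := V.2.fromSpec_primeIdealOf ⟨z, hz⟩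
    rw [← hh] at this
    exact this
  · rw [h1, ← RingHom.comp_apply, hψ, mem_basicOpen_appLE]
    simp [hz]

/-- Modulo v, a polynomial in v is its constant term, so up to the unit a every element of B comes
from P. Thus the locus v = 0 injects into Spec P. -/
lemma IsBlowupAlgebra.eq_of_mem {P B : Type u} [CommRing P] [CommRing B] {F g a : P} {ι : P →+* B}
    {v : B} (h : IsBlowupAlgebra F g a ι v) {t t' : PrimeSpectrum B} (hv : v ∈ t.asIdeal)
    (hv' : v ∈ t'.asIdeal) (hp : ∀ p, ι p ∈ t.asIdeal ↔ ι p ∈ t'.asIdeal) : t = t' := by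
  have key : ∀ (t : PrimeSpectrum B), v ∈ t.asIdeal → ∀ (b : B) (n : ℕ) (q : Polynomial P),
      ι a ^ n * b = q.eval₂ ι v → (b ∈ t.asIdeal ↔ ι (q.coeff 0) ∈ t.asIdeal) := by
    intro t hv b n q hq
    rw [← Ideal.unit_mul_mem_iff_mem _ (h.isUnit.pow n), hq, ← Polynomial.divX_mul_X_add q]
    simp only [Polynomial.eval₂_add, Polynomial.eval₂_mul, Polynomial.eval₂_X, Polynomial.eval₂_C,
      Polynomial.coeff_add, Polynomial.coeff_mul_X_zero, Polynomial.coeff_C_zero, zero_add]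
    exact Ideal.add_mem_iff_right _ (Ideal.mul_mem_left _ _ hv)
  ext b
  obtain ⟨n, q, hq⟩ := h.exists_eq b
  rw [key t hv b n q hq, key t' hv' b n q hq, hp]

variable {P : Scheme.{u}} [AlgebraicGeometry.IsIntegral P] {f : P ⟶ X}

/-- The coordinate `F / g` vanishes on the lift. -/
lemma appLE_eq_zero {U : Y.affineOpens} {F g a : Γ(Y, U.1)}
    (hA : IsAdapted C (f ≫ π) U F g a) {B : Type u} [CommRing B]
    {ι : Γ(Y, U.1) →+* B} {v : B} (hB : ι g * v = ι F) {V : X.affineOpens}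
    (e : V.1 ≤ π ⁻¹ᵁ U.1) {ψ : B →+* Γ(X, V.1)} (hψ : ψ.comp ι = (π.appLE U.1 V.1 e).hom)
    {D : P.Opens} (hD : D ≤ f ⁻¹ᵁ V.1) : (f.appLE V.1 D hD).hom (ψ v) = 0 := by
  rcases (D : Set P).eq_empty_or_nonempty with hemp | hne
  · have : D = ⊥ := by ext1; exact hemp
    subst this
    exact Subsingleton.elim _ _
  have : Nonempty D := hne.to_subtype
  have e' : D ≤ (f ≫ π) ⁻¹ᵁ U.1 := hD.trans (f.preimage_mono e)
  have hψ' : ∀ p, ψ (ι p) = (π.appLE U.1 V.1 e).hom p := fun p => RingHom.congr_fun hψ p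
  have h1 := congrArg (f.appLE V.1 D hD).hom (congrArg ψ hB)
  rw [map_mul, hψ', hψ', map_mul, appLE_appLE _ _ _ _ e', appLE_appLE _ _ _ _ e'] at h1
  have h0 : ((f ≫ π).appLE U.1 D e').hom F = 0 :=
    (congrArg (rs e') hA.app_eq_zero).trans (map_zero _)
  rw [h0] at h1
  exact (mul_eq_zero.mp h1).resolve_left (appLE_ne_zero _ hA.app_ne_zero _ hne)

/-- The points z and f x have the same image in Y, and both lie in the chart Spec B at v = 0, so
they coincide by `eq_of_mem`. At z one has v = 0 either by continuity, v being zero on the image of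
f, or because v = F/g where g is invertible. -/
lemma mem_range_of_mem_closure_or (hπ : IsBlowup C π) {U : Y.affineOpens}
    [IsDomain Γ(Y, U.1)] {F g a : Γ(Y, U.1)} (hA : IsAdapted C (f ≫ π) U F g a) {z : X} {x : P}
    (ha : π z ∈ Y.basicOpen a) (hx : (f ≫ π) x = π z)
    (hz : z ∈ closure (Set.range f) ∨ π z ∈ Y.basicOpen g) : z ∈ Set.range f := by
  have hg0 : g ≠ 0 := fun h => hA.app_ne_zero (by rw [h, map_zero])
  have ha0 : a ≠ 0 := fun h => by
    rw [h, Scheme.basicOpen_zero] at ha; exact ha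
  have hF : π z ∉ Y.basicOpen F := by
    intro hF
    rw [← hx] at hF
    have h1 : x ∈ (f ≫ π) ⁻¹ᵁ Y.basicOpen F := hF
    rw [Scheme.preimage_basicOpen, hA.app_eq_zero, Scheme.basicOpen_zero] at h1
    exact h1
  have hgood : ∀ z', π z' = π z → (z' ∈ closure (Set.range f) ∨ π z' ∈ Y.basicOpen g) →
      ∃ V : X.affineOpens, z' ∈ V.1 ∧ InChart C π U g a V := by
    intro z' hz' h
    rcases h with h | h
    · exact exists_inChart_of_mem_closure hπ.1 hA (hz' ▸ ha) h
    · obtain ⟨V, hzV, h' | ⟨e, hg⟩⟩ := exists_inChart_or hπ.1 hA.isGeneratedBy (z := z') (hz' ▸ ha)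
      · exact ⟨V, hzV, h'⟩
      · exfalso
        obtain ⟨c, hc⟩ := Ideal.mem_span_singleton'.mp hg
        have h1 : z' ∈ X.basicOpen ((π.appLE U.1 V.1 e).hom g) :=
          (mem_basicOpen_appLE π e g z').mpr ⟨hzV, h⟩
        rw [← hc, Scheme.basicOpen_mul] at h1
        exact hF (hz' ▸ ((mem_basicOpen_appLE π e F z').mp h1.2).2)
  obtain ⟨B, _, _, ι, v, hB⟩ := exists_isBlowupAlgebra F g a hg0 ha0
  obtain ⟨h, hh⟩ := exists_blowupChart hπ hg0 hA.isGeneratedBy hB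
  have hpt : ∀ z', π z' = π z → (z' ∈ closure (Set.range f) ∨ π z' ∈ Y.basicOpen g) →
      ∃ t : PrimeSpectrum B, h t = z' ∧ v ∈ t.asIdeal ∧
        ∀ p, ι p ∈ t.asIdeal ↔ π z ∉ Y.basicOpen p := by
    intro z' hz' h'
    obtain ⟨V, hzV, hV⟩ := hgood z' hz' h'
    obtain ⟨ψ, hψ, -, hψh⟩ := hh V hV.le hV.ideal_eq hV.mem_nonZeroDivisors hV.isUnit
    obtain ⟨t, ht, htb, htp⟩ := exists_chartPoint hV.le hψ hψh hzV
    refine ⟨t, ht, ?_, fun p => by rw [htp, hz']⟩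
    rcases h' with h' | h'
    · rw [htb]
      intro hzv
      obtain ⟨_, hx1, ⟨x1, rfl⟩⟩ := mem_closure_iff.mp h' _ (X.basicOpen (ψ v)).isOpen hzv
      have h0 := appLE_eq_zero hA hB.mul_eq hV.le hψ (D := f ⁻¹ᵁ V.1) le_rfl
      have h1 : x1 ∈ P.basicOpen ((f.appLE V.1 (f ⁻¹ᵁ V.1) le_rfl).hom (ψ v)) :=
        (mem_basicOpen_appLE f le_rfl (ψ v) x1).mpr ⟨X.basicOpen_le _ hx1, hx1⟩
      rw [h0, Scheme.basicOpen_zero] at h1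
      exact h1
    · have h1 : ι g * v ∈ t.asIdeal := by
        rw [hB.mul_eq, htp, hz']; exact hF
      exact (t.isPrime.mem_or_mem h1).resolve_left fun h2 => (htp g).mp h2 h'
  obtain ⟨t, ht, htv, htp⟩ := hpt z rfl hz
  obtain ⟨t', ht', htv', htp'⟩ := hpt (f x) hx (Or.inl (subset_closure ⟨x, rfl⟩))
  have := hB.eq_of_mem htv htv' fun p => by rw [htp, htp']
  exact ⟨x, by rw [← ht', ← this, ht]⟩

/-- There are adapted charts around every point. -/
def HasAdaptedCharts (C : Y.IdealSheafData) (j : P ⟶ Y) : Prop :=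
  ∀ x : P, ∃ (U : Y.affineOpens) (F g a : Γ(Y, U.1)), IsDomain Γ(Y, U.1) ∧
    j x ∈ Y.basicOpen a ∧ IsAdapted C j U F g a

/-- Being an embedding and being surjective on stalks are inherited from the composite. Only
closedness of the image is at stake, since π is not assumed to be separated. -/
lemma isClosedImmersion_lift (hπ : IsBlowup C π) [IsClosedImmersion (f ≫ π)]
    (H : HasAdaptedCharts C (f ≫ π)) : IsClosedImmersion f := by
  have h1 : Topology.IsEmbedding (f ≫ π) := (f ≫ π).isEmbedding
  have h2 : Topology.IsEmbedding f := Topology.IsEmbedding.of_comp f.continuous π.continuous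
    (by simpa using h1)
  have h3 : SurjectiveOnStalks f := SurjectiveOnStalks.of_comp f π
  have h4 : IsPreimmersion f := ⟨h2⟩
  refine IsClosedImmersion.of_isPreimmersion f ?_
  refine isClosed_of_closure_subset fun z hz => ?_
  have h5 : IsClosed (Set.range (f ≫ π)) := (f ≫ π).isClosedEmbedding.isClosed_range
  have h6 : π z ∈ Set.range (f ≫ π) := by
    rw [← h5.closure_eq]
    refine closure_mono ?_ (image_closure_subset_closure_image π.continuous ⟨z, hz, rfl⟩)
    rintro _ ⟨_, ⟨x, rfl⟩, rfl⟩
    exact ⟨x, by simp⟩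
  obtain ⟨x, hx⟩ := h6
  obtain ⟨U, F, g, a, _, ha, hA⟩ := H x
  exact mem_range_of_mem_closure_or hπ hA (hx ▸ ha) hx (Or.inl hz)

/-- Outside C the functions F and g have no common zero; F vanishes at π z, so g is invertible
there. -/
lemma mem_range_of_notMem_support (hπ : IsBlowup C π) (H : HasAdaptedCharts C (f ≫ π)) {z : X}
    (hz : π z ∈ Set.range (f ≫ π)) (hz' : π z ∉ C.support) : z ∈ Set.range f := by
  obtain ⟨x, hx⟩ := hz
  obtain ⟨U, F, g, a, _, ha, hA⟩ := H x
  rw [hx] at ha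
  refine mem_range_of_mem_closure_or hπ hA ha hx (Or.inr ?_)
  by_contra hg
  refine hz' ?_
  have hU : π z ∈ U.1 := Y.basicOpen_le a ha
  rw [Scheme.IdealSheafData.mem_support_iff_of_mem hU, Scheme.mem_zeroLocus_iff]
  intro c hc
  have hF : π z ∉ Y.basicOpen F := by
    intro hF
    rw [← hx] at hF
    have h1 : x ∈ (f ≫ π) ⁻¹ᵁ Y.basicOpen F := hF
    rw [Scheme.preimage_basicOpen, hA.app_eq_zero, Scheme.basicOpen_zero] at h1
    exact h1
  obtain ⟨α, β, h⟩ := Ideal.mem_span_pair.mp (hA.isGeneratedBy.2.2 c hc)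
  rw [Scheme.mem_basicOpen Y _ _ hU] at hF hg ha ⊢
  intro hc'
  have h' := congrArg (Y.presheaf.germ U.1 (π z) hU).hom h
  have hu : IsUnit ((Y.presheaf.germ U.1 (π z) hU).hom (a * c)) := by
    rw [map_mul]; exact ha.mul hc'
  rw [← h', map_add, map_mul, map_mul] at hu
  rcases IsLocalRing.isUnit_or_isUnit_of_isUnit_add hu with h3 | h3
  · exact hF (isUnit_of_mul_isUnit_right h3)
  · exact hg (isUnit_of_mul_isUnit_right h3)

end Lift

/-! ### The strict transform -/

section StrictTransform

variable {X Y P : Scheme.{u}} {C : Y.IdealSheafData} {π : X ⟶ Y}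

lemma ker_eq_vanishingIdeal_of_isReduced {f : P ⟶ X} [IsReduced P] :
    f.ker = Scheme.IdealSheafData.vanishingIdeal (.closure (Set.range f)) := by
  rw [← Scheme.IdealSheafData.map_bot, ← Scheme.nilradical_eq_bot,
    ← Scheme.IdealSheafData.vanishingIdeal_top, Scheme.IdealSheafData.map_vanishingIdeal]
  congr 2
  simp

/-- The strict transform of the image of `j` is the image of a lift of `j` to the blowup. -/
theorem exists_iso_strictTransform [AlgebraicGeometry.IsIntegral P] (hπ : IsBlowup C π) (j : P ⟶ Y)
    [IsClosedImmersion j] (hj : IsEffectiveCartier (C.comap j)) (H : HasAdaptedCharts C j)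
    (L : Y.IdealSheafData) (hL : (L.support : Set Y) = Set.range j)
    (hne : ∃ x, j x ∉ C.support) :
    ∃ e : P ≅ (strictTransform π C L).subscheme,
      e.hom ≫ (strictTransform π C L).subschemeι ≫ π = j := by
  obtain ⟨f, rfl, -⟩ := hπ.2 P j hj
  have hf : IsClosedImmersion f := isClosedImmersion_lift hπ H
  have hcl : closure (π ⁻¹' ((L.support : Set Y) \ (C.support : Set Y))) = Set.range f := by
    apply subset_antisymm
    · refine closure_minimal (fun z hz => ?_) f.isClosedEmbedding.isClosed_range
      exact mem_range_of_notMem_support hπ H (hL ▸ hz.1) hz.2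
    -- The part of P outside C is a nonempty open subset of an irreducible space, hence dense, so
    -- the closure of its image contains the whole image.
    · have hd : Dense (((f ≫ π) ⁻¹' (C.support : Set Y))ᶜ) := by
        refine IsOpen.dense ?_ hne
        exact (C.support.isClosed.preimage (f ≫ π).continuous).isOpen_compl
      rw [← Set.image_univ, ← hd.closure_eq]
      refine (image_closure_subset_closure_image f.continuous).trans (closure_mono ?_)
      rintro _ ⟨x, hx, rfl⟩
      refine ⟨?_, fun h => hx (by simpa using h)⟩
      rw [hL]
      exact ⟨x, by simp⟩
  have hker : f.ker = strictTransform π C L := by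
    rw [ker_eq_vanishingIdeal_of_isReduced]
    unfold strictTransform
    congr 1
    ext1
    refine Eq.trans ?_ hcl.symm
    rw [Closeds.coe_closure, f.isClosedEmbedding.isClosed_range.closure_eq]
  rw [← hker]
  have : IsIso f.toImage := inferInstance
  refine ⟨asIso f.toImage, ?_⟩
  have h1 : f.toImage ≫ f.ker.subschemeι = f := f.toImage_imageι
  rw [asIso_hom, reassoc_of% h1]

end StrictTransform

/-! ### Local structure of the conormal sheaf -/

section LocalConormal

/-- An open immersion induces isomorphisms of local rings, and the local ring of the domain B
consists of fractions of elements of B and contains B. Functions near a point of the blowup can thus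
be computed inside B. -/
lemma exists_mul_eq_of_isOpenImmersion {B S : Type u} [CommRing B] [CommRing S] [IsDomain B]
    (ψ : B →+* S) (hψ : IsOpenImmersion (Spec.map (CommRingCat.ofHom ψ))) (q : PrimeSpectrum S)
    (T : Type u) [CommRing T] [Algebra S T] [IsLocalization.AtPrime T q.asIdeal] :
    (∀ σ : T, ∃ b₁ b₂ : B, IsUnit (algebraMap S T (ψ b₂)) ∧
      σ * algebraMap S T (ψ b₂) = algebraMap S T (ψ b₁)) ∧
    ∀ b : B, algebraMap S T (ψ b) = 0 → b = 0 := by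
  obtain ⟨p, hpp, hp, hbij⟩ : ∃ (p : Ideal B) (_ : p.IsPrime) (hp : p = q.asIdeal.comap ψ),
      Function.Bijective (Localization.localRingHom p q.asIdeal ψ hp) := by
    have h1 : ∀ x, IsIso ((Spec.map (CommRingCat.ofHom ψ)).stalkMap x) := fun x => inferInstance
    have h2 := (MorphismProperty.isomorphisms CommRingCat).arrow_mk_iso_iff
      (Scheme.arrowStalkMapSpecIso (CommRingCat.ofHom ψ) q)
    have h3 := h2.mp (h1 q)
    exact ⟨(q.comap ψ).asIdeal, (q.comap ψ).isPrime, rfl,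
      (ConcreteCategory.isIso_iff_bijective _).mp h3⟩
  let e := IsLocalization.algEquiv q.asIdeal.primeCompl (Localization.AtPrime q.asIdeal) T
  have he : ∀ b, e (Localization.localRingHom p q.asIdeal ψ hp (algebraMap B _ b)) =
      algebraMap S T (ψ b) := fun b => by
    rw [Localization.localRingHom_to_map, AlgEquiv.commutes]
  constructor
  · intro σ
    obtain ⟨τ, hτ⟩ := hbij.2 (e.symm σ)
    obtain ⟨⟨b₁, b₂⟩, hb⟩ := IsLocalization.surj p.primeCompl τ
    have hb₂ : ψ b₂ ∈ q.asIdeal.primeCompl := fun h => b₂.2 (hp.ge h)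
    refine ⟨b₁, b₂, IsLocalization.map_units T (⟨ψ b₂, hb₂⟩ : q.asIdeal.primeCompl), ?_⟩
    have := congrArg (fun t => e (Localization.localRingHom p q.asIdeal ψ hp t)) hb
    dsimp only at this
    rw [map_mul, map_mul, hτ, he, he, AlgEquiv.apply_symm_apply] at this
    exact this
  · intro b hb
    rw [← he, EmbeddingLike.map_eq_zero_iff] at hb
    have := hbij.1 (hb.trans (map_zero _).symm)
    exact (IsLocalization.to_map_eq_zero_iff _ p.primeCompl_le_nonZeroDivisors).mp this

variable {X Y Z : Scheme.{u}} {C : Y.IdealSheafData} {π : X ⟶ Y}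

lemma exists_local_fraction {B : Type u} [CommRing B] [IsDomain B] {V : X.affineOpens}
    {ψ : B →+* Γ(X, V.1)} (hψ : IsOpenImmersion (Spec.map (CommRingCat.ofHom ψ))) {W : X.Opens}
    (s : Γ(X, W)) {z : X} (hzV : z ∈ V.1) (hzW : z ∈ W) :
    ∃ (D : X.Opens) (hDW : D ≤ W) (hDV : D ≤ V.1) (b₁ b₂ : B), z ∈ D ∧
      IsUnit (rs hDV (ψ b₂)) ∧ rs hDW s * rs hDV (ψ b₂) = rs hDV (ψ b₁) := by
  let := X.presheaf.algebra_section_stalk ⟨z, hzV⟩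
  have := V.2.isLocalization_stalk ⟨z, hzV⟩
  obtain ⟨b₁, b₂, hu, hb⟩ := (exists_mul_eq_of_isOpenImmersion ψ hψ (V.2.primeIdealOf ⟨z, hzV⟩)
    (X.presheaf.stalk z)).1 ((X.presheaf.germ W z hzW).hom s)
  have hb' : (X.presheaf.germ (W ⊓ V.1) z ⟨hzW, hzV⟩).hom (rs inf_le_left s * rs inf_le_right (ψ b₂)) =
      (X.presheaf.germ (W ⊓ V.1) z ⟨hzW, hzV⟩).hom (rs inf_le_right (ψ b₁)) := by
    rw [map_mul]
    have e1 := X.presheaf.germ_res_apply (homOfLE (inf_le_left : W ⊓ V.1 ≤ W)) z ⟨hzW, hzV⟩ s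
    have e2 := X.presheaf.germ_res_apply (homOfLE (inf_le_right : W ⊓ V.1 ≤ V.1)) z ⟨hzW, hzV⟩
    have e3 := e2 (ψ b₁)
    have e4 := e2 (ψ b₂)
    exact (congrArg₂ (· * ·) e1 e4).trans (hb.trans e3.symm)
  obtain ⟨D, hzD, i₁, i₂, hD⟩ := X.presheaf.germ_eq z _ _ _ _ hb'
  have hzD' : z ∈ X.basicOpen (ψ b₂) := (Scheme.mem_basicOpen X _ z hzV).mpr hu
  refine ⟨D ⊓ X.basicOpen (ψ b₂), inf_le_left.trans (i₁.le.trans inf_le_left),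
    inf_le_right.trans (X.basicOpen_le _), b₁, b₂, ⟨hzD, hzD'⟩, ?_, ?_⟩
  · rw [← rs_rs (X.basicOpen_le (ψ b₂)) inf_le_right]
    exact IsUnit.map _ (RingedSpace.isUnit_res_basicOpen _ (ψ b₂))
  · have h1 : rs i₁.le (rs inf_le_left s * rs inf_le_right (ψ b₂)) =
      rs i₂.le (rs inf_le_right (ψ b₁)) := hD
    have h2 := congrArg (rs (inf_le_left : D ⊓ X.basicOpen (ψ b₂) ≤ D)) h1
    simpa only [map_mul, rs_rs] using h2

lemma eq_zero_of_rs_eq_zero {B : Type u} [CommRing B] [IsDomain B] {V : X.affineOpens}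
    {ψ : B →+* Γ(X, V.1)} (hψ : IsOpenImmersion (Spec.map (CommRingCat.ofHom ψ))) {D : X.Opens}
    (hD : D ≤ V.1) {z : X} (hz : z ∈ D) {b : B} (hb : rs hD (ψ b) = 0) : b = 0 := by
  let := X.presheaf.algebra_section_stalk ⟨z, hD hz⟩
  have := V.2.isLocalization_stalk ⟨z, hD hz⟩
  refine (exists_mul_eq_of_isOpenImmersion ψ hψ (V.2.primeIdealOf ⟨z, hD hz⟩)
    (X.presheaf.stalk z)).2 b ?_
  have e1 := X.presheaf.germ_res_apply (homOfLE hD) z hz (ψ b)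
  refine e1.symm.trans ?_
  exact (congrArg (X.presheaf.germ D z hz).hom hb).trans (map_zero _)

/-- The functions `y₁`, `y₂` are local equations, with independent differentials, of the image of
`j`. -/
structure IsConormalFrame (j : Z ⟶ Y) (U : Y.affineOpens) (y₁ y₂ : Γ(Y, U.1)) : Prop where
  app₁ : j.app U.1 y₁ = 0
  app₂ : j.app U.1 y₂ = 0
  exists_eq : ∀ r, j.app U.1 r = 0 → ∃ α β, r = α * y₁ + β * y₂
  indep : ∀ α β, α * y₁ + β * y₂ ∈ Ideal.span {y₁, y₂} ^ 2 → j.app U.1 α = 0 ∧ j.app U.1 β = 0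

/-- Every positive power of v = F/g contributes a factor F once denominators are cleared. The free
exponent k allows several polynomials to be brought to one power of g. -/
lemma exists_pow_mul_eval₂ {P B : Type u} [CommRing P] [CommRing B] {F g : P} {ι : P →+* B}
    {v : B} (h : ι g * v = ι F) (q : Polynomial P) : ∃ (n : ℕ) (r : P), ∀ k,
      ι (g ^ (n + k)) * q.eval₂ ι v = ι (g ^ k * (g ^ n * q.coeff 0 + F * r)) := by
  suffices ∃ (n : ℕ) (r : P), ι (g ^ n) * q.eval₂ ι v = ι (g ^ n * q.coeff 0 + F * r) by
    obtain ⟨n, r, hr⟩ := this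
    refine ⟨n, r, fun k => ?_⟩
    rw [map_mul, ← hr, pow_add, map_mul]; ring
  have key : ∀ q : Polynomial P, ∃ (n : ℕ) (r : P), ι (g ^ n) * q.eval₂ ι v = ι r := by
    intro q
    induction q using Polynomial.induction_on' with
    | add p q hp hq =>
      obtain ⟨n, r, hr⟩ := hp
      obtain ⟨n', r', hr'⟩ := hq
      refine ⟨n + n', g ^ n' * r + g ^ n * r', ?_⟩
      rw [Polynomial.eval₂_add, map_add, map_mul, map_mul, ← hr, ← hr', pow_add, map_mul]
      ring
    | monomial n c =>
      refine ⟨n, c * F ^ n, ?_⟩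
      rw [Polynomial.eval₂_monomial, map_pow, map_mul, map_pow, ← h]
      ring
  obtain ⟨n, r, hr⟩ := key q.divX
  refine ⟨n + 1, r, ?_⟩
  conv_lhs => rw [← Polynomial.divX_mul_X_add q]
  rw [Polynomial.eval₂_add, Polynomial.eval₂_mul, Polynomial.eval₂_X, Polynomial.eval₂_C, map_add,
    map_mul, map_mul, ← hr, ← h, map_pow, map_pow]
  ring

/-- A relation between the generators `y₁`, `y₂`, `v` of the ideal of the strict transform is a
consequence, to first order, of `y₁ a₁ + y₂ a₂ = g v`. -/
lemma exists_mem_span_sq {P B : Type u} [CommRing P] [CommRing B] {y₁ y₂ a₁ a₂ g : P}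
    {ι : P →+* B} (hι : Function.Injective ι) {v : B} (h : ι g * v = ι (y₁ * a₁ + y₂ * a₂))
    (q₁ q₂ q₃ : Polynomial P)
    (hq : q₁.eval₂ ι v * ι y₁ + q₂.eval₂ ι v * ι y₂ + q₃.eval₂ ι v * v = 0) : ∃ n : ℕ,
      g ^ n * (g * q₁.coeff 0 + a₁ * q₃.coeff 0) * y₁ +
        g ^ n * (g * q₂.coeff 0 + a₂ * q₃.coeff 0) * y₂ ∈ Ideal.span {y₁, y₂} ^ 2 := by
  obtain ⟨n₁, r₁, h₁⟩ := exists_pow_mul_eval₂ h q₁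
  obtain ⟨n₂, r₂, h₂⟩ := exists_pow_mul_eval₂ h q₂
  obtain ⟨n₃, r₃, h₃⟩ := exists_pow_mul_eval₂ h q₃
  replace h₁ := h₁ (n₂ + n₃)
  replace h₂ := h₂ (n₁ + n₃)
  replace h₃ := h₃ (n₁ + n₂)
  refine ⟨n₁ + n₂ + n₃, ?_⟩
  set F := y₁ * a₁ + y₂ * a₂ with hF
  have hy₁ : y₁ ∈ Ideal.span {y₁, y₂} := Ideal.subset_span (by simp)
  have hy₂ : y₂ ∈ Ideal.span {y₁, y₂} := Ideal.subset_span (by simp)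
  have hFm : F ∈ Ideal.span {y₁, y₂} :=
    add_mem (Ideal.mul_mem_right _ _ hy₁) (Ideal.mul_mem_right _ _ hy₂)
  -- The relation is multiplied by g to the power n₁ + n₂ + n₃ + 1; the additional factor g turns
  -- the last v into F.
  have h0 : g * (g ^ (n₂ + n₃) * (g ^ n₁ * q₁.coeff 0 + F * r₁)) * y₁ +
      g * (g ^ (n₁ + n₃) * (g ^ n₂ * q₂.coeff 0 + F * r₂)) * y₂ +
      g ^ (n₁ + n₂) * (g ^ n₃ * q₃.coeff 0 + F * r₃) * F = 0 := by
    apply hι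
    rw [map_zero, map_add, map_add, map_mul _ _ y₁, map_mul _ _ y₂, map_mul _ _ F, map_mul ι g,
      map_mul ι g, ← h₁, ← h₂, ← h₃, ← h, ← mul_zero (ι (g ^ (n₁ + n₂ + n₃ + 1))), ← hq]
    simp only [map_pow]
    ring
  -- The terms that are not of first order are multiples of F y₁, F y₂ and F², all in the square of
  -- (y₁, y₂).
  have h4 : g ^ (n₁ + n₂ + n₃) * (g * q₁.coeff 0 + a₁ * q₃.coeff 0) * y₁ +
        g ^ (n₁ + n₂ + n₃) * (g * q₂.coeff 0 + a₂ * q₃.coeff 0) * y₂ =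
      -(g * g ^ (n₂ + n₃) * r₁ * (F * y₁) + g * g ^ (n₁ + n₃) * r₂ * (F * y₂) +
        g ^ (n₁ + n₂) * r₃ * (F * F)) := by
    rw [eq_neg_iff_add_eq_zero, ← h0]
    ring
  rw [h4, pow_two]
  exact neg_mem (add_mem (add_mem (Ideal.mul_mem_left _ _ (Ideal.mul_mem_mul hFm hy₁))
    (Ideal.mul_mem_left _ _ (Ideal.mul_mem_mul hFm hy₂)))
    (Ideal.mul_mem_left _ _ (Ideal.mul_mem_mul hFm hFm)))

end LocalConormal

/-! ### Generators and relations of the ideal of the strict transform -/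

section GeneratorsRelations

variable {X Y Z : Scheme.{u}} {C : Y.IdealSheafData} {π : X ⟶ Y}
variable [AlgebraicGeometry.IsIntegral Z] {i : Z ⟶ X} {U : Y.affineOpens}
  {F g a y₁ y₂ a₁ a₂ : Γ(Y, U.1)} {B : Type u} [CommRing B] {ι : Γ(Y, U.1) →+* B}
  {v : B} {V : X.affineOpens} {ψ : B →+* Γ(X, V.1)}

lemma appLE_eq_zero_iff {P Y : Scheme.{u}} [AlgebraicGeometry.IsIntegral P] (j : P ⟶ Y)
    {U : Y.Opens} {g : Γ(Y, U)} {V : P.Opens} (e : V ≤ j ⁻¹ᵁ U) (hV : (V : Set P).Nonempty) :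
    (j.appLE U V e).hom g = 0 ↔ j.app U g = 0 :=
  ⟨fun h => by_contra fun hg => appLE_ne_zero j hg e hV h,
    fun h => (congrArg (rs e) h).trans (map_zero _)⟩

/-- The pullback to the strict transform of a function in the chart. -/
lemma appLE_eval₂ (hA : IsAdapted C (i ≫ π) U F g a) (hB : ι g * v = ι F)
    (e : V.1 ≤ π ⁻¹ᵁ U.1) (hψ : ψ.comp ι = (π.appLE U.1 V.1 e).hom) {O : Z.Opens}
    (hO : O ≤ i ⁻¹ᵁ V.1) (hO' : O ≤ (i ≫ π) ⁻¹ᵁ U.1) (q : Polynomial Γ(Y, U.1)) :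
    (i.appLE V.1 O hO).hom (ψ (q.eval₂ ι v)) = ((i ≫ π).appLE U.1 O hO').hom (q.coeff 0) := by
  have hψ' : ∀ p, ψ (ι p) = (π.appLE U.1 V.1 e).hom p := fun p => RingHom.congr_fun hψ p
  conv_lhs => rw [← Polynomial.divX_mul_X_add q]
  rw [Polynomial.eval₂_add, Polynomial.eval₂_mul, Polynomial.eval₂_X, Polynomial.eval₂_C, map_add,
    map_add, map_mul, map_mul, appLE_eq_zero hA hB e hψ, mul_zero, zero_add, hψ',
    appLE_appLE _ _ _ _ hO']

variable [IsDomain B]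

/-- Up to units, s is locally a polynomial in v with coefficients in Γ(Y, U). On Z, where v = 0,
only its constant term survives, so this term vanishes on Z and is a combination of y₁ and y₂; the
other terms are multiples of v. -/
lemma exists_generators (hA : IsAdapted C (i ≫ π) U F g a) (hB : IsBlowupAlgebra F g a ι v)
    (e : V.1 ≤ π ⁻¹ᵁ U.1) (hψ : ψ.comp ι = (π.appLE U.1 V.1 e).hom)
    (hψo : IsOpenImmersion (Spec.map (CommRingCat.ofHom ψ)))
    (hY : IsConormalFrame (i ≫ π) U y₁ y₂) {W : X.Opens} (s : Γ(X, W)) (hs : i.app W s = 0)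
    {z : Z} (hzW : i z ∈ W) (hzV : i z ∈ V.1) :
    ∃ (D : X.Opens) (hDW : D ≤ W) (hDV : D ≤ V.1) (c₁ c₂ c₃ : Γ(X, D)), i z ∈ D ∧
      rs hDW s = c₁ * rs hDV ((π.appLE U.1 V.1 e).hom y₁) +
        c₂ * rs hDV ((π.appLE U.1 V.1 e).hom y₂) + c₃ * rs hDV (ψ v) := by
  have hψ' : ∀ p, ψ (ι p) = (π.appLE U.1 V.1 e).hom p := fun p => RingHom.congr_fun hψ p
  obtain ⟨D, hDW, hDV, b₁, b₂, hzD, hu, hb⟩ := exists_local_fraction hψo s hzV hzW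
  refine ⟨D, hDW, hDV, ?_⟩
  obtain ⟨n, q, hq⟩ := hB.exists_eq b₁
  have hO' : i ⁻¹ᵁ D ≤ (i ≫ π) ⁻¹ᵁ U.1 := i.preimage_mono (hDV.trans e)
  have hO : i ⁻¹ᵁ D ≤ i ⁻¹ᵁ V.1 := i.preimage_mono hDV
  have h1 : ((i ≫ π).appLE U.1 (i ⁻¹ᵁ D) hO').hom (q.coeff 0) = 0 := by
    rw [← appLE_eval₂ hA hB.mul_eq e hψ hO hO', ← hq, map_mul, map_mul]
    have h2 := congrArg (i.appLE D (i ⁻¹ᵁ D) le_rfl).hom hb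
    rw [map_mul, appLE_rs, appLE_rs, appLE_rs] at h2
    have h3 : (i.appLE W (i ⁻¹ᵁ D) (i.preimage_mono hDW)).hom s = 0 :=
      (congrArg (rs (i.preimage_mono hDW)) hs).trans (map_zero _)
    rw [h3, zero_mul] at h2
    rw [← h2, mul_zero]
  rw [appLE_eq_zero_iff _ _ ⟨z, hzD⟩] at h1
  obtain ⟨α, β, hαβ⟩ := hY.exists_eq _ h1
  have hu' : IsUnit (rs hDV (ψ (ι a ^ n * b₂))) := by
    rw [map_mul, map_mul]
    exact (((hB.isUnit.pow n).map ψ).map _).mul hu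
  obtain ⟨w, hw⟩ := hu'
  have h4 : rs hDW s * w = rs hDV (ψ (q.eval₂ ι v)) := by
    rw [hw, ← hq, map_mul, map_mul, map_mul, map_mul, ← hb]; ring
  have h5 : rs hDV (ψ (q.eval₂ ι v)) = rs hDV (ψ (ι α)) * rs hDV ((π.appLE U.1 V.1 e).hom y₁) +
      rs hDV (ψ (ι β)) * rs hDV ((π.appLE U.1 V.1 e).hom y₂) +
      rs hDV (ψ (q.divX.eval₂ ι v)) * rs hDV (ψ v) := by
    conv_lhs => rw [← Polynomial.divX_mul_X_add q]
    rw [Polynomial.eval₂_add, Polynomial.eval₂_mul, Polynomial.eval₂_X, Polynomial.eval₂_C, hαβ,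
      ← hψ', ← hψ']
    simp only [map_add, map_mul]
    ring
  refine ⟨↑w⁻¹ * rs hDV (ψ (ι α)), ↑w⁻¹ * rs hDV (ψ (ι β)), ↑w⁻¹ * rs hDV (ψ (q.divX.eval₂ ι v)),
    hzD, ?_⟩
  rw [h5] at h4
  calc rs hDW s = ↑w⁻¹ * (rs hDW s * w) := by rw [mul_comm, mul_assoc, Units.mul_inv, mul_one]
    _ = _ := by rw [h4]; ring

/-- By `exists_mem_span_sq` and the independence of y₁, y₂ modulo squares, the restriction of (c₁,
c₂, c₃) to Z is proportional to (a₁, a₂, −g) over the function field. It therefore annihilates each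
triple with a₁u₁ + a₂u₂ = gw, so such a triple defines a homomorphism on the ideal. -/
lemma relation_apply (hA : IsAdapted C (i ≫ π) U F g a) (hB : IsBlowupAlgebra F g a ι v)
    (e : V.1 ≤ π ⁻¹ᵁ U.1) (hψ : ψ.comp ι = (π.appLE U.1 V.1 e).hom)
    (hψo : IsOpenImmersion (Spec.map (CommRingCat.ofHom ψ)))
    (hY : IsConormalFrame (i ≫ π) U y₁ y₂) (hF : F = y₁ * a₁ + y₂ * a₂)
    {D : X.Opens} (hDV : D ≤ V.1) (c₁ c₂ c₃ : Γ(X, D))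
    (hc : c₁ * rs hDV ((π.appLE U.1 V.1 e).hom y₁) + c₂ * rs hDV ((π.appLE U.1 V.1 e).hom y₂) +
      c₃ * rs hDV (ψ v) = 0) {O : Z.Opens} (hO : O ≤ i ⁻¹ᵁ D) (hO' : O ≤ (i ≫ π) ⁻¹ᵁ U.1)
    (u₁ u₂ w : Γ(Z, O))
    (huw : ((i ≫ π).appLE U.1 O hO').hom a₁ * u₁ + ((i ≫ π).appLE U.1 O hO').hom a₂ * u₂ =
      ((i ≫ π).appLE U.1 O hO').hom g * w) :
    (i.appLE D O hO).hom c₁ * u₁ + (i.appLE D O hO).hom c₂ * u₂ + (i.appLE D O hO).hom c₃ * w =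
      0 := by
  have hψ' : ∀ p, ψ (ι p) = (π.appLE U.1 V.1 e).hom p := fun p => RingHom.congr_fun hψ p
  -- A fraction b₁/b₂ is rewritten with polynomials in v as numerator and denominator; the powers of
  -- a needed for b₁ and b₂ are exchanged crosswise.
  have frac : ∀ (c : Γ(X, D)) {z : X} (hz : z ∈ D), ∃ (E : X.Opens) (hE : E ≤ D)
      (q p : Polynomial Γ(Y, U.1)), z ∈ E ∧ IsUnit (rs (hE.trans hDV) (ψ (p.eval₂ ι v))) ∧
      rs hE c * rs (hE.trans hDV) (ψ (p.eval₂ ι v)) = rs (hE.trans hDV) (ψ (q.eval₂ ι v)) := by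
    intro c z hz
    obtain ⟨E, hE, hEV, b₁, b₂, hzE, hu, hb⟩ := exists_local_fraction hψo c (hDV hz) hz
    obtain ⟨n, q, hq⟩ := hB.exists_eq b₁
    obtain ⟨m, p, hp⟩ := hB.exists_eq b₂
    have hua : IsUnit (rs (hE.trans hDV) (ψ (ι a))) := (hB.isUnit.map ψ).map _
    refine ⟨E, hE, Polynomial.C (a ^ m) * q, Polynomial.C (a ^ n) * p, hzE, ?_, ?_⟩
    · rw [Polynomial.eval₂_mul, Polynomial.eval₂_C, ← hp]
      simp only [map_mul, map_pow]
      exact (hua.pow n).mul ((hua.pow m).mul hu)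
    · rw [Polynomial.eval₂_mul, Polynomial.eval₂_C, ← hp, Polynomial.eval₂_mul, Polynomial.eval₂_C,
        ← hq]
      simp only [map_mul, map_pow]
      rw [← hb]; ring
  refine eq_of_locally_eq_rs _ _ fun z hz => ?_
  obtain ⟨E₁, hE₁, q₁, p₁, hz₁, hu₁, h₁⟩ := frac c₁ (hO hz)
  obtain ⟨E₂, hE₂, q₂, p₂, hz₂, hu₂, h₂⟩ := frac c₂ (hO hz)
  obtain ⟨E₃, hE₃, q₃, p₃, hz₃, hu₃, h₃⟩ := frac c₃ (hO hz)
  let E : X.Opens := E₁ ⊓ E₂ ⊓ E₃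
  have e₁ : E ≤ E₁ := inf_le_left.trans inf_le_left
  have e₂ : E ≤ E₂ := inf_le_left.trans inf_le_right
  have e₃ : E ≤ E₃ := inf_le_right
  have hED : E ≤ D := e₁.trans hE₁
  have hEV : E ≤ V.1 := hED.trans hDV
  have hzE : i z ∈ E := ⟨⟨hz₁, hz₂⟩, hz₃⟩
  replace h₁ := congrArg (rs e₁) h₁
  replace h₂ := congrArg (rs e₂) h₂
  replace h₃ := congrArg (rs e₃) h₃
  replace hu₁ := hu₁.map (rs e₁)
  replace hu₂ := hu₂.map (rs e₂)
  replace hu₃ := hu₃.map (rs e₃)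
  rw [rs_rs] at hu₁ hu₂ hu₃
  rw [map_mul, rs_rs, rs_rs, rs_rs] at h₁ h₂ h₃
  -- Without denominators the relation holds in B itself, because an element of B that vanishes near
  -- a point of the chart is zero.
  have hrel : (q₁ * p₂ * p₃).eval₂ ι v * ι y₁ + (q₂ * p₁ * p₃).eval₂ ι v * ι y₂ +
      (q₃ * p₁ * p₂).eval₂ ι v * v = 0 := by
    apply eq_zero_of_rs_eq_zero hψo hEV hzE
    have h0 := congrArg (rs hED) hc
    simp only [map_add, map_mul, rs_rs, map_zero, Polynomial.eval₂_mul, hψ'] at h0 ⊢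
    rw [← h₁, ← h₂, ← h₃]
    linear_combination (rs hEV (ψ (p₁.eval₂ ι v)) * rs hEV (ψ (p₂.eval₂ ι v)) *
      rs hEV (ψ (p₃.eval₂ ι v))) * h0
  obtain ⟨n, hn⟩ := exists_mem_span_sq hB.injective (hB.mul_eq.trans (congrArg ι hF)) _ _ _ hrel
  obtain ⟨hi₁, hi₂⟩ := hY.indep _ _ hn
  let O₁ : Z.Opens := O ⊓ i ⁻¹ᵁ E
  have hzO₁ : z ∈ O₁ := ⟨hz, hzE⟩
  have hne : (O₁ : Set Z).Nonempty := ⟨z, hzO₁⟩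
  have : Nonempty O₁ := ⟨⟨z, hzO₁⟩⟩
  have hO₁U : O₁ ≤ (i ≫ π) ⁻¹ᵁ U.1 := inf_le_left.trans hO'
  have hO₁E : O₁ ≤ i ⁻¹ᵁ E := inf_le_right
  have hO₁V : O₁ ≤ i ⁻¹ᵁ V.1 := hO₁E.trans (i.preimage_mono hEV)
  refine ⟨O₁, inf_le_left, hzO₁, ?_⟩
  have hg := appLE_ne_zero _ hA.app_ne_zero hO₁U hne
  rw [← appLE_eq_zero_iff _ hO₁U hne] at hi₁ hi₂
  have bar := fun q => appLE_eval₂ hA hB.mul_eq e hψ hO₁V hO₁U q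
  have k₁ := congrArg (i.appLE E O₁ hO₁E).hom h₁
  have k₂ := congrArg (i.appLE E O₁ hO₁E).hom h₂
  have k₃ := congrArg (i.appLE E O₁ hO₁E).hom h₃
  have m₁ := hu₁.map (i.appLE E O₁ hO₁E).hom
  have m₂ := hu₂.map (i.appLE E O₁ hO₁E).hom
  have m₃ := hu₃.map (i.appLE E O₁ hO₁E).hom
  rw [appLE_rs, bar] at m₁ m₂ m₃
  rw [map_mul, appLE_rs, appLE_rs, appLE_rs, bar, bar] at k₁ k₂ k₃
  have hU := congrArg (rs (inf_le_left : O₁ ≤ O)) huw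
  simp only [map_add, map_mul, map_pow, rs_appLE, map_zero, Polynomial.mul_coeff_zero] at hU hi₁ hi₂ ⊢
  have hi₁' := (mul_eq_zero.mp hi₁).resolve_left (pow_ne_zero _ hg)
  have hi₂' := (mul_eq_zero.mp hi₂).resolve_left (pow_ne_zero _ hg)
  set β := ((i ≫ π).appLE U.1 O₁ hO₁U).hom
  apply (mul_right_injective₀ (mul_ne_zero (mul_ne_zero (mul_ne_zero m₁.ne_zero m₂.ne_zero)
    m₃.ne_zero) hg))
  dsimp only
  linear_combination (β g * β (p₂.coeff 0) * β (p₃.coeff 0) * rs inf_le_left u₁) * k₁ +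
    (β g * β (p₁.coeff 0) * β (p₃.coeff 0) * rs inf_le_left u₂) * k₂ +
    (β g * β (p₁.coeff 0) * β (p₂.coeff 0) * rs inf_le_left w) * k₃ +
    rs inf_le_left u₁ * hi₁' + rs inf_le_left u₂ * hi₂' -
    β (q₃.coeff 0) * β (p₁.coeff 0) * β (p₂.coeff 0) * hU

/-- A section of the normal sheaf takes compatible values on the generators. -/
lemma normalEval_relation (hB : ι g * v = ι F) (e : V.1 ≤ π ⁻¹ᵁ U.1)
    (hψ : ψ.comp ι = (π.appLE U.1 V.1 e).hom) (hF : F = y₁ * a₁ + y₂ * a₂)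
    {η₁ η₂ ν : Γ(idealModule i, V.1)} (hη₁ : idealVal i V.1 η₁ = (π.appLE U.1 V.1 e).hom y₁)
    (hη₂ : idealVal i V.1 η₂ = (π.appLE U.1 V.1 e).hom y₂) (hν : idealVal i V.1 ν = ψ v)
    {N : Z.Opens} (φ : NormalSections i N) (hN' : N ⊓ i ⁻¹ᵁ V.1 ≤ (i ≫ π) ⁻¹ᵁ U.1) :
    ((i ≫ π).appLE U.1 _ hN').hom a₁ * normalEval i φ V.1 η₁ +
      ((i ≫ π).appLE U.1 _ hN').hom a₂ * normalEval i φ V.1 η₂ =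
      ((i ≫ π).appLE U.1 _ hN').hom g * normalEval i φ V.1 ν := by
  have hψ' : ∀ p, ψ (ι p) = (π.appLE U.1 V.1 e).hom p := fun p => RingHom.congr_fun hψ p
  have h1 : (π.appLE U.1 V.1 e).hom a₁ • η₁ + (π.appLE U.1 V.1 e).hom a₂ • η₂ =
      (π.appLE U.1 V.1 e).hom g • ν := by
    apply (exact_idealVal i V.1).1
    have h4 : ψ (ι g) * ψ v = ψ (ι F) := by rw [← map_mul, hB]
    rw [idealVal_add, idealVal_smul, idealVal_smul, idealVal_smul, hη₁, hη₂, hν, ← hψ' g, h4, hψ',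
      hF]
    simp only [map_add, map_mul]
    ring
  have h2 := congrArg (normalEval i φ V.1) h1
  have h3 : ∀ p, rs (inf_le_right : N ⊓ i ⁻¹ᵁ V.1 ≤ i ⁻¹ᵁ V.1)
      (i.app V.1 ((π.appLE U.1 V.1 e).hom p)) = ((i ≫ π).appLE U.1 _ hN').hom p := fun p =>
    appLE_appLE i π e inf_le_right hN' p
  rwa [normalEval_add, normalEval_smul, normalEval_smul, normalEval_smul, h3, h3, h3] at h2

lemma sum_ulift_three {M : Type*} [AddCommMonoid M] (f : ULift.{u} (Fin 3) → M) :
    ∑ j, f j = f ⟨0⟩ + f ⟨1⟩ + f ⟨2⟩ := by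
  rw [← Equiv.ulift.symm.sum_comp, Fin.sum_univ_three]
  rfl

/-- Sections of the normal sheaf over a small open subset are given by their values on `y₁` and
`y₂`. -/
theorem existsUnique_normalSection_of_chart (hA : IsAdapted C (i ≫ π) U F g a)
    (hB : IsBlowupAlgebra F g a ι v) (e : V.1 ≤ π ⁻¹ᵁ U.1)
    (hψ : ψ.comp ι = (π.appLE U.1 V.1 e).hom)
    (hψo : IsOpenImmersion (Spec.map (CommRingCat.ofHom ψ)))
    (hY : IsConormalFrame (i ≫ π) U y₁ y₂) (hF : F = y₁ * a₁ + y₂ * a₂)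
    {η₁ η₂ ν : Γ(idealModule i, V.1)} (hη₁ : idealVal i V.1 η₁ = (π.appLE U.1 V.1 e).hom y₁)
    (hη₂ : idealVal i V.1 η₂ = (π.appLE U.1 V.1 e).hom y₂) (hν : idealVal i V.1 ν = ψ v)
    {N : Z.Opens} (hN : N ≤ i ⁻¹ᵁ V.1) (hN' : N ≤ (i ≫ π) ⁻¹ᵁ U.1) (u₁ u₂ w : Γ(Z, N))
    (huw : ((i ≫ π).appLE U.1 N hN').hom a₁ * u₁ + ((i ≫ π).appLE U.1 N hN').hom a₂ * u₂ =
      ((i ≫ π).appLE U.1 N hN').hom g * w) :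
    ∃! φ : NormalSections i N, normalEval i φ V.1 η₁ = rs inf_le_left u₁ ∧
      normalEval i φ V.1 η₂ = rs inf_le_left u₂ := by
  have main := existsUnique_normalSection i (σ := ULift.{u} (Fin 3)) (W := V.1) (U := N)
    (fun k => ![η₁, η₂, ν] k.down) (fun k => ![u₁, u₂, w] k.down) ?_ ?_
  · obtain ⟨φ, hφ, hφ'⟩ := main
    refine ⟨φ, ⟨hφ ⟨0⟩, hφ ⟨1⟩⟩, fun φ' h => hφ' φ' ?_⟩
    -- The value at v is forced by those at y₁ and y₂: g times it is a₁u₁ + a₂u₂ = gw, and g is not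
    -- zero on the integral scheme Z.
    have h3 : normalEval i φ' V.1 ν = rs inf_le_left w := by
      rcases ((N ⊓ i ⁻¹ᵁ V.1 : Z.Opens) : Set Z).eq_empty_or_nonempty with hemp | hne
      · have hbot : N ⊓ i ⁻¹ᵁ V.1 = ⊥ := by ext1; exact hemp
        have : Subsingleton Γ(Z, N ⊓ i ⁻¹ᵁ V.1) := by rw [hbot]; infer_instance
        exact Subsingleton.elim _ _
      · have : Nonempty (N ⊓ i ⁻¹ᵁ V.1 : Z.Opens) := hne.to_subtype
        have hN'' : N ⊓ i ⁻¹ᵁ V.1 ≤ (i ≫ π) ⁻¹ᵁ U.1 := inf_le_left.trans hN'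
        have h4 := normalEval_relation hB.mul_eq e hψ hF hη₁ hη₂ hν φ' hN''
        have h5 := congrArg (rs (inf_le_left : N ⊓ i ⁻¹ᵁ V.1 ≤ N)) huw
        simp only [map_add, map_mul, rs_appLE] at h5
        rw [h.1, h.2, h5] at h4
        exact (mul_left_cancel₀ (appLE_ne_zero _ hA.app_ne_zero hN'' hne) h4).symm
    rintro ⟨k⟩
    fin_cases k
    exacts [h.1, h.2, h3]
  · intro W' h z hz hzW'
    obtain ⟨D, hDW, hDV, c₁, c₂, c₃, hzD, hc⟩ := exists_generators hA hB e hψ hψo hY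
      (idealVal i W' h) (app_idealVal i W' h) hzW' (hN hz)
    refine ⟨D, hDW, hDV, fun k => ![c₁, c₂, c₃] k.down, hzD, ?_⟩
    rw [sum_ulift_three]
    apply (exact_idealVal i D).1
    rw [idealVal_add, idealVal_add, idealVal_smul, idealVal_smul, idealVal_smul, idealVal_res]
    refine hc.trans ?_
    rw [← hη₁, ← hη₂, ← hν]
    exact congrArg₂ (· + ·) (congrArg₂ (· + ·) (congrArg (c₁ * ·) (idealVal_res i hDV η₁).symm)
      (congrArg (c₂ * ·) (idealVal_res i hDV η₂).symm))
      (congrArg (c₃ * ·) (idealVal_res i hDV ν).symm)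
  · intro D hD α hα
    rw [sum_ulift_three] at hα ⊢
    have h1 := congrArg (idealVal i D) hα
    rw [idealVal_add, idealVal_add, idealVal_smul, idealVal_smul, idealVal_smul] at h1
    have h2 := relation_apply hA hB e hψ hψo hY hF hD (α ⟨0⟩) (α ⟨1⟩) (α ⟨2⟩) (by
      rw [← hη₁, ← hη₂, ← hν]
      refine Eq.trans ?_ (h1.trans (map_zero ((kernel.ι (structureMap i)).app D).hom))
      exact (congrArg₂ (· + ·) (congrArg₂ (· + ·) (congrArg (α ⟨0⟩ * ·) (idealVal_res i hD η₁))
        (congrArg (α ⟨1⟩ * ·) (idealVal_res i hD η₂)))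
        (congrArg (α ⟨2⟩ * ·) (idealVal_res i hD ν))).symm) (O := N ⊓ i ⁻¹ᵁ D) inf_le_right
      (inf_le_left.trans hN') (rs inf_le_left u₁) (rs inf_le_left u₂) (rs inf_le_left w) (by
        have h5 := congrArg (rs (inf_le_left : N ⊓ i ⁻¹ᵁ D ≤ N)) huw
        simpa only [map_add, map_mul, rs_appLE] using h5)
    exact h2

end GeneratorsRelations

/-! ### Sections of the structure sheaf of `Proj` -/

section ProjSections

variable {R A : Type u} [CommRing R] [CommRing A] [Algebra R A]
variable (𝒜 : ℕ → Submodule R A) [GradedAlgebra 𝒜]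

lemma valueAt_injective {U : (Proj 𝒜).Opens} {s t : Γ(Proj 𝒜, U)}
    (h : ∀ x : U, valueAt 𝒜 U x s = valueAt 𝒜 U x t) : s = t := by
  apply Subtype.ext
  funext x
  exact HomogeneousLocalization.val_injective _ (h x)

lemma valueAt_rs {U V : (Proj 𝒜).Opens} (h : V ≤ U) (x : V) (s : Γ(Proj 𝒜, U)) :
    valueAt 𝒜 V x (rs h s) = valueAt 𝒜 U ⟨x.1, h x.2⟩ s := rfl

variable {𝒜}

/-- The function `f / y ^ d` on `D₊(y)`. -/
def frac {y : A} (hy : y ∈ 𝒜 1) {d : ℕ} {f : A} (hf : f ∈ 𝒜 d) :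
    Γ(Proj 𝒜, Proj.basicOpen 𝒜 y) :=
  (Proj.awayToSection 𝒜 y).hom (HomogeneousLocalization.Away.mk 𝒜 hy d f (by simpa using hf))

lemma valueAt_frac {y : A} (hy : y ∈ 𝒜 1) {d : ℕ} {f : A} (hf : f ∈ 𝒜 d)
    (x : Proj.basicOpen 𝒜 y) :
    valueAt 𝒜 _ x (frac hy hf) = Localization.mk f ⟨y ^ d, pow_mem (show y ∈
      (pt x.1).asHomogeneousIdeal.toIdeal.primeCompl from x.2) d⟩ := by
  change HomogeneousLocalization.val ((frac hy hf).1 x) = _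
  have h := ProjectiveSpectrum.Proj.awayToSection_apply 𝒜 y
    (HomogeneousLocalization.Away.mk 𝒜 hy d f (by simpa using hf)) x
  refine h.trans ?_
  rw [HomogeneousLocalization.Away.val_mk, Localization.mk_eq_mk', IsLocalization.map_mk',
    ← Localization.mk_eq_mk']
  rfl

lemma valueAt_frac_mul {y : A} (hy : y ∈ 𝒜 1) {d : ℕ} {f : A} (hf : f ∈ 𝒜 d)
    (x : Proj.basicOpen 𝒜 y) :
    valueAt 𝒜 _ x (frac hy hf) * algebraMap A (LocAt 𝒜 (pt x.1)) y ^ d =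
      algebraMap A (LocAt 𝒜 (pt x.1)) f := by
  rw [valueAt_frac, ← map_pow, ← Localization.mk_one_eq_algebraMap,
    ← Localization.mk_one_eq_algebraMap, Localization.mk_mul, Localization.mk_eq_mk_iff,
    Localization.r_iff_exists]
  exact ⟨1, by simp; ring⟩

lemma isUnit_algebraMap_locAt {y : A} {x : Proj 𝒜} (hx : x ∈ Proj.basicOpen 𝒜 y) :
    IsUnit (algebraMap A (LocAt 𝒜 (pt x)) y) :=
  IsLocalization.map_units (M := (pt x).asHomogeneousIdeal.toIdeal.primeCompl) _ ⟨y, hx⟩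

/-- Two functions agree if they do after multiplication by the powers of `y`. -/
lemma eq_of_valueAt_mul_pow {U : (Proj 𝒜).Opens} {y : A} (hU : U ≤ Proj.basicOpen 𝒜 y) (n : ℕ)
    {s t : Γ(Proj 𝒜, U)}
    (h : ∀ x : U, valueAt 𝒜 U x s * algebraMap A (LocAt 𝒜 (pt x.1)) y ^ n =
      valueAt 𝒜 U x t * algebraMap A (LocAt 𝒜 (pt x.1)) y ^ n) : s = t :=
  valueAt_injective 𝒜 fun x => ((isUnit_algebraMap_locAt (hU x.2)).pow n).mul_right_cancel (h x)

lemma frac_mul {y : A} (hy : y ∈ 𝒜 1) {d e : ℕ} {f g : A} (hf : f ∈ 𝒜 d) (hg : g ∈ 𝒜 e) :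
    frac hy hf * frac hy hg = frac hy (SetLike.mul_mem_graded hf hg) := by
  refine eq_of_valueAt_mul_pow le_rfl (d + e) fun x => ?_
  rw [valueAt_frac_mul, map_mul, map_mul, pow_add, ← valueAt_frac_mul hy hf x,
    ← valueAt_frac_mul hy hg x]
  ring

lemma frac_congr {y : A} (hy : y ∈ 𝒜 1) {d : ℕ} {f g : A} (hf : f ∈ 𝒜 d) (hg : g ∈ 𝒜 d)
    (h : f = g) : frac hy hf = frac hy hg := by subst h; rfl

lemma frac_self_pow {y : A} (hy : y ∈ 𝒜 1) (d : ℕ) (hd : y ^ d ∈ 𝒜 d) : frac hy hd = 1 := by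
  refine eq_of_valueAt_mul_pow le_rfl d fun x => ?_
  rw [valueAt_frac_mul, map_one, one_mul, map_pow]

lemma exists_eq_frac {y : A} (hy : y ∈ 𝒜 1) (s : Γ(Proj 𝒜, Proj.basicOpen 𝒜 y)) :
    ∃ (d : ℕ) (f : A) (hf : f ∈ 𝒜 d), s = frac hy hf := by
  obtain ⟨d, f, hf, e⟩ := HomogeneousLocalization.Away.mk_surjective 𝒜 hy
    ((Proj.basicOpenIsoAway 𝒜 y hy one_pos).inv.hom s)
  refine ⟨d, f, by simpa using hf, ?_⟩
  unfold frac
  rw [e, ← Proj.basicOpenIsoAway_hom 𝒜 y hy one_pos]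
  exact (ConcreteCategory.congr_hom (Proj.basicOpenIsoAway 𝒜 y hy one_pos).inv_hom_id s).symm

lemma frac_ne_zero [IsDomain A] {y : A} (hy : y ∈ 𝒜 1) (hy0 : y ≠ 0) {d : ℕ} {f : A}
    (hf : f ∈ 𝒜 d) (h : f ≠ 0) : frac hy hf ≠ 0 := by
  intro h0
  apply h
  have h1 : HomogeneousLocalization.Away.mk 𝒜 hy d f (by simpa using hf) = 0 := by
    have := congrArg (Proj.basicOpenIsoAway 𝒜 y hy one_pos).inv.hom h0
    unfold frac at this
    rw [← Proj.basicOpenIsoAway_hom 𝒜 y hy one_pos, map_zero] at this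
    exact (ConcreteCategory.congr_hom (Proj.basicOpenIsoAway 𝒜 y hy one_pos).hom_inv_id _).symm.trans
      this
  have h2 := congrArg HomogeneousLocalization.val h1
  rw [HomogeneousLocalization.Away.val_mk, HomogeneousLocalization.val_zero,
    Localization.mk_eq_mk', IsLocalization.mk'_eq_zero_iff] at h2
  obtain ⟨⟨_, n, rfl⟩, hn⟩ := h2
  exact (mul_eq_zero.mp hn).resolve_left (pow_ne_zero _ hy0)

/-- The restrictions of `f / y ^ d` and `f / z ^ d` to `D₊(y) ∩ D₊(z)` differ by a unit. -/
lemma exists_isUnit_frac_eq {y z : A} (hy : y ∈ 𝒜 1) (hz : z ∈ 𝒜 1) {W : (Proj 𝒜).Opens}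
    (hWy : W ≤ Proj.basicOpen 𝒜 y) (hWz : W ≤ Proj.basicOpen 𝒜 z) (d : ℕ) :
    ∃ v : Γ(Proj 𝒜, W), IsUnit v ∧ ∀ (f : A) (hf : f ∈ 𝒜 d),
      rs hWy (frac hy hf) = v * rs hWz (frac hz hf) := by
  have h1 : rs hWy (frac hy hz) * rs hWz (frac hz hy) = 1 := by
    refine eq_of_valueAt_mul_pow hWy 1 fun x => ?_
    rw [map_mul, valueAt_rs, valueAt_rs, map_one, one_mul]
    have e1 := valueAt_frac_mul hy hz ⟨x.1, hWy x.2⟩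
    have e2 := valueAt_frac_mul hz hy ⟨x.1, hWz x.2⟩
    rw [pow_one] at e1 e2 ⊢
    calc _ = (valueAt 𝒜 _ ⟨x.1, hWy x.2⟩ (frac hy hz) * algebraMap A _ y) *
          valueAt 𝒜 _ ⟨x.1, hWz x.2⟩ (frac hz hy) := by ring
      _ = _ := by rw [e1, mul_comm, e2]
  refine ⟨rs hWy (frac hy hz) ^ d, (IsUnit.of_mul_eq_one _ h1).pow d, fun f hf => ?_⟩
  refine eq_of_valueAt_mul_pow hWy d fun x => ?_
  have e1 := valueAt_frac_mul hy hz ⟨x.1, hWy x.2⟩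
  have e2 := valueAt_frac_mul hz hf ⟨x.1, hWz x.2⟩
  have e3 := valueAt_frac_mul hy hf ⟨x.1, hWy x.2⟩
  rw [map_mul, valueAt_rs, valueAt_rs, map_pow, valueAt_rs, e3, mul_right_comm, ← mul_pow,
    ← pow_one (algebraMap A (LocAt 𝒜 (pt x.1)) y), e1, mul_comm, e2]

/-- All fᵢ have the same degree d, so on D₊(x) ∩ D₊(y) their dehomogenizations with respect to x and
y differ by one common unit. -/
lemma map_germ_ideal_eq {Z : (Proj 𝒜).IdealSheafData} {d : ℕ} {ι : Type*} {f : ι → A}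
    (hf : ∀ i, f i ∈ 𝒜 d) {x y : A} (hx : x ∈ 𝒜 1) (hy : y ∈ 𝒜 1)
    (h : Z.ideal ⟨Proj.basicOpen 𝒜 x, Proj.isAffineOpen_basicOpen 𝒜 _ hx one_pos⟩ =
      Ideal.span (Set.range fun i => frac hx (hf i))) {z : Proj 𝒜}
    (hz : z ∈ Proj.basicOpen 𝒜 y) (hk : z ∈ Proj.basicOpen 𝒜 x) :
    (Z.ideal ⟨Proj.basicOpen 𝒜 y, Proj.isAffineOpen_basicOpen 𝒜 _ hy one_pos⟩).map
      ((Proj 𝒜).presheaf.germ (Proj.basicOpen 𝒜 y) z hz).hom =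
    (Ideal.span (Set.range fun i => frac hy (hf i))).map
      ((Proj 𝒜).presheaf.germ (Proj.basicOpen 𝒜 y) z hz).hom := by
  let U : (Proj 𝒜).affineOpens := ⟨_, Proj.isAffineOpen_basicOpen 𝒜 y hy one_pos⟩
  change (Z.ideal U).map _ = _
  let U' : (Proj 𝒜).affineOpens := ⟨_, Proj.isAffineOpen_basicOpen 𝒜 x hx one_pos⟩
  let W : (Proj 𝒜).affineOpens := ⟨Proj.basicOpen 𝒜 (y * x), Proj.isAffineOpen_basicOpen 𝒜 _
    (SetLike.mul_mem_graded hy hx) (by norm_num)⟩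
  have hWy : W.1 ≤ U.1 := (Proj.basicOpen_mul 𝒜 y x).trans_le inf_le_left
  have hWx : W.1 ≤ U'.1 := (Proj.basicOpen_mul 𝒜 y x).trans_le inf_le_right
  have hzW : z ∈ W.1 := by
    change z ∈ Proj.basicOpen 𝒜 (y * x)
    rw [Proj.basicOpen_mul]; exact ⟨hz, hk⟩
  obtain ⟨v, hv, hv'⟩ := exists_isUnit_frac_eq hy hx hWy hWx d
  have key : (Z.ideal U).map (rs hWy) =
      (Ideal.span (Set.range fun i => frac hy (hf i))).map (rs hWy) := by
    have e1 : (Z.ideal U).map (rs hWy) = Z.ideal W := Z.map_ideal hWy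
    have e2 : (Z.ideal U').map (rs hWx) = Z.ideal W := Z.map_ideal hWx
    rw [e1, ← e2, h, Ideal.map_span, Ideal.map_span, ← Set.range_comp, ← Set.range_comp]
    have e3 : (rs hWy ∘ fun i => frac hy (hf i)) =
        fun i => v * (rs hWx ∘ fun i => frac hx (hf i)) i := by
      funext i; exact hv' _ (hf i)
    rw [e3]
    apply le_antisymm
    · rw [Ideal.span_le]
      rintro _ ⟨i, rfl⟩
      obtain ⟨w, hw⟩ := hv.exists_left_inv
      have : (rs hWx ∘ fun i => frac hx (hf i)) i =
          w * (v * (rs hWx ∘ fun i => frac hx (hf i)) i) := by rw [← mul_assoc, hw, one_mul]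
      rw [this]
      exact Ideal.mul_mem_left _ _ (Ideal.subset_span ⟨i, rfl⟩)
    · rw [Ideal.span_le]
      rintro _ ⟨i, rfl⟩
      exact Ideal.mul_mem_left _ _ (Ideal.subset_span ⟨i, rfl⟩)
  have e : ((Proj 𝒜).presheaf.germ U.1 z hz).hom =
      ((Proj 𝒜).presheaf.germ W.1 z hzW).hom.comp (rs hWy) := by
    ext r
    exact (TopCat.Presheaf.germ_res_apply (Proj 𝒜).presheaf (homOfLE hWy) z hzW r).symm
  rw [e, ← Ideal.map_map, ← Ideal.map_map, key]

/-- Ideals on an affine open set are compared stalk by stalk. This frees `IsZeroScheme` from the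
standard coordinates, so that coordinates adapted to the line can be used. -/
lemma ideal_basicOpen_eq_span {Z : (Proj 𝒜).IdealSheafData} {d : ℕ} {ι κ : Type*} {f : ι → A}
    (hf : ∀ i, f i ∈ 𝒜 d) {x : κ → A} (hx : ∀ k, x k ∈ 𝒜 1)
    (hcov : ∀ z : Proj 𝒜, ∃ k, z ∈ Proj.basicOpen 𝒜 (x k))
    (h : ∀ k, Z.ideal ⟨Proj.basicOpen 𝒜 (x k), Proj.isAffineOpen_basicOpen 𝒜 _ (hx k) one_pos⟩ =
      Ideal.span (Set.range fun i => frac (hx k) (hf i))) {y : A} (hy : y ∈ 𝒜 1) :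
    Z.ideal ⟨Proj.basicOpen 𝒜 y, Proj.isAffineOpen_basicOpen 𝒜 _ hy one_pos⟩ =
      Ideal.span (Set.range fun i => frac hy (hf i)) := by
  rw [(Proj.isAffineOpen_basicOpen 𝒜 y hy one_pos).ideal_ext_iff]
  intro z hz
  obtain ⟨k, hk⟩ := hcov z
  exact map_germ_ideal_eq hf (hx k) hy (h k) hz hk

end ProjSections

/-! ### Constant functions on projective space -/

lemma app_top_topIso_inv {X : Scheme.{u}} (U : X.Opens) (hU : ⊤ ≤ U) (f : X ⟶ U.toScheme) (hf : f ≫ U.ι = 𝟙 X)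
    (s : Γ(X, U)) : f.app ⊤ (U.topIso.inv.hom s) = rs hU s := by
  have hU' : (⊤ : U.toScheme.Opens) ≤ U.ι ⁻¹ᵁ U := by simp
  have hf' : (⊤ : X.Opens) ≤ f ⁻¹ᵁ (⊤ : U.toScheme.Opens) := le_top
  have h1 : U.ι.appLE U ⊤ hU' ≫ f.appLE ⊤ ⊤ hf' = X.presheaf.map (homOfLE hU).op := by
    have e := Scheme.Hom.appLE_comp_appLE f U.ι U ⊤ ⊤ hU' hf'
    refine e.trans ?_
    have (g : X ⟶ X) (hg : g = 𝟙 X) (e) : g.appLE U ⊤ e = X.presheaf.map (homOfLE hU).op := by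
      subst hg; rw [Scheme.Hom.appLE, Scheme.Hom.id_app]; exact Category.id_comp _
    exact this _ hf _
  have h2 : U.ι.appLE U ⊤ hU' = U.topIso.inv := by
    rw [Scheme.Opens.ι_appLE, Scheme.Opens.topIso_inv]
    rfl
  rw [h2] at h1
  have h3 : f.appLE ⊤ ⊤ hf' = f.app ⊤ := Scheme.Hom.appLE_eq_app ..
  rw [h3] at h1
  exact ConcreteCategory.congr_hom h1 s

lemma ΓSpecIso_inv_comp_app {R S T : CommRingCat.{u}} (f : R ⟶ S) (g : S ⟶ T) (c : R) :
    (Scheme.ΓSpecIso T).hom ((Spec.map g).app ⊤ ((Spec.map f).app ⊤ ((Scheme.ΓSpecIso R).inv c))) =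
      g (f c) := by
  have h : (Scheme.ΓSpecIso R).inv ≫ (Spec.map f).appTop ≫ (Spec.map g).appTop ≫
      (Scheme.ΓSpecIso T).hom = f ≫ g := by
    rw [← Scheme.ΓSpecIso_inv_naturality_assoc, ← Scheme.ΓSpecIso_inv_naturality_assoc,
      Iso.inv_hom_id, Category.comp_id]
  exact ConcreteCategory.congr_hom h c

/-- D₊(1) is the whole space, so the structure morphism can be computed in this one basic open set,
where a constant is visibly c/1. -/
lemma valueAt_constants (n : ℕ) (x : (⊤ : (PSpace n).Opens)) (c : ℂ) :
    valueAt (coordGrading n) ⊤ x (constants (PSpace.toSpec n) c) =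
      algebraMap ℂ (LocAt (coordGrading n) (pt x.1)) c := by
  have h : constants (PSpace.toSpec n) c = rs (Proj.basicOpen_one (coordGrading n)).ge
      ((Proj.awayToSection (coordGrading n) 1).hom (HomogeneousLocalization.fromZeroRingHom
        (coordGrading n) _ (algebraMap ℂ (coordGrading n 0) c))) := by
    rw [← app_top_topIso_inv _ _ ((Scheme.topIso _).inv ≫
      (Scheme.isoOfEq _ (Proj.basicOpen_one (coordGrading n))).inv) (by simp)]
    let τ := ((Scheme.topIso _).inv ≫
      (Scheme.isoOfEq _ (Proj.basicOpen_one (coordGrading n))).inv).app ⊤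
    exact (congrArg τ (ConcreteCategory.congr_hom
      (Proj.basicOpenToSpec_app_top (coordGrading n) 1) _)).trans (congrArg (fun y => τ
        ((Proj.basicOpen (coordGrading n) 1).topIso.inv.hom
          ((Proj.awayToSection (coordGrading n) 1).hom y)))
        (ΓSpecIso_inv_comp_app (CommRingCat.ofHom (algebraMap ℂ (coordGrading n 0)))
          (CommRingCat.ofHom (HomogeneousLocalization.fromZeroRingHom (coordGrading n) _)) c))
  rw [h]
  have hx : x.1 ∈ Proj.basicOpen (coordGrading n) 1 := (Proj.basicOpen_one (coordGrading n)).ge x.2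
  have h := ProjectiveSpectrum.Proj.awayToSection_apply (coordGrading n) 1 (HomogeneousLocalization.fromZeroRingHom (coordGrading n) _ (algebraMap ℂ (coordGrading n 0) c)) ⟨x.1, hx⟩
  refine h.trans ?_
  change IsLocalization.map _ _ _ (Localization.mk _ _) = _
  rw [Localization.mk_eq_mk', IsLocalization.map_mk', ← Localization.mk_eq_mk']
  refine Eq.trans ?_ ((Localization.mk_one_eq_algebraMap (algebraMap ℂ (MvPolynomial (Fin (n + 1)) ℂ) c)).trans
    (IsScalarTower.algebraMap_apply ℂ (MvPolynomial (Fin (n + 1)) ℂ) (LocAt (coordGrading n) (pt x.1)) c).symm)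
  rfl

/-- Each monomial of degree d absorbs one factor u per variable. This is the passage between the
ratios h and the homogeneous coordinates g = hu; u need not be invertible. -/
lemma aeval_mul_pow {σ B : Type*} [CommRing B] {R : Type*} [CommRing R] (e : R →+* B) {g h : σ → B} {u : B}
    (hu : ∀ i, h i * u = g i) {f : MvPolynomial σ R} {d : ℕ} (hf : f.IsHomogeneous d) :
    MvPolynomial.eval₂ e h f * u ^ d = MvPolynomial.eval₂ e g f := by
  rw [MvPolynomial.eval₂_eq, MvPolynomial.eval₂_eq, Finset.sum_mul]
  refine Finset.sum_congr rfl fun m hm => ?_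
  have hdeg : m.degree = d := by
    have := hf (MvPolynomial.mem_support_iff.mp hm)
    rwa [Finsupp.degree_eq_weight_one]
  have h1 : u ^ d = ∏ i ∈ m.support, u ^ m i := by
    rw [Finset.prod_pow_eq_pow_sum, ← hdeg]; rfl
  rw [h1, mul_assoc, ← Finset.prod_mul_distrib]
  simp_rw [← mul_pow, hu]

/-! ### Charts of projective space in linear coordinates -/

section Charts
variable {n : ℕ}

/-- The zero ideal is a generic point, which gives irreducibility; sections embed in products of
localizations of a domain, which gives reducedness. -/
instance : AlgebraicGeometry.IsIntegral (PSpace n) := by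
  let η : PSpace n := ⟨⟨⊥, Ideal.IsHomogeneous.bot _⟩, Ideal.isPrime_bot, fun h => by
    have : (MvPolynomial.X 0 : MvPolynomial (Fin (n + 1)) ℂ) ∈ (⊥ : Ideal _) := h (by
      exact HomogeneousIdeal.mem_irrelevant_of_mem (coordGrading n) one_pos (X_mem_coordGrading 0))
    exact MvPolynomial.X_ne_zero 0 this⟩
  have : AlgebraicGeometry.IsReduced (PSpace n) := ⟨fun U => ⟨fun s hs => ?_⟩⟩
  · have : IrreducibleSpace (PSpace n) := by
      have h : IsIrreducible (Set.univ : Set (PSpace n)) := by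
        have h1 : closure {η} = Set.univ := by
          refine Set.eq_univ_of_forall fun x => ?_
          exact (ProjectiveSpectrum.le_iff_mem_closure (𝒜 := coordGrading n) η x).mp
            (show @LE.le (ProjectiveSpectrum (coordGrading n)) _ η x from fun a ha => by
              have ha : a = 0 := ha
              rw [ha]; exact zero_mem (pt x).asHomogeneousIdeal.toIdeal)
        rw [← h1]
        exact isIrreducible_singleton.closure
      exact (irreducibleSpace_def _).mpr h
    exact isIntegral_of_irreducibleSpace_of_isReduced _
  · obtain ⟨m, hm⟩ := hs
    refine valueAt_injective _ fun x => ?_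
    have := congrArg (valueAt _ U x) hm
    rw [map_pow, map_zero] at this
    rw [map_zero]
    have : IsDomain (LocAt (coordGrading n) (pt x.1)) :=
      IsLocalization.isDomain_localization (Ideal.primeCompl_le_nonZeroDivisors _)
    exact IsNilpotent.eq_zero ⟨m, ‹_›⟩

/-- The ring of constants on an open subset of projective space. -/
def constantsOn (U : (PSpace n).Opens) : ℂ →+* Γ(PSpace n, U) :=
  (rs le_top).comp (constants (PSpace.toSpec n))

lemma valueAt_constantsOn (U : (PSpace n).Opens) (x : U) (c : ℂ) :
    valueAt (coordGrading n) U x (constantsOn U c) =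
      algebraMap (MvPolynomial (Fin (n + 1)) ℂ) (LocAt (coordGrading n) (pt x.1))
        (MvPolynomial.C c) :=
  (valueAt_constants n ⟨x.1, trivial⟩ c).trans
    (IsScalarTower.algebraMap_apply ℂ (MvPolynomial (Fin (n + 1)) ℂ) _ c)

/-- A change of the coordinates of projective space. -/
structure Frame (n : ℕ) where
  equiv : MvPolynomial (Fin (n + 1)) ℂ ≃ₐ[ℂ] MvPolynomial (Fin (n + 1)) ℂ
  mem : ∀ {d f}, f ∈ coordGrading n d → equiv f ∈ coordGrading n d
  symm_mem : ∀ {d f}, f ∈ coordGrading n d → equiv.symm f ∈ coordGrading n d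

namespace Frame

variable (σ : Frame n) (k : Fin (n + 1))

/-- The coordinates of a frame. -/
def coord : MvPolynomial (Fin (n + 1)) ℂ := σ.equiv (MvPolynomial.X k)

lemma coord_mem : σ.coord k ∈ coordGrading n 1 := σ.mem (X_mem_coordGrading k)

lemma coord_ne_zero : σ.coord k ≠ 0 := by
  unfold coord
  rw [Ne, EmbeddingLike.map_eq_zero_iff]
  exact MvPolynomial.X_ne_zero k

/-- The chart where a coordinate does not vanish. -/
def U : (PSpace n).affineOpens :=
  ⟨Proj.basicOpen (coordGrading n) (σ.coord k),
    Proj.isAffineOpen_basicOpen (coordGrading n) _ (σ.coord_mem k) one_pos⟩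

/-- The function `f / yₖᵈ` on the chart `D₊(yₖ)`. -/
def dehom {d : ℕ} {f : MvPolynomial (Fin (n + 1)) ℂ} (hf : f ∈ coordGrading n d) :
    Γ(PSpace n, (σ.U k).1) := frac (σ.coord_mem k) hf

/-- Substitution of `1` for one of the variables. -/
def subst : MvPolynomial (Fin (n + 1)) ℂ →ₐ[ℂ] MvPolynomial (Fin n) ℂ :=
  MvPolynomial.aeval (k.insertNth (α := fun _ => MvPolynomial (Fin n) ℂ) 1 MvPolynomial.X)

/-- The functions on a chart, as polynomials in the affine coordinates. -/
def chartHom : MvPolynomial (Fin n) ℂ →+* Γ(PSpace n, (σ.U k).1) :=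
  MvPolynomial.eval₂Hom (constantsOn (σ.U k).1) fun i =>
    σ.dehom k (σ.coord_mem (k.succAbove i))

/-- After multiplication by the d-th power of the chart coordinate both sides become the form
`σ.equiv h`, by `aeval_mul_pow`. -/
lemma chartHom_subst {d : ℕ} {h : MvPolynomial (Fin (n + 1)) ℂ} (hh : h ∈ coordGrading n d) :
    σ.chartHom k (subst k h) = σ.dehom k (σ.mem hh) := by
  refine eq_of_valueAt_mul_pow (U := (σ.U k).1) (y := σ.coord k) le_rfl d fun x => ?_
  refine Eq.trans ?_ (valueAt_frac_mul (σ.coord_mem k) (σ.mem hh) x).symm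
  have h1 : ((valueAt (coordGrading n) (σ.U k).1 x).comp (σ.chartHom k)).comp
      (subst k : MvPolynomial (Fin (n + 1)) ℂ →+* _) =
      MvPolynomial.eval₂Hom ((algebraMap (MvPolynomial (Fin (n + 1)) ℂ)
        (LocAt (coordGrading n) (pt x.1))).comp MvPolynomial.C)
        (fun i => valueAt (coordGrading n) (σ.U k).1 x (σ.dehom k (σ.coord_mem i))) := by
    refine MvPolynomial.ringHom_ext (fun c => ?_) fun i => ?_
    · simpa [subst, chartHom] using valueAt_constantsOn (σ.U k).1 x c
    · induction i using Fin.succAboveCases k with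
      | x =>
        have : σ.dehom k (σ.coord_mem k) = 1 := by
          have h := frac_self_pow (σ.coord_mem k) 1 (by simpa using σ.coord_mem k)
          exact (frac_congr _ _ _ (pow_one _).symm).trans h
        simp [subst, this]
      | p i => simp [subst, chartHom]
  have h2 := RingHom.congr_fun h1 h
  change valueAt (coordGrading n) (σ.U k).1 x (σ.chartHom k (subst k h)) = _ at h2
  rw [h2]
  refine (aeval_mul_pow (e := (algebraMap (MvPolynomial (Fin (n + 1)) ℂ)
        (LocAt (coordGrading n) (pt x.1))).comp MvPolynomial.C) (g := fun i => algebraMap _ _ (σ.coord i)) (fun i => ?_) hh).trans ?_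
  · have := valueAt_frac_mul (σ.coord_mem k) (σ.coord_mem i) x
    rwa [pow_one] at this
  · have h3 : MvPolynomial.eval₂Hom ((algebraMap (MvPolynomial (Fin (n + 1)) ℂ)
        (LocAt (coordGrading n) (pt x.1))).comp MvPolynomial.C) (fun i => algebraMap _ _ (σ.coord i)) =
        (algebraMap (MvPolynomial (Fin (n + 1)) ℂ) (LocAt (coordGrading n) (pt x.1))).comp
          (σ.equiv : MvPolynomial (Fin (n + 1)) ℂ →+* _) := by
      refine MvPolynomial.ringHom_ext (fun c => ?_) fun i => ?_
      · have : σ.equiv (MvPolynomial.C c) = MvPolynomial.C c := σ.equiv.commutes c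
        simp [this]
      · simp [coord]
    exact RingHom.congr_fun h3 h

/-- Homogenization with the k-th variable; the summands of a sum are first brought to a common
degree by powers of that variable. -/
lemma exists_subst_eq (p : MvPolynomial (Fin n) ℂ) :
    ∃ (d : ℕ) (h : MvPolynomial (Fin (n + 1)) ℂ), h ∈ coordGrading n d ∧ subst k h = p := by
  have hX : subst k (MvPolynomial.X k) = 1 := by simp [subst]
  have hXi : ∀ i, subst k (MvPolynomial.X (k.succAbove i)) = MvPolynomial.X i := by
    intro i; simp [subst]
  induction p using MvPolynomial.induction_on with
  | C c => exact ⟨0, MvPolynomial.C c, MvPolynomial.isHomogeneous_C _ c, by simp [subst]⟩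
  | add p q hp hq =>
    obtain ⟨d, f, hf, rfl⟩ := hp
    obtain ⟨e, g, hg, rfl⟩ := hq
    refine ⟨d + e, f * MvPolynomial.X k ^ e + MvPolynomial.X k ^ d * g, add_mem ?_ ?_, ?_⟩
    · have := SetLike.pow_mem_graded e (X_mem_coordGrading k)
      exact SetLike.mul_mem_graded hf (by simpa using this)
    · have := SetLike.pow_mem_graded d (X_mem_coordGrading k)
      exact SetLike.mul_mem_graded (by simpa using this) hg
    · simp [hX]
  | mul_X p i hp =>
    obtain ⟨d, f, hf, rfl⟩ := hp
    exact ⟨d + 1, f * MvPolynomial.X (k.succAbove i),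
      SetLike.mul_mem_graded hf (X_mem_coordGrading _), by simp [hXi]⟩

lemma chartHom_bijective : Function.Bijective (σ.chartHom k) := by
  constructor
  · rw [injective_iff_map_eq_zero]
    intro p hp
    obtain ⟨d, h, hh, rfl⟩ := exists_subst_eq k p
    rw [chartHom_subst σ k hh] at hp
    by_contra h0
    refine frac_ne_zero (σ.coord_mem k) (σ.coord_ne_zero k) (σ.mem hh) (fun h1 => h0 ?_) hp
    rw [EmbeddingLike.map_eq_zero_iff] at h1
    rw [h1, map_zero]
  · intro s
    obtain ⟨d, f, hf, rfl⟩ := exists_eq_frac (σ.coord_mem k) s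
    refine ⟨subst k (σ.equiv.symm f), ?_⟩
    rw [chartHom_subst σ k (σ.symm_mem hf)]
    exact frac_congr _ _ _ (by simp)

/-- The coordinate ring of a chart is a polynomial ring. -/
def chartEquiv : MvPolynomial (Fin n) ℂ ≃+* Γ(PSpace n, (σ.U k).1) :=
  RingEquiv.ofBijective (σ.chartHom k) (σ.chartHom_bijective k)

lemma chartEquiv_C (c : ℂ) : σ.chartEquiv k (MvPolynomial.C c) = constantsOn (σ.U k).1 c := by
  simp [chartEquiv, chartHom]

lemma chartEquiv_X (i : Fin n) :
    σ.chartEquiv k (MvPolynomial.X i) = σ.dehom k (σ.coord_mem (k.succAbove i)) := by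
  simp [chartEquiv, chartHom]

lemma chartEquiv_subst {d : ℕ} {h : MvPolynomial (Fin (n + 1)) ℂ} (hh : h ∈ coordGrading n d) :
    σ.chartEquiv k (subst k h) = σ.dehom k (σ.mem hh) := σ.chartHom_subst k hh

/-- A prime containing all coordinates of a frame would contain every form of positive degree, hence
the irrelevant ideal. -/
lemma exists_mem_U (x : PSpace n) : ∃ k, x ∈ (σ.U k).1 := by
  by_contra! h
  have h0 : ∀ i, MvPolynomial.X i ∈ (pt x).asHomogeneousIdeal.toIdeal.comap σ.equiv := fun i =>
    not_not.mp (h i)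
  obtain ⟨d, hd, f, hf, hfx⟩ := exists_homogeneous_notMem (coordGrading n) x
  refine hfx ?_
  have h1 : σ.equiv.symm f ∈ (pt x).asHomogeneousIdeal.toIdeal.comap σ.equiv := by
    have h2 : σ.equiv.symm f ∈ Ideal.span (MvPolynomial.X '' Set.univ) := by
      rw [MvPolynomial.mem_ideal_span_X_image]
      intro m hm
      have h3 := σ.symm_mem hf (MvPolynomial.mem_support_iff.mp hm)
      by_contra! h4
      have : m = 0 := Finsupp.ext fun i => h4 i trivial
      rw [this, map_zero] at h3
      omega
    refine Ideal.span_le.mpr ?_ h2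
    rintro _ ⟨i, -, rfl⟩
    exact h0 i
  simpa using h1

end Frame
end Charts

/-! ### Frames adapted to a line -/

section Frames

variable {n : ℕ}

lemma finrank_coordGrading_one : Module.finrank ℂ (coordGrading n 1) = n + 1 := by
  change Module.finrank ℂ (MvPolynomial.homogeneousSubmodule (Fin (n + 1)) ℂ 1) = n + 1
  rw [MvPolynomial.homogeneousSubmodule_one_eq_span_X,
    finrank_span_eq_card (MvPolynomial.linearIndependent_X _ _), Fintype.card_fin]

instance : Module.Finite ℂ (coordGrading n 1) :=
  Module.finite_of_finrank_pos (by rw [finrank_coordGrading_one]; omega)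

/-- The kernels of the powers of α stabilize, say at n. An x killed by α is αⁿz for some z, and z ∈
ker αⁿ⁺¹ = ker αⁿ gives x = 0. -/
lemma injective_of_surjective_algHom {R A : Type*} [CommRing R] [CommRing A] [Algebra R A]
    [IsNoetherianRing A] {α : A →ₐ[R] A} (hα : Function.Surjective α) : Function.Injective α := by
  have hmono : Monotone fun n : ℕ => RingHom.ker (α ^ n) := by
    refine monotone_nat_of_le_succ fun n x hx => ?_
    rw [RingHom.mem_ker] at hx ⊢
    rw [pow_succ', AlgHom.mul_apply, hx, map_zero]
  obtain ⟨n, hn⟩ := monotone_stabilizes_iff_noetherian.mpr (inferInstance : IsNoetherian A A)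
    ⟨_, hmono⟩
  have hsurj : Function.Surjective (α ^ n) := by
    rw [AlgHom.coe_pow]; exact hα.iterate n
  rw [injective_iff_map_eq_zero]
  intro x hx
  obtain ⟨z, rfl⟩ := hsurj x
  have h1 : z ∈ RingHom.ker (α ^ (n + 1)) := by
    rw [RingHom.mem_ker, pow_succ', AlgHom.mul_apply, hx]
  have h2 : RingHom.ker (α ^ n) = RingHom.ker (α ^ (n + 1)) := hn (n + 1) (Nat.le_succ n)
  rw [← h2] at h1
  exact h1

/-- By dimension the yᵢ span all linear forms, so the substitution Xᵢ ↦ yᵢ is surjective, hence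
bijective. It commutes with taking homogeneous components, so its inverse preserves degrees as well.
-/
lemma exists_frame {y : Fin (n + 1) → MvPolynomial (Fin (n + 1)) ℂ}
    (hy : ∀ i, y i ∈ coordGrading n 1) (hli : LinearIndependent ℂ y) :
    ∃ σ : Frame n, ∀ i, σ.coord i = y i := by
  let α : MvPolynomial (Fin (n + 1)) ℂ →ₐ[ℂ] MvPolynomial (Fin (n + 1)) ℂ := MvPolynomial.aeval y
  have hα : ∀ {d f}, f ∈ coordGrading n d → α f ∈ coordGrading n d := by
    intro d f hf
    have := MvPolynomial.IsHomogeneous.aeval (n := 1) hf y hy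
    rwa [one_mul] at this
  have hspan : Submodule.span ℂ (Set.range y) = coordGrading n 1 := by
    refine Submodule.eq_of_le_of_finrank_le (Submodule.span_le.mpr ?_) ?_
    · rintro _ ⟨i, rfl⟩; exact hy i
    · rw [finrank_span_eq_card hli, finrank_coordGrading_one, Fintype.card_fin]
  have hsurj : Function.Surjective α := by
    rw [← AlgHom.range_eq_top, ← top_le_iff, ← MvPolynomial.adjoin_range_X, Algebra.adjoin_le_iff]
    rintro _ ⟨i, rfl⟩
    have h1 : MvPolynomial.X i ∈ Submodule.span ℂ (Set.range y) := by
      rw [hspan]; exact X_mem_coordGrading i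
    refine Submodule.span_le (p := Subalgebra.toSubmodule α.range).mpr ?_ h1
    rintro _ ⟨i, rfl⟩
    exact ⟨MvPolynomial.X i, by simp [α]⟩
  have hinj : Function.Injective α :=
    injective_of_surjective_algHom hsurj
  refine ⟨⟨AlgEquiv.ofBijective α ⟨hinj, hsurj⟩, hα, fun {d f} hf => ?_⟩, fun i => ?_⟩
  · obtain ⟨h, rfl⟩ := hsurj f
    have e : (AlgEquiv.ofBijective α ⟨hinj, hsurj⟩).symm (α h) = h :=
      (AlgEquiv.ofBijective α ⟨hinj, hsurj⟩).symm_apply_apply h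
    rw [e]
    have h1 : MvPolynomial.homogeneousComponent d h = h := by
      apply hinj
      have h2 : MvPolynomial.homogeneousComponent d (α h) = α h := by
        rw [MvPolynomial.homogeneousComponent_of_mem hf, if_pos rfl]
      conv_rhs => rw [← h2, ← MvPolynomial.sum_homogeneousComponent h, map_sum, map_sum]
      rw [Finset.sum_congr rfl fun i _ => MvPolynomial.homogeneousComponent_of_mem
        (hα (MvPolynomial.homogeneousComponent_mem i h))]
      rw [Finset.sum_ite_eq]
      split_ifs with hd
      · rfl
      · rw [MvPolynomial.homogeneousComponent_eq_zero, map_zero]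
        simp at hd; omega
    rw [← h1]
    exact MvPolynomial.homogeneousComponent_mem d h
  · change α (MvPolynomial.X i) = y i
    simp [α]

/-- The coordinates of a frame extending two linear forms, the second of which avoids finitely
many points of the line cut out by the two forms. -/
lemma exists_frame_of_line {f : Fin 2 → MvPolynomial (Fin 4) ℂ} (hf : ∀ j, f j ∈ coordGrading 3 1)
    (hli : LinearIndependent ℂ f) {T : Set (PSpace 3)} (hT : T.Finite)
    (hTf : ∀ x ∈ T, ∀ j, f j ∈ (pt x).asHomogeneousIdeal.toIdeal) :
    ∃ σ : Frame 3, σ.coord 2 = f 0 ∧ σ.coord 3 = f 1 ∧ ∀ x ∈ T, x ∈ (σ.U 1).1 := by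
  let V := coordGrading 3 1
  let v : Fin 2 → V := fun j => ⟨f j, hf j⟩
  have hv : LinearIndependent ℂ v := LinearIndependent.of_comp V.subtype hli
  have hr : Module.finrank ℂ V = 4 := finrank_coordGrading_one
  have toFrame : ∀ {a b : V}, LinearIndependent ℂ (Fin.cons a (Fin.cons b v : Fin 3 → V) : Fin 4 → V) →
      ∃ σ : Frame 3, σ.coord 0 = a ∧ σ.coord 1 = b ∧ σ.coord 2 = f 0 ∧ σ.coord 3 = f 1 := by
    intro a b hab
    obtain ⟨σ, hσ⟩ := exists_frame
      (y := fun i => ((Fin.cons a (Fin.cons b v : Fin 3 → V) : Fin 4 → V) i : MvPolynomial (Fin 4) ℂ))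
      (fun i => Subtype.prop _) (hab.map' V.subtype (Submodule.ker_subtype V))
    exact ⟨σ, hσ 0, hσ 1, hσ 2, hσ 3⟩
  obtain ⟨b, hb⟩ := exists_linearIndependent_cons_of_lt_finrank hv (by rw [hr]; norm_num)
  obtain ⟨a, ha⟩ := exists_linearIndependent_cons_of_lt_finrank hb (by rw [hr]; norm_num)
  obtain ⟨τ, hτ0, hτ1, hτ2, hτ3⟩ := toFrame ha
  -- The second coordinate is sought among the forms b + ca. Each x in T excludes at most one c: two
  -- excluded values would put a and b, and thus all four coordinates, into the prime x.
  have hbad : (⋃ x ∈ T, {c : ℂ | (b : MvPolynomial (Fin 4) ℂ) + c • (a : MvPolynomial (Fin 4) ℂ) ∈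
      (pt x).asHomogeneousIdeal.toIdeal}).Finite := by
    refine hT.biUnion fun x hx => Set.Subsingleton.finite fun c hc d hd => ?_
    by_contra hne
    have h1 : (c - d) • (a : MvPolynomial (Fin 4) ℂ) ∈ (pt x).asHomogeneousIdeal.toIdeal := by
      have := Ideal.sub_mem (pt x).asHomogeneousIdeal.toIdeal hc hd
      rwa [add_sub_add_left_eq_sub, ← sub_smul] at this
    have h2 : (a : MvPolynomial (Fin 4) ℂ) ∈ (pt x).asHomogeneousIdeal.toIdeal := by
      have := Ideal.mul_mem_left _ (MvPolynomial.C (c - d)⁻¹) h1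
      rwa [MvPolynomial.smul_eq_C_mul, ← mul_assoc, ← map_mul, inv_mul_cancel₀ (sub_ne_zero.mpr hne),
        map_one, one_mul] at this
    have h3 : (b : MvPolynomial (Fin 4) ℂ) ∈ (pt x).asHomogeneousIdeal.toIdeal := by
      have := Ideal.sub_mem (pt x).asHomogeneousIdeal.toIdeal hc (Ideal.mul_mem_left _ (MvPolynomial.C c) h2)
      rwa [MvPolynomial.smul_eq_C_mul, add_sub_cancel_right] at this
    obtain ⟨k, hk⟩ := τ.exists_mem_U x
    refine hk ?_
    fin_cases k
    · exact hτ0.symm ▸ h2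
    · exact hτ1.symm ▸ h3
    · exact hτ2.symm ▸ hTf x hx 0
    · exact hτ3.symm ▸ hTf x hx 1
  obtain ⟨c, hc⟩ := hbad.infinite_compl.nonempty
  have hb' : LinearIndependent ℂ (Fin.cons (b + c • a) v : Fin 3 → V) := by
    rw [linearIndependent_finCons] at hb ha ⊢
    refine ⟨hv, fun hmem => ?_⟩
    rcases eq_or_ne c 0 with rfl | hc0
    · exact hb.2 (by simpa using hmem)
    · refine ha.2 ?_
      rw [Fin.range_cons]
      have h1 : c • a ∈ Submodule.span ℂ (insert b (Set.range v)) := by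
        have := sub_mem (Submodule.span_mono (Set.subset_insert b _) hmem)
          (Submodule.subset_span (R := ℂ) (Set.mem_insert b (Set.range v)))
        rwa [add_sub_cancel_left] at this
      exact (Submodule.smul_mem_iff _ hc0).mp h1
  obtain ⟨a', ha'⟩ := exists_linearIndependent_cons_of_lt_finrank hb' (by rw [hr]; norm_num)
  obtain ⟨σ, hσ0, hσ1, hσ2, hσ3⟩ := toFrame ha'
  refine ⟨σ, hσ2, hσ3, fun x hx hmem => hc ?_⟩
  refine Set.mem_iUnion₂.mpr ⟨x, hx, ?_⟩
  change σ.coord 1 ∈ (pt x).asHomogeneousIdeal.toIdeal at hmem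
  rw [hσ1] at hmem
  exact hmem

end Frames

/-! ### Functoriality of `Proj` -/

section ProjMap

variable {R A B : Type u} [CommRing R] [CommRing A] [Algebra R A] [CommRing B] [Algebra R B]
variable {𝒜 : ℕ → Submodule R A} [GradedAlgebra 𝒜] {ℬ : ℕ → Submodule R B} [GradedAlgebra ℬ]

lemma mem_basicOpen_iff_isUnit_valueAt {U : (Proj 𝒜).Opens} (s : Γ(Proj 𝒜, U)) (x : U) :
    x.1 ∈ (Proj 𝒜).basicOpen s ↔ IsUnit (valueAt 𝒜 U x s) := by
  rw [Scheme.mem_basicOpen _ _ _ x.2]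
  have h := isUnit_map_iff (Proj.stalkIso' 𝒜 x.1)
    ((ProjectiveSpectrum.Proj.structureSheaf 𝒜).presheaf.germ U x.1 x.2 s)
  rw [Proj.stalkIso'_germ 𝒜 U x.1 x.2 s] at h
  exact h.symm.trans (HomogeneousLocalization.isUnit_iff_isUnit_val 𝒜
    (pt x.1).asHomogeneousIdeal.toIdeal (s.1 x)).symm

lemma mem_basicOpen_frac {y : A} (hy : y ∈ 𝒜 1) {d : ℕ} {f : A} (hf : f ∈ 𝒜 d)
    {x : Proj 𝒜} (hx : x ∈ Proj.basicOpen 𝒜 y) :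
    x ∈ (Proj 𝒜).basicOpen (frac hy hf) ↔ f ∉ (pt x).asHomogeneousIdeal.toIdeal := by
  rw [mem_basicOpen_iff_isUnit_valueAt (frac hy hf) ⟨x, hx⟩]
  have h := valueAt_frac_mul hy hf ⟨x, hx⟩
  have h1 : IsUnit (algebraMap A (LocAt 𝒜 (pt x)) f) ↔ f ∉ (pt x).asHomogeneousIdeal.toIdeal :=
    IsLocalization.AtPrime.isUnit_to_map_iff (LocAt 𝒜 (pt x)) (pt x).asHomogeneousIdeal.toIdeal f
  rw [← h1]
  dsimp only at h
  rw [← h]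
  exact ((isUnit_algebraMap_locAt hx).pow d).mul_right_iff.symm

variable (φ : 𝒜 →+*ᵍ ℬ) (hφ : HomogeneousIdeal.irrelevant ℬ ≤ (HomogeneousIdeal.irrelevant 𝒜).map φ)

/-- The map on localizations at a point induced by a homomorphism of graded rings. -/
def locMap (x : Proj ℬ) : LocAt 𝒜 (pt (Proj.map φ hφ x)) →+* LocAt ℬ (pt x) :=
  Localization.localRingHom (pt (Proj.map φ hφ x)).asHomogeneousIdeal.toIdeal
    (pt x).asHomogeneousIdeal.toIdeal φ.toRingHom rfl

lemma locMap_algebraMap (x : Proj ℬ) (a : A) :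
    locMap φ hφ x (algebraMap A _ a) = algebraMap B _ (φ a) :=
  Localization.localRingHom_to_map _ _ _ _ a

lemma valueAt_map_appLE {U : (Proj 𝒜).Opens} {V : (Proj ℬ).Opens} (e : V ≤ Proj.map φ hφ ⁻¹ᵁ U)
    (s : Γ(Proj 𝒜, U)) (x : V) :
    valueAt ℬ V x (((Proj.map φ hφ).appLE U V e).hom s) =
      locMap φ hφ x.1 (valueAt 𝒜 U ⟨Proj.map φ hφ x.1, e x.2⟩ s) := by
  exact HomogeneousLocalization.val_localRingHom ..

lemma map_appLE_frac {y : A} (hy : y ∈ 𝒜 1) {d : ℕ} {f : A} (hf : f ∈ 𝒜 d) {y' : B}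
    (hy' : y' ∈ ℬ 1) (hyy' : φ y = y') {f' : B} (hf' : f' ∈ ℬ d) (hff' : φ f = f')
    {V : (Proj ℬ).Opens} (e : V ≤ Proj.map φ hφ ⁻¹ᵁ Proj.basicOpen 𝒜 y)
    (e' : V ≤ Proj.basicOpen ℬ y') :
    ((Proj.map φ hφ).appLE _ V e).hom (frac hy hf) = rs e' (frac hy' hf') := by
  subst hyy' hff'
  refine eq_of_valueAt_mul_pow e' d fun x => ?_
  have h1 := valueAt_frac_mul hy' hf' ⟨x.1, e' x.2⟩
  refine Eq.trans ?_ h1.symm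
  rw [valueAt_map_appLE, ← locMap_algebraMap φ hφ x.1 y, ← map_pow, ← map_mul,
    ← locMap_algebraMap φ hφ x.1 f]
  exact congrArg _ (valueAt_frac_mul hy hf ⟨Proj.map φ hφ x.1, e x.2⟩)

/-- The property is local on the target, and over D₊(yᵢ) the map of coordinate rings is surjective
because every numerator lifts in its own degree. -/
lemma isClosedImmersion_map (hs : ∀ d, ∀ g ∈ ℬ d, ∃ f ∈ 𝒜 d, φ f = g) {ι : Type*} {y : ι → A}
    (hy : ∀ i, y i ∈ 𝒜 1) (hcov : ∀ x : Proj 𝒜, ∃ i, x ∈ Proj.basicOpen 𝒜 (y i)) :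
    IsClosedImmersion (Proj.map φ hφ) := by
  let U : ι → (Proj 𝒜).affineOpens := fun i =>
    ⟨Proj.basicOpen 𝒜 (y i), Proj.isAffineOpen_basicOpen 𝒜 _ (hy i) one_pos⟩
  have hU : ⨆ i, (U i : (Proj 𝒜).Opens) = ⊤ :=
    top_le_iff.mp fun x _ => Opens.mem_iSup.mpr (hcov x)
  rw [IsZariskiLocalAtTarget.iff_of_iSup_eq_top (P := @IsClosedImmersion) _ hU]
  intro i
  have hV : IsAffineOpen (Proj.basicOpen ℬ (φ (y i))) :=
    Proj.isAffineOpen_basicOpen ℬ _ (φ.2 (hy i)) one_pos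
  have h1 : IsAffine (Proj.map φ hφ ⁻¹ᵁ (U i).1).toScheme := hV
  have h2 : IsAffine ((U i).1).toScheme := (U i).2
  refine IsClosedImmersion.of_surjective_of_isAffine _ ?_
  have h3 : Function.Surjective ((Proj.map φ hφ).app (U i).1).hom := by
    intro s
    obtain ⟨d, g, hg, rfl⟩ := exists_eq_frac (φ.2 (hy i)) s
    obtain ⟨f, hf, rfl⟩ := hs d g hg
    refine ⟨frac (hy i) hf, ?_⟩
    have h4 := map_appLE_frac φ hφ (hy i) hf (φ.2 (hy i)) rfl (φ.2 hf) rfl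
      (V := Proj.basicOpen ℬ (φ (y i))) le_rfl le_rfl
    rw [rs_self] at h4
    refine Eq.trans ?_ h4
    exact (ConcreteCategory.congr_hom (Scheme.Hom.appLE_eq_app (f := Proj.map φ hφ)
      (U := (U i).1)) _).symm
  have h5 : Function.Surjective ((Proj.map φ hφ).app ((U i).1.ι ''ᵁ ⊤)).hom := by
    rw [Scheme.Opens.ι_image_top]; exact h3
  have h6 := morphismRestrict_appTop (Proj.map φ hφ) (U i).1
  have h7 := ((ConcreteCategory.bijective_of_isIso ((Proj ℬ).presheaf.map (eqToHom
    (image_morphismRestrict_preimage (Proj.map φ hφ) (U i).1 ⊤)).op)).2).comp h5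
  have h8 : Function.Surjective ((Proj.map φ hφ ∣_ (U i).1).appTop).hom := by
    intro s
    obtain ⟨r, hr⟩ := h7 s
    exact ⟨r, (ConcreteCategory.congr_hom h6 r).trans hr⟩
  exact h8

end ProjMap

/-! ### The parametrized line `y₂ = y₃ = 0` of a frame -/

section Line

open MvPolynomial in
/-- Restriction of polynomials to the line `x₂ = x₃ = 0`. -/
def lineHom : MvPolynomial (Fin 4) ℂ →ₐ[ℂ] MvPolynomial (Fin 2) ℂ := aeval ![X 0, X 1, 0, 0]

open MvPolynomial in
/-- Polynomials in the first two variables. -/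
def lineSection : MvPolynomial (Fin 2) ℂ →ₐ[ℂ] MvPolynomial (Fin 4) ℂ := aeval ![X 0, X 1]

lemma lineHom_mem {d : ℕ} {f : MvPolynomial (Fin 4) ℂ} (hf : f ∈ coordGrading 3 d) :
    lineHom f ∈ coordGrading 1 d := by
  have := MvPolynomial.IsHomogeneous.aeval (n := 1) hf
    ![(MvPolynomial.X 0 : MvPolynomial (Fin 2) ℂ), MvPolynomial.X 1, 0, 0] (fun i => by
      fin_cases i
      · exact X_mem_coordGrading (n := 1) 0
      · exact X_mem_coordGrading (n := 1) 1
      · exact MvPolynomial.isHomogeneous_zero _ _ _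
      · exact MvPolynomial.isHomogeneous_zero _ _ _)
  rwa [one_mul] at this

lemma lineSection_mem {d : ℕ} {g : MvPolynomial (Fin 2) ℂ} (hg : g ∈ coordGrading 1 d) :
    lineSection g ∈ coordGrading 3 d := by
  have := MvPolynomial.IsHomogeneous.aeval (n := 1) hg
    ![(MvPolynomial.X 0 : MvPolynomial (Fin 4) ℂ), MvPolynomial.X 1] (fun i => by
      fin_cases i
      · exact X_mem_coordGrading (n := 3) 0
      · exact X_mem_coordGrading (n := 3) 1)
  rwa [one_mul] at this

lemma lineHom_lineSection (g : MvPolynomial (Fin 2) ℂ) : lineHom (lineSection g) = g := by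
  have : lineHom.comp lineSection = AlgHom.id ℂ _ := by
    ext i; fin_cases i <;> simp [lineHom, lineSection]
  exact AlgHom.congr_fun this g

lemma sub_lineSection_mem (f : MvPolynomial (Fin 4) ℂ) :
    f - lineSection (lineHom f) ∈
      Ideal.span {(MvPolynomial.X 2 : MvPolynomial (Fin 4) ℂ), MvPolynomial.X 3} := by
  rw [← Ideal.Quotient.eq]
  have : (Ideal.Quotient.mkₐ ℂ (Ideal.span {(MvPolynomial.X 2 : MvPolynomial (Fin 4) ℂ),
      MvPolynomial.X 3})) = ((Ideal.Quotient.mkₐ ℂ _).comp lineSection).comp lineHom := by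
    ext i
    fin_cases i
    · simp [lineHom, lineSection]
    · simp [lineHom, lineSection]
    · simpa [lineHom, lineSection] using Ideal.Quotient.eq_zero_iff_mem.mpr
        (Ideal.subset_span (by simp))
    · simpa [lineHom, lineSection] using Ideal.Quotient.eq_zero_iff_mem.mpr
        (Ideal.subset_span (by simp))
  exact AlgHom.congr_fun this f

/-- f lies in the ideal (x₂, x₃), and the coefficients can be replaced by their components of degree
d. -/
lemma exists_eq_of_lineHom_eq_zero {d : ℕ} {f : MvPolynomial (Fin 4) ℂ}
    (hf : f ∈ coordGrading 3 (d + 1)) (h : lineHom f = 0) :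
    ∃ a ∈ coordGrading 3 d, ∃ b ∈ coordGrading 3 d,
      f = MvPolynomial.X 2 * a + MvPolynomial.X 3 * b := by
  have h1 := sub_lineSection_mem f
  rw [h, map_zero, sub_zero, Ideal.mem_span_pair] at h1
  obtain ⟨a, b, hab⟩ := h1
  refine ⟨_, SetLike.coe_mem (DirectSum.decompose (coordGrading 3) a d), _,
    SetLike.coe_mem (DirectSum.decompose (coordGrading 3) b d), ?_⟩
  rw [← DirectSum.coe_decompose_mul_add_of_left_mem (coordGrading 3) (X_mem_coordGrading 2),
    ← DirectSum.coe_decompose_mul_add_of_left_mem (coordGrading 3) (X_mem_coordGrading 3),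
    ← Submodule.coe_add, ← DirectSum.add_apply, ← DirectSum.decompose_add, mul_comm _ a,
    mul_comm _ b, hab, add_comm 1 d, DirectSum.decompose_of_mem_same _ hf]

namespace Frame

variable (σ : Frame 3)

/-- Restriction of polynomials to the line `y₂ = y₃ = 0` of a frame. -/
def toLine : coordGrading 3 →+*ᵍ coordGrading 1 where
  toRingHom := lineHom.toRingHom.comp σ.equiv.symm.toAlgHom.toRingHom
  map_mem := by
    intro d f hf
    exact lineHom_mem (σ.symm_mem hf)

lemma toLine_apply (f : MvPolynomial (Fin 4) ℂ) : σ.toLine f = lineHom (σ.equiv.symm f) := rfl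

lemma toLine_mem {d : ℕ} {f : MvPolynomial (Fin 4) ℂ} (hf : f ∈ coordGrading 3 d) :
    σ.toLine f ∈ coordGrading 1 d := σ.toLine.2 hf

lemma toLine_lift (g : MvPolynomial (Fin 2) ℂ) : σ.toLine (σ.equiv (lineSection g)) = g := by
  rw [toLine_apply, AlgEquiv.symm_apply_apply, lineHom_lineSection]

lemma toLine_irrelevant : HomogeneousIdeal.irrelevant (coordGrading 1) ≤
    (HomogeneousIdeal.irrelevant (coordGrading 3)).map σ.toLine := by
  refine (HomogeneousIdeal.toIdeal_irrelevant_le _).mpr fun i hi g hg => ?_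
  have h1 := HomogeneousIdeal.mem_irrelevant_of_mem (coordGrading 3) hi
    (σ.mem (lineSection_mem hg))
  have h2 := Ideal.mem_map_of_mem σ.toLine h1
  rwa [σ.toLine_lift] at h2

/-- The parametrization of the line `y₂ = y₃ = 0` of a frame. -/
def line : PSpace 1 ⟶ PSpace 3 := Proj.map σ.toLine σ.toLine_irrelevant

instance : IsClosedImmersion σ.line :=
  isClosedImmersion_map σ.toLine σ.toLine_irrelevant
    (fun _ g hg => ⟨_, σ.mem (lineSection_mem hg), σ.toLine_lift g⟩) σ.coord_mem σ.exists_mem_U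

/-- The first two of the indices of the coordinates. -/
abbrev idx (k : Fin 2) : Fin 4 := Fin.castLE (by norm_num) k

lemma toLine_coord (k : Fin 2) : σ.toLine (σ.coord (idx k)) = MvPolynomial.X k := by
  rw [toLine_apply, coord, AlgEquiv.symm_apply_apply]
  fin_cases k <;> simp [lineHom, idx]

lemma toLine_coord_two : σ.toLine (σ.coord 2) = 0 := by
  rw [toLine_apply, coord, AlgEquiv.symm_apply_apply]; simp [lineHom]

lemma toLine_coord_three : σ.toLine (σ.coord 3) = 0 := by
  rw [toLine_apply, coord, AlgEquiv.symm_apply_apply]; simp [lineHom]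

lemma exists_eq_of_toLine_eq_zero {d : ℕ} {f : MvPolynomial (Fin 4) ℂ}
    (hf : f ∈ coordGrading 3 (d + 1)) (h : σ.toLine f = 0) :
    ∃ a ∈ coordGrading 3 d, ∃ b ∈ coordGrading 3 d, f = σ.coord 2 * a + σ.coord 3 * b := by
  obtain ⟨a, ha, b, hb, e⟩ := exists_eq_of_lineHom_eq_zero (σ.symm_mem hf) h
  refine ⟨_, σ.mem ha, _, σ.mem hb, ?_⟩
  rw [coord, coord, ← map_mul, ← map_mul, ← map_add, ← e, AlgEquiv.apply_symm_apply]

lemma line_preimage (k : Fin 2) : σ.line ⁻¹ᵁ (σ.U (idx k)).1 = (chart k).1 :=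
  congrArg (Proj.basicOpen (coordGrading 1)) (σ.toLine_coord k)

lemma line_appLE {k : Fin 2} {d : ℕ} {f : MvPolynomial (Fin 4) ℂ} (hf : f ∈ coordGrading 3 d)
    {g : MvPolynomial (Fin 2) ℂ} (hg : g ∈ coordGrading 1 d) (h : σ.toLine f = g)
    {V : (PSpace 1).Opens} (e : V ≤ σ.line ⁻¹ᵁ (σ.U (idx k)).1) (e' : V ≤ (chart k).1) :
    (σ.line.appLE _ V e).hom (σ.dehom (idx k) hf) = rs e' (dehomogenize k g hg) :=
  map_appLE_frac σ.toLine σ.toLine_irrelevant (σ.coord_mem (idx k)) hf (X_mem_coordGrading k)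
    (σ.toLine_coord k) hg h e e'

lemma line_app {k : Fin 2} {d : ℕ} {f : MvPolynomial (Fin 4) ℂ} (hf : f ∈ coordGrading 3 d)
    {g : MvPolynomial (Fin 2) ℂ} (hg : g ∈ coordGrading 1 d) (h : σ.toLine f = g) :
    σ.line.app (σ.U (idx k)).1 (σ.dehom (idx k) hf) =
      rs (σ.line_preimage k).le (dehomogenize k g hg) := by
  rw [← σ.line_appLE hf hg h le_rfl, Scheme.Hom.appLE_eq_app]

lemma line_app_eq_zero_iff {k : Fin 2} {d : ℕ} {f : MvPolynomial (Fin 4) ℂ}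
    (hf : f ∈ coordGrading 3 d) :
    σ.line.app (σ.U (idx k)).1 (σ.dehom (idx k) hf) = 0 ↔ σ.toLine f = 0 := by
  rw [σ.line_app hf (σ.toLine_mem hf) rfl]
  constructor
  · intro h
    by_contra h0
    have h2 := congrArg (rs (σ.line_preimage k).ge) h
    rw [rs_rs, rs_self, map_zero] at h2
    exact frac_ne_zero (X_mem_coordGrading k) (MvPolynomial.X_ne_zero k) (σ.toLine_mem hf) h0 h2
  · intro h
    have : dehomogenize k _ (σ.toLine_mem hf) = 0 := by
      refine eq_of_valueAt_mul_pow (U := (chart k).1) le_rfl d fun x => ?_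
      rw [map_zero, zero_mul]
      refine (valueAt_frac_mul (X_mem_coordGrading k) (σ.toLine_mem hf) x).trans ?_
      rw [h, map_zero]
    rw [this, map_zero]

lemma line_toSpec : σ.line ≫ PSpace.toSpec 3 = PSpace.toSpec 1 := by
  have h : constants (σ.line ≫ PSpace.toSpec 3) = constants (PSpace.toSpec 1) := by
    refine RingHom.ext fun c => ?_
    refine valueAt_injective _ fun x => ?_
    rw [valueAt_constants]
    have e : (⊤ : (PSpace 1).Opens) ≤ Proj.map σ.toLine σ.toLine_irrelevant ⁻¹ᵁ ⊤ := le_top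
    have h1 := valueAt_map_appLE σ.toLine σ.toLine_irrelevant e (constants (PSpace.toSpec 3) c) x
    have h2 : ((Proj.map σ.toLine σ.toLine_irrelevant).appLE ⊤ ⊤ e).hom
        (constants (PSpace.toSpec 3) c) = constants (σ.line ≫ PSpace.toSpec 3) c :=
      (ConcreteCategory.congr_hom (Scheme.Hom.appLE_eq_app (f := σ.line) (U := ⊤)) _).trans rfl
    rw [h2] at h1
    refine h1.trans ?_
    rw [valueAt_constants, IsScalarTower.algebraMap_apply ℂ (MvPolynomial (Fin 4) ℂ)]
    refine (locMap_algebraMap σ.toLine σ.toLine_irrelevant x.1 _).trans ?_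
    refine Eq.trans ?_ (IsScalarTower.algebraMap_apply ℂ (MvPolynomial (Fin 2) ℂ)
      (LocAt (coordGrading 1) (pt x.1)) c).symm
    exact congrArg _ ((lineHom.comp σ.equiv.symm.toAlgHom).commutes c)
  refine ext_to_Spec ?_
  exact CommRingCat.hom_ext h

/-- The preimage of x is its pullback under the section ψ of the restriction to the line: f and
ψ(f|_L) differ by an element of (y₂, y₃), which is contained in the prime x. -/
lemma mem_range_line {x : PSpace 3} (h2 : σ.coord 2 ∈ (pt x).asHomogeneousIdeal.toIdeal)
    (h3 : σ.coord 3 ∈ (pt x).asHomogeneousIdeal.toIdeal) : x ∈ Set.range σ.line := by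
  let ψ : coordGrading 1 →+*ᵍ coordGrading 3 :=
    { toRingHom := σ.equiv.toAlgHom.toRingHom.comp lineSection.toRingHom
      map_mem := by
        intro d f hf
        exact σ.mem (lineSection_mem hf) }
  have hψ : ∀ g, ψ g = σ.equiv (lineSection g) := fun g => rfl
  have hx : ∀ f, f - ψ (σ.toLine f) ∈ (pt x).asHomogeneousIdeal.toIdeal := by
    intro f
    have h1 := Ideal.mem_map_of_mem σ.equiv (sub_lineSection_mem (σ.equiv.symm f))
    rw [Ideal.map_span, Set.image_pair, map_sub, AlgEquiv.apply_symm_apply] at h1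
    refine Ideal.span_le.mpr ?_ h1
    rintro _ (rfl | rfl)
    · exact h2
    · exact h3
  have hx' : ∀ f, ψ (σ.toLine f) ∈ (pt x).asHomogeneousIdeal.toIdeal ↔
      f ∈ (pt x).asHomogeneousIdeal.toIdeal := by
    intro f
    have := Ideal.add_mem_iff_right (b := ψ (σ.toLine f)) _ (hx f)
    rw [sub_add_cancel] at this
    exact this.symm
  let p : PSpace 1 := ⟨(pt x).asHomogeneousIdeal.comap ψ, (pt x).isPrime.comap ψ, fun h => by
    obtain ⟨k, hk⟩ := σ.exists_mem_U x
    refine hk ((hx' _).mp ?_)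
    exact h (HomogeneousIdeal.mem_irrelevant_of_mem (coordGrading 1) one_pos
      (σ.toLine_mem (σ.coord_mem k)))⟩
  refine ⟨p, ?_⟩
  refine ProjectiveSpectrum.ext (HomogeneousIdeal.ext' fun i f hf => ?_)
  exact hx' f

lemma coord_mem_of_mem_range {x : PSpace 3} (h : x ∈ Set.range σ.line) :
    σ.coord 2 ∈ (pt x).asHomogeneousIdeal.toIdeal ∧
      σ.coord 3 ∈ (pt x).asHomogeneousIdeal.toIdeal := by
  obtain ⟨p, rfl⟩ := h
  constructor
  · change σ.toLine (σ.coord 2) ∈ (pt p).asHomogeneousIdeal.toIdeal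
    rw [toLine_coord_two]; exact zero_mem _
  · change σ.toLine (σ.coord 3) ∈ (pt p).asHomogeneousIdeal.toIdeal
    rw [toLine_coord_three]; exact zero_mem _

end Frame

end Line

/-! ### Closed subschemes of projective space in a frame -/

section ZeroSchemes

variable {n : ℕ}

/-- The frame of the standard coordinates. -/
def Frame.std (n : ℕ) : Frame n := ⟨AlgEquiv.refl, id, id⟩

lemma exists_mem_chart (x : PSpace n) : ∃ k, x ∈ (chart (n := n) k).1 :=
  (Frame.std n).exists_mem_U x

variable {d r : ℕ} {Z : (PSpace n).IdealSheafData} {f : Fin r → MvPolynomial (Fin (n + 1)) ℂ}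
  {hf : ∀ j, f j ∈ coordGrading n d}

lemma IsZeroScheme.ideal_eq (h : IsZeroScheme Z f hf) (σ : Frame n) (k : Fin (n + 1)) :
    Z.ideal (σ.U k) = Ideal.span (Set.range fun j => σ.dehom k (hf j)) :=
  ideal_basicOpen_eq_span hf X_mem_coordGrading exists_mem_chart h (σ.coord_mem k)

lemma IsZeroScheme.mem_support_iff (h : IsZeroScheme Z f hf) (x : PSpace n) :
    x ∈ Z.support ↔ ∀ j, f j ∈ (pt x).asHomogeneousIdeal.toIdeal := by
  obtain ⟨k, hk⟩ := exists_mem_chart x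
  rw [Scheme.IdealSheafData.mem_support_iff_of_mem hk, h k, Scheme.zeroLocus_span,
    Scheme.mem_zeroLocus_iff, Set.forall_mem_range]
  refine forall_congr' fun j => ?_
  rw [← not_iff_not, not_not]
  exact mem_basicOpen_frac (X_mem_coordGrading k) (hf j) hk

lemma finite_support_of_hasLength {m : ℕ} (h : HasLength (subschemeToSpec Z) m) :
    (Z.support : Set (PSpace n)).Finite := by
  have := h.1
  have h1 := Scheme.Hom.finite_preimage (subschemeToSpec Z)
    (s := Set.univ) (Set.Finite.subset (Set.finite_singleton (default : PrimeSpectrum ℂ))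
      fun x _ => Subsingleton.elim (α := PrimeSpectrum ℂ) x default)
  rw [Set.preimage_univ] at h1
  rw [← Scheme.IdealSheafData.range_subschemeι, ← Set.image_univ]
  exact h1.image _

/-- Since all of Z lies in the affine open set U, its ring of global functions is Γ(U) modulo the
ideal of Z, and ρ presents R as the same quotient over ℂ. -/
lemma finrank_eq_of_hasLength {m : ℕ} (h : HasLength (subschemeToSpec Z) m)
    {U : (PSpace n).affineOpens} (hU : ∀ x ∈ Z.support, x ∈ U.1) {R : Type} [CommRing R]
    [Algebra ℂ R] (ρ : Γ(PSpace n, U.1) →+* R) (hρ : Function.Surjective ρ)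
    (hker : RingHom.ker ρ = Z.ideal U) (hc : ∀ c, ρ (constantsOn U.1 c) = algebraMap ℂ R c) :
    Module.finrank ℂ R = m := by
  obtain ⟨-, h⟩ := h
  let := (constants (subschemeToSpec Z)).toAlgebra
  have hle : (⊤ : Z.subscheme.Opens) ≤ Z.subschemeι ⁻¹ᵁ U.1 := fun x _ => hU _ (by
    rw [← SetLike.mem_coe, ← Scheme.IdealSheafData.range_subschemeι]; exact ⟨x, rfl⟩)
  let α : Γ(PSpace n, U.1) →+* Γ(Z.subscheme, ⊤) := (Z.subschemeι.appLE U.1 ⊤ hle).hom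
  have hα : α = (rs hle).comp (Z.subschemeι.app U.1).hom := rfl
  have hrs : Function.Bijective (rs hle) := by
    have e : Z.subschemeι ⁻¹ᵁ U.1 ≤ ⊤ := le_top
    refine Function.bijective_iff_has_inverse.mpr ⟨rs e, fun s => ?_, fun s => ?_⟩
    · rw [rs_rs, rs_self]
    · rw [rs_rs, rs_self]
  have hα1 : Function.Surjective α := by
    rw [hα]
    exact hrs.2.comp (Z.subschemeι_app_surjective U)
  have hα2 : RingHom.ker α = Z.ideal U := by
    rw [← Z.ker_subschemeι_app U, hα]
    ext s
    rw [RingHom.mem_ker, RingHom.mem_ker, RingHom.comp_apply, map_eq_zero_iff _ hrs.1]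
  have hα3 : ∀ c, α (constantsOn U.1 c) = constants (subschemeToSpec Z) c := by
    intro c
    have e : (⊤ : Z.subscheme.Opens) ≤ Z.subschemeι ⁻¹ᵁ ⊤ := le_top
    refine (appLE_rs Z.subschemeι (le_top : U.1 ≤ ⊤) hle _).trans ?_
    exact (ConcreteCategory.congr_hom (Scheme.Hom.appLE_eq_app (f := Z.subschemeι) (U := ⊤)) _).trans
      rfl
  let e : Γ(Z.subscheme, ⊤) ≃+* R := (RingHom.quotientKerEquivOfSurjective hα1).symm.trans
    ((Ideal.quotEquivOfEq (hα2.trans hker.symm)).trans (RingHom.quotientKerEquivOfSurjective hρ))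
  have he : ∀ s, e (α s) = ρ s := by
    intro s
    have : (RingHom.quotientKerEquivOfSurjective hα1).symm (α s) = Ideal.Quotient.mk _ s := by
      rw [RingEquiv.symm_apply_eq]; rfl
    simp only [e, RingEquiv.trans_apply, this]
    rfl
  let e' : Γ(Z.subscheme, ⊤) ≃ₐ[ℂ] R := AlgEquiv.ofRingEquiv (f := e) fun c => by
    change e (constants (subschemeToSpec Z) c) = _
    rw [← hα3, he, hc]
  rw [← h]
  exact (LinearEquiv.finrank_eq e'.toLinearEquiv).symm

end ZeroSchemes

/-! ### The affine line -/

section AffineLine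

open Polynomial

/-- The functions on the chart `D₊(x₁)` of the projective line, as polynomials in one variable. -/
def lineChart : ℂ[X] ≃+* Γ(PSpace 1, (chart (n := 1) 1).1) :=
  (MvPolynomial.uniqueAlgEquiv ℂ (Fin 1)).symm.toRingEquiv.trans ((Frame.std 1).chartEquiv 1)

lemma lineChart_aeval {d : ℕ} {f : MvPolynomial (Fin 2) ℂ} (hf : f ∈ coordGrading 1 d) :
    lineChart (MvPolynomial.aeval ![X, 1] f) = dehomogenize 1 f hf := by
  have h := (Frame.std 1).chartEquiv_subst 1 hf
  refine Eq.trans (congrArg ((Frame.std 1).chartEquiv 1) ?_) h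
  have : ((MvPolynomial.uniqueAlgEquiv ℂ (Fin 1)).symm.toAlgHom.comp
      (MvPolynomial.aeval ![X, 1])) = Frame.subst (n := 1) 1 := by
    ext i
    fin_cases i
    · simp [Frame.subst]
      rfl
    · simp [Frame.subst]
  exact AlgHom.congr_fun this f

end AffineLine

/-! ### The ideal of a line and of its intersection with a curve -/

section LineIdeals

/-- Modulo x the hypothesis reads βy ≡ wy² for some w, and y can be cancelled because x is prime and
does not divide it. This is the independence of two coordinates in the conormal module of their zero
locus. -/
lemma mem_span_pair_of_mem_sq {R : Type*} [CommRing R] {x y : R} (hx : Prime x)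
    (hxy : ¬ x ∣ y) {α β : R} (h : α * x + β * y ∈ Ideal.span {x, y} ^ 2) :
    β ∈ Ideal.span {x, y} := by
  rw [pow_two, Ideal.span_pair_mul_span_pair] at h
  obtain ⟨p, h1, hp, e1⟩ := Ideal.mem_span_insert.mp h
  obtain ⟨q, h2, hq, e2⟩ := Ideal.mem_span_insert.mp hp
  obtain ⟨r, w, e3⟩ := Ideal.mem_span_pair.mp hq
  have h3 : x ∣ (β - w * y) * y := ⟨p * x + q * y + r * y - α, by
    rw [e2, ← e3] at e1; linear_combination e1⟩
  obtain ⟨c, hc⟩ := (hx.dvd_or_dvd h3).resolve_right hxy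
  exact Ideal.mem_span_pair.mpr ⟨c, w, by linear_combination -hc⟩

lemma frac_eq_mul_add_mul {R A : Type u} [CommRing R] [CommRing A] [Algebra R A]
    {𝒜 : ℕ → Submodule R A} [GradedAlgebra 𝒜] {y : A} (hy : y ∈ 𝒜 1) {d : ℕ} {f u a v b : A}
    (hf : f ∈ 𝒜 (d + 1)) (hu : u ∈ 𝒜 1) (ha : a ∈ 𝒜 d) (hv : v ∈ 𝒜 1) (hb : b ∈ 𝒜 d)
    (h : f = u * a + v * b) :
    frac hy hf = frac hy hu * frac hy ha + frac hy hv * frac hy hb := by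
  refine eq_of_valueAt_mul_pow le_rfl (d + 1) fun x => ?_
  rw [valueAt_frac_mul, h, map_add, map_mul, map_mul, ← valueAt_frac_mul hy hu x,
    ← valueAt_frac_mul hy hv x, ← valueAt_frac_mul hy ha x, ← valueAt_frac_mul hy hb x,
    map_add, map_mul, map_mul]
  ring

/-- At the point X₁ = 0 one has s ≡ s(1, 0) X₀ᵈ modulo I. -/
lemma notMem_of_eval_ne_zero {d : ℕ} {s : MvPolynomial (Fin 2) ℂ} (hs : s ∈ coordGrading 1 d)
    (h : MvPolynomial.eval ![1, 0] s ≠ 0) {I : Ideal (MvPolynomial (Fin 2) ℂ)} [I.IsPrime]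
    (h0 : MvPolynomial.X 0 ∉ I) (h1 : MvPolynomial.X 1 ∈ I) : s ∉ I := by
  intro hI
  let e : ℂ →+* MvPolynomial (Fin 2) ℂ ⧸ I := (Ideal.Quotient.mk I).comp MvPolynomial.C
  have h2 := aeval_mul_pow (e := e) (h := fun i => e ((![1, 0] : Fin 2 → ℂ) i))
    (g := fun i => Ideal.Quotient.mk I (MvPolynomial.X i)) (u := Ideal.Quotient.mk I (MvPolynomial.X 0))
    (fun i => by
      fin_cases i
      · simp
      · simpa using (Ideal.Quotient.eq_zero_iff_mem.mpr h1).symm) hs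
  have h3 : MvPolynomial.eval₂ e (fun i => Ideal.Quotient.mk I (MvPolynomial.X i)) s =
      Ideal.Quotient.mk I s := by
    have : MvPolynomial.eval₂Hom e (fun i => Ideal.Quotient.mk I (MvPolynomial.X i)) =
        Ideal.Quotient.mk I := MvPolynomial.ringHom_ext (fun c => by simp [e]) fun i => by simp
    exact RingHom.congr_fun this s
  have h4 : MvPolynomial.eval₂ e (fun i => e ((![1, 0] : Fin 2 → ℂ) i)) s =
      e (MvPolynomial.eval ![1, 0] s) := (MvPolynomial.eval₂_comp e ![1, 0] s).symm
  rw [h3, Ideal.Quotient.eq_zero_iff_mem.mpr hI, h4] at h2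
  rcases mul_eq_zero.mp h2 with h5 | h5
  · exact h ((map_eq_zero e).mp h5)
  · exact h0 (Ideal.Quotient.eq_zero_iff_mem.mp (eq_zero_of_pow_eq_zero h5))

namespace Frame

variable (σ : Frame 3)

lemma C_mem_coordGrading {n : ℕ} (c : ℂ) :
    (MvPolynomial.C c : MvPolynomial (Fin (n + 1)) ℂ) ∈ coordGrading n 0 :=
  MvPolynomial.isHomogeneous_C _ c

lemma dehom_C (k : Fin 4) (c : ℂ) :
    σ.dehom k (C_mem_coordGrading c) = constantsOn (σ.U k).1 c := by
  refine Eq.trans ?_ (σ.chartEquiv_C k c)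
  have h := σ.chartEquiv_subst k (C_mem_coordGrading c)
  refine Eq.trans (frac_congr _ _ _ (σ.equiv.commutes c).symm) (h.symm.trans (congrArg _ ?_))
  exact (subst k).commutes c

lemma prime_dehom {k i : Fin 4} (h : i ≠ k) : Prime (σ.dehom k (σ.coord_mem i)) := by
  obtain ⟨j, rfl⟩ := Fin.exists_succAbove_eq h
  rw [← chartEquiv_X]
  exact (MulEquiv.prime_iff (σ.chartEquiv k)).mpr (MvPolynomial.X_prime)

lemma not_dehom_dvd {k i i' : Fin 4} (h : i ≠ k) (h' : i' ≠ k) (hi : i ≠ i') :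
    ¬ σ.dehom k (σ.coord_mem i) ∣ σ.dehom k (σ.coord_mem i') := by
  obtain ⟨j, rfl⟩ := Fin.exists_succAbove_eq h
  obtain ⟨j', rfl⟩ := Fin.exists_succAbove_eq h'
  rw [← chartEquiv_X, ← chartEquiv_X, map_dvd_iff, MvPolynomial.X_dvd_X]
  exact fun h1 => hi (congrArg _ h1)

lemma idx_ne_two (k : Fin 2) : (2 : Fin 4) ≠ idx k := by fin_cases k <;> decide

lemma idx_ne_three (k : Fin 2) : (3 : Fin 4) ≠ idx k := by fin_cases k <;> decide

lemma dehom_mul_coord {k : Fin 4} {d : ℕ} {f : MvPolynomial (Fin 4) ℂ} (hf : f ∈ coordGrading 3 d) :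
    σ.dehom k (SetLike.mul_mem_graded hf (σ.coord_mem k)) = σ.dehom k hf := by
  have h1 : σ.coord k ^ 1 ∈ coordGrading 3 1 := by simpa using σ.coord_mem k
  refine (frac_mul (σ.coord_mem k) hf (σ.coord_mem k)).symm.trans ?_
  rw [frac_congr (σ.coord_mem k) (σ.coord_mem k) h1 (pow_one _).symm,
    frac_self_pow (σ.coord_mem k) 1 h1, mul_one]
  rfl

lemma dehom_eq {k : Fin 4} {d : ℕ} {f a b : MvPolynomial (Fin 4) ℂ} (hf : f ∈ coordGrading 3 (d + 1))
    (ha : a ∈ coordGrading 3 d) (hb : b ∈ coordGrading 3 d)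
    (h : f = σ.coord 2 * a + σ.coord 3 * b) : σ.dehom k hf =
      σ.dehom k (σ.coord_mem 2) * σ.dehom k ha + σ.dehom k (σ.coord_mem 3) * σ.dehom k hb :=
  frac_eq_mul_add_mul (σ.coord_mem k) hf (σ.coord_mem 2) ha (σ.coord_mem 3) hb h

lemma isConormalFrame (k : Fin 2) : IsConormalFrame σ.line (σ.U (idx k))
    (σ.dehom (idx k) (σ.coord_mem 2)) (σ.dehom (idx k) (σ.coord_mem 3)) := by
  have h2 := (σ.line_app_eq_zero_iff (k := k) (σ.coord_mem 2)).mpr σ.toLine_coord_two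
  have h3 := (σ.line_app_eq_zero_iff (k := k) (σ.coord_mem 3)).mpr σ.toLine_coord_three
  have hspan : ∀ r ∈ Ideal.span {σ.dehom (idx k) (σ.coord_mem 2), σ.dehom (idx k) (σ.coord_mem 3)},
      σ.line.app (σ.U (idx k)).1 r = 0 := by
    intro r hr
    obtain ⟨p, q, rfl⟩ := Ideal.mem_span_pair.mp hr
    rw [map_add, map_mul, map_mul, h2, h3, mul_zero, mul_zero, add_zero]
  refine ⟨h2, h3, fun r hr => ?_, fun α β h => ⟨hspan α ?_, hspan β ?_⟩⟩
  · obtain ⟨d, f, hf, rfl⟩ := exists_eq_frac (σ.coord_mem (idx k)) r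
    have h0 := (σ.line_app_eq_zero_iff (k := k) hf).mp hr
    -- Multiplying numerator and denominator by the chart coordinate makes the degree positive,
    -- which is needed to split off y₂ and y₃.
    obtain ⟨a, ha, b, hb, e⟩ := σ.exists_eq_of_toLine_eq_zero
      (SetLike.mul_mem_graded hf (σ.coord_mem (idx k))) (by
        change σ.toLine.toRingHom (f * _) = 0
        rw [map_mul]
        exact mul_eq_zero_of_left h0 _)
    refine ⟨σ.dehom (idx k) ha, σ.dehom (idx k) hb, ?_⟩
    have h1 := σ.dehom_eq (k := idx k) (SetLike.mul_mem_graded hf (σ.coord_mem (idx k))) ha hb e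
    rw [σ.dehom_mul_coord hf] at h1
    refine h1.trans ?_
    ring
  · rw [Set.pair_comm (σ.dehom _ _)] at h ⊢
    rw [add_comm (α * _)] at h
    exact mem_span_pair_of_mem_sq (σ.prime_dehom (idx_ne_three k))
      (σ.not_dehom_dvd (idx_ne_three k) (idx_ne_two k) (by decide)) h
  · exact mem_span_pair_of_mem_sq (σ.prime_dehom (idx_ne_two k))
      (σ.not_dehom_dvd (idx_ne_two k) (idx_ne_three k) (by decide)) h

open Polynomial

/-- Restriction of functions to the affine part of the line. -/
def toAffineLine : Γ(PSpace 3, (σ.U (idx 1)).1) →+* ℂ[X] :=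
  lineChart.symm.toRingHom.comp (σ.line.appLE _ (chart (n := 1) 1).1 (σ.line_preimage 1).ge).hom

lemma lineChart_toAffineLine (r : Γ(PSpace 3, (σ.U (idx 1)).1)) :
    lineChart (σ.toAffineLine r) = (σ.line.appLE _ (chart (n := 1) 1).1 (σ.line_preimage 1).ge).hom r :=
  lineChart.apply_symm_apply _

lemma toAffineLine_dehom {d : ℕ} {f : MvPolynomial (Fin 4) ℂ} (hf : f ∈ coordGrading 3 d) :
    σ.toAffineLine (σ.dehom (idx 1) hf) = MvPolynomial.aeval ![X, 1] (σ.toLine f) := by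
  apply lineChart.injective
  rw [lineChart_toAffineLine, lineChart_aeval (σ.toLine_mem hf),
    σ.line_appLE hf (σ.toLine_mem hf) rfl _ le_rfl, rs_self]

lemma toAffineLine_surjective : Function.Surjective σ.toAffineLine := by
  intro p
  have hp : p.homogenize p.natDegree ∈ coordGrading 1 p.natDegree :=
    Polynomial.isHomogeneous_homogenize ..
  refine ⟨σ.dehom (idx 1) (σ.mem (lineSection_mem hp)), ?_⟩
  rw [toAffineLine_dehom, toLine_lift, Polynomial.aeval_homogenize_of_eq_one]
  all_goals simp

lemma toAffineLine_constantsOn (c : ℂ) :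
    σ.toAffineLine (constantsOn (σ.U (idx 1)).1 c) = C c := by
  rw [← dehom_C, toAffineLine_dehom]
  have : σ.toLine (MvPolynomial.C c) = MvPolynomial.C c :=
    (lineHom.comp σ.equiv.symm.toAlgHom).commutes c
  rw [this]
  simp

lemma toAffineLine_eq_zero_iff (r : Γ(PSpace 3, (σ.U (idx 1)).1)) :
    σ.toAffineLine r = 0 ↔ σ.line.app _ r = 0 := by
  rw [← map_eq_zero_iff _ lineChart.injective, lineChart_toAffineLine]
  have h : Function.Injective (rs (σ.line_preimage 1).ge) := by
    intro s t hst
    have := congrArg (rs (σ.line_preimage 1).le) hst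
    rwa [rs_rs, rs_rs, rs_self, rs_self] at this
  exact map_eq_zero_iff (rs (σ.line_preimage 1).ge) h

variable {σ} {C L : (PSpace 3).IdealSheafData} {f : Fin 2 → MvPolynomial (Fin 4) ℂ}
  {hf : ∀ j, f j ∈ coordGrading 3 1}

lemma support_eq_range_line (hL : IsZeroScheme L f hf) (h2 : σ.coord 2 = f 0)
    (h3 : σ.coord 3 = f 1) : (L.support : Set (PSpace 3)) = Set.range σ.line := by
  ext x
  rw [SetLike.mem_coe, hL.mem_support_iff, Fin.forall_fin_two, ← h2, ← h3]
  exact ⟨fun h => σ.mem_range_line h.1 h.2, fun h => σ.coord_mem_of_mem_range h⟩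

lemma ker_toAffineLine (hL : IsZeroScheme L f hf) (h2 : σ.coord 2 = f 0) (h3 : σ.coord 3 = f 1) :
    RingHom.ker σ.toAffineLine = L.ideal (σ.U (idx 1)) := by
  have hcf := σ.isConormalFrame 1
  have e : (Set.range fun j => σ.dehom (idx 1) (hf j)) =
      {σ.dehom (idx 1) (σ.coord_mem 2), σ.dehom (idx 1) (σ.coord_mem 3)} := by
    ext r
    simp only [Set.mem_range, Fin.exists_fin_two, Set.mem_insert_iff, Set.mem_singleton_iff]
    have e2 : σ.dehom (idx 1) (hf 0) = σ.dehom (idx 1) (σ.coord_mem 2) := frac_congr _ _ _ h2.symm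
    have e3 : σ.dehom (idx 1) (hf 1) = σ.dehom (idx 1) (σ.coord_mem 3) := frac_congr _ _ _ h3.symm
    rw [e2, e3, eq_comm, @eq_comm _ _ r]
  rw [hL.ideal_eq σ (idx 1), e]
  ext r
  rw [RingHom.mem_ker, toAffineLine_eq_zero_iff, Ideal.mem_span_pair]
  constructor
  · intro h
    obtain ⟨α, β, h⟩ := hcf.exists_eq r h
    exact ⟨α, β, h.symm⟩
  · rintro ⟨α, β, rfl⟩
    rw [map_add, map_mul, map_mul, hcf.app₁, hcf.app₂, mul_zero, mul_zero, add_zero]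

/-- The intersection of a line with a closed subscheme is cut out by a binary form whose degree is
the length of the intersection. -/
theorem exists_form (hL : IsZeroScheme L f hf) (h2 : σ.coord 2 = f 0) (h3 : σ.coord 3 = f 1)
    {m : ℕ} (hm : 0 < m) (hlen : HasLength (subschemeToSpec (C ⊔ L)) m)
    (hU : ∀ x ∈ (C ⊔ L).support, x ∈ (σ.U 1).1) :
    ∃ (s : MvPolynomial (Fin 2) ℂ) (hs : s ∈ coordGrading 1 m),
      (MvPolynomial.aeval ![X, (1 : ℂ[X])] s).natDegree = m ∧
      ∀ k, (C.comap σ.line).ideal (chart k) = Ideal.span {dehomogenize k s hs} := by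
  let J : Ideal ℂ[X] := (C.ideal (σ.U (idx 1))).map σ.toAffineLine
  obtain ⟨p, hp⟩ := (IsPrincipalIdealRing.principal J).principal
  change J = Ideal.span {p} at hp
  -- C ∩ L lies entirely in the chart of y₁, so this quotient is its ring of functions and p has
  -- degree m.
  have hrank : Module.finrank ℂ (ℂ[X] ⧸ Ideal.span {p}) = m := by
    refine finrank_eq_of_hasLength hlen (U := σ.U (idx 1)) hU
      ((Ideal.Quotient.mk _).comp σ.toAffineLine)
      (Ideal.Quotient.mk_surjective.comp σ.toAffineLine_surjective) ?_ fun c => ?_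
    · rw [← RingHom.comap_ker, Ideal.mk_ker, ← hp,
        Ideal.comap_map_of_surjective' _ σ.toAffineLine_surjective, ker_toAffineLine hL h2 h3]
      rfl
    · rw [RingHom.comp_apply, toAffineLine_constantsOn]
      rfl
  rw [finrank_quotient_span_eq_natDegree] at hrank
  -- For p = 0 the degree takes the default value 0, which m > 0 excludes.
  have hp0 : p ≠ 0 := by
    rintro rfl
    rw [natDegree_zero] at hrank
    omega
  have hs : p.homogenize m ∈ coordGrading 1 m := Polynomial.isHomogeneous_homogenize ..
  have hps : MvPolynomial.aeval ![X, 1] (p.homogenize m) = p := by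
    rw [Polynomial.aeval_homogenize_of_eq_one hrank.le _ (by simp)]
    simp
  have heval : MvPolynomial.eval ![1, 0] (p.homogenize m) ≠ 0 := by
    rw [eval_homogenize_one_zero, ← hrank]
    exact leadingCoeff_ne_zero.mpr hp0
  have h1 : (C.comap σ.line).ideal (chart (n := 1) 1) = Ideal.span {dehomogenize 1 _ hs} := by
    rw [ideal_comap C σ.line (σ.U (idx 1)) (chart 1) (σ.line_preimage 1).ge]
    have e : (σ.line.appLE _ (chart (n := 1) 1).1 (σ.line_preimage 1).ge).hom =
        lineChart.toRingHom.comp σ.toAffineLine :=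
      RingHom.ext fun r => (σ.lineChart_toAffineLine r).symm
    rw [e, ← Ideal.map_map]
    change J.map _ = _
    rw [hp, Ideal.map_span, Set.image_singleton, ← lineChart_aeval, hps]
    rfl
  refine ⟨_, hs, by rw [hps, hrank], fun k => ?_⟩
  have hr : ∀ k, (Set.range fun _ : Fin 1 => dehomogenize k _ hs) = {dehomogenize k _ hs} :=
    fun k => Set.range_const
  fin_cases k
  · rw [(chart (n := 1) 0).2.ideal_ext_iff]
    intro z hz
    by_cases hz1 : z ∈ (chart (n := 1) 1).1
    · have := map_germ_ideal_eq (Z := C.comap σ.line) (fun _ : Fin 1 => hs)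
        (X_mem_coordGrading 1) (X_mem_coordGrading 0) (h1.trans (by rw [← hr 1]; rfl)) hz hz1
      exact this.trans (congrArg (fun T => (Ideal.span T).map _) (hr 0))
    -- At infinity both ideals are the unit ideal: C does not meet L there, and s does not vanish
    -- there because its degree in the affine coordinate is exactly m.
    · have hz' : z ∉ (C.comap σ.line).support := by
        intro hzC
        rw [← SetLike.mem_coe, Scheme.IdealSheafData.support_comap] at hzC
        refine hz1 ?_
        rw [← σ.line_preimage 1]
        refine hU _ ?_
        rw [Scheme.IdealSheafData.support_sup]
        refine ⟨hzC, ?_⟩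
        rw [support_eq_range_line hL h2 h3]
        exact ⟨z, rfl⟩
      have htop : ∀ (I : Ideal Γ(PSpace 1, (chart (n := 1) 0).1)) (r), r ∈ I →
          z ∈ (PSpace 1).basicOpen r → I.map ((PSpace 1).presheaf.germ _ z hz).hom = ⊤ := by
        intro I r hr hzr
        rw [Scheme.mem_basicOpen _ _ _ hz] at hzr
        exact Ideal.eq_top_of_isUnit_mem _ (Ideal.mem_map_of_mem _ hr) hzr
      rw [Scheme.IdealSheafData.mem_support_iff_of_mem hz, Scheme.mem_zeroLocus_iff] at hz'
      push Not at hz'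
      obtain ⟨r, hr1, hr2⟩ := hz'
      refine (htop _ r hr1 hr2).trans (htop _ _ (Ideal.mem_span_singleton_self _) ?_).symm
      refine (mem_basicOpen_frac (X_mem_coordGrading 0) hs hz).mpr ?_
      have := (pt z).isPrime
      exact notMem_of_eval_ne_zero hs heval hz (not_not.mp hz1)
  · exact h1

end Frame

end LineIdeals

/-! ### Smoothness in the charts of a frame -/

section SmoothCharts

open TensorProduct KaehlerDifferential

variable {n : ℕ}

lemma Frame.isDomain (σ : Frame n) (k : Fin (n + 1)) : IsDomain Γ(PSpace n, (σ.U k).1) :=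
  (σ.chartEquiv k).symm.toMulEquiv.isDomain _

/-- The ideal of a closed subscheme in the coordinates of a chart. -/
abbrev Frame.chartIdeal (σ : Frame n) (k : Fin (n + 1)) (Z : (PSpace n).IdealSheafData) :
    Ideal (MvPolynomial (Fin n) ℂ) := (Z.ideal (σ.U k)).comap (σ.chartEquiv k)

/-- Turns a local property of the morphism Z → Spec ℂ into one of a quotient of a polynomial ring.
It serves both for smoothness and for smoothness of relative dimension 1. -/
lemma algebraMap_quotient_chartIdeal {P : MorphismProperty Scheme.{0}}
    {Q : ∀ {R S : Type} [CommRing R] [CommRing S], (R →+* S) → Prop} [HasRingHomProperty P Q]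
    {Z : (PSpace n).IdealSheafData} (hZ : P (subschemeToSpec Z)) (σ : Frame n) (k : Fin (n + 1)) :
    Q (algebraMap ℂ (MvPolynomial (Fin n) ℂ ⧸ σ.chartIdeal k Z)) := by
  have hV : IsAffineOpen (Z.subschemeι ⁻¹ᵁ (σ.U k).1) := (σ.U k).2.preimage _
  have e0 : Z.subschemeι ⁻¹ᵁ (σ.U k).1 ≤ subschemeToSpec Z ⁻¹ᵁ ⊤ := le_top
  have h1 : Q ((subschemeToSpec Z).appLE ⊤ (Z.subschemeι ⁻¹ᵁ (σ.U k).1) e0).hom :=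
    HasRingHomProperty.appLE P (subschemeToSpec Z) hZ ⟨⊤, isAffineOpen_top _⟩ ⟨_, hV⟩ e0
  have hiso := (HasRingHomProperty.isLocal_ringHomProperty P (Q := Q)).respectsIso
  let α : MvPolynomial (Fin n) ℂ →+* Γ(Z.subscheme, Z.subschemeι ⁻¹ᵁ (σ.U k).1) :=
    (Z.subschemeι.app (σ.U k).1).hom.comp (σ.chartEquiv k).toRingHom
  have hα : Function.Surjective α :=
    (Z.subschemeι_app_surjective (σ.U k)).comp (σ.chartEquiv k).surjective
  have hker : RingHom.ker α = σ.chartIdeal k Z := by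
    rw [← RingHom.comap_ker, Z.ker_subschemeι_app]
    rfl
  let e : Γ(Z.subscheme, Z.subschemeι ⁻¹ᵁ (σ.U k).1) ≃+* MvPolynomial (Fin n) ℂ ⧸ σ.chartIdeal k Z :=
    (RingHom.quotientKerEquivOfSurjective hα).symm.trans (Ideal.quotEquivOfEq hker)
  have he : ∀ p, e (α p) = Ideal.Quotient.mk _ p := by
    intro p
    have : (RingHom.quotientKerEquivOfSurjective hα).symm (α p) = Ideal.Quotient.mk _ p := by
      rw [RingEquiv.symm_apply_eq]; rfl
    simp only [e, RingEquiv.trans_apply, this]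
    rfl
  have h2 := hiso.1 _ e (hiso.2 (R := ℂ) _ (Scheme.ΓSpecIso (CommRingCat.of ℂ)).symm.commRingCatIsoToRingEquiv h1)
  refine cast (congrArg Q ?_) h2
  symm
  refine RingHom.ext fun c => ?_
  refine (he (MvPolynomial.C c)).symm.trans (congrArg e ?_)
  change Z.subschemeι.app (σ.U k).1 (σ.chartEquiv k (MvPolynomial.C c)) = _
  rw [Frame.chartEquiv_C]
  have e1 : Z.subschemeι ⁻¹ᵁ (σ.U k).1 ≤ Z.subschemeι ⁻¹ᵁ ⊤ := le_top
  have e2 : (⊤ : (PSpace n).Opens) ≤ PSpace.toSpec n ⁻¹ᵁ ⊤ := le_top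
  have h3 := appLE_rs Z.subschemeι (le_top : (σ.U k).1 ≤ ⊤) le_rfl
    (constants (PSpace.toSpec n) c)
  have h4 := appLE_appLE Z.subschemeι (PSpace.toSpec n) e2 e1 e0
    ((Scheme.ΓSpecIso (CommRingCat.of ℂ)).inv c)
  have h5 : ((PSpace.toSpec n).appLE ⊤ ⊤ e2).hom ((Scheme.ΓSpecIso (CommRingCat.of ℂ)).inv c) =
      constants (PSpace.toSpec n) c :=
    ConcreteCategory.congr_hom (Scheme.Hom.appLE_eq_app (f := PSpace.toSpec n) (U := ⊤)) _
  rw [h5] at h4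
  rw [← Scheme.Hom.appLE_eq_app]
  exact h3.trans h4

lemma Frame.formallySmooth_quotient {d : ℕ} {Z : (PSpace n).IdealSheafData}
    (hZ : SmoothOfRelativeDimension d (subschemeToSpec Z)) (σ : Frame n) (k : Fin (n + 1)) :
    Algebra.FormallySmooth ℂ (MvPolynomial (Fin n) ℂ ⧸ σ.chartIdeal k Z) := by
  have h : Smooth (subschemeToSpec Z) := hZ.smooth
  have := algebraMap_quotient_chartIdeal (P := @Smooth) (Q := RingHom.Smooth) h σ k
  exact RingHom.formallySmooth_algebraMap.mp (RingHom.smooth_def.mp this).1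

lemma tmul_smul_eq_zero {P M : Type*} [CommRing P] [AddCommGroup M] [Module P M] {p : Ideal P}
    [p.IsPrime] {x : P} (hx : x ∈ p) (d : M) : (1 : p.ResidueField) ⊗ₜ[P] (x • d) = 0 := by
  rw [← TensorProduct.smul_tmul, Algebra.smul_def, Ideal.algebraMap_residueField_eq_zero.mpr hx,
    zero_mul, TensorProduct.zero_tmul]

variable {S : (PSpace n).IdealSheafData} {d e : ℕ} {F : MvPolynomial (Fin (n + 1)) ℂ}
  {hF : F ∈ coordGrading n d}

lemma Frame.tmul_D_ne_zero (hS : IsZeroScheme S (fun _ : Fin 1 => F) (fun _ => hF)) (hF0 : F ≠ 0)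
    (hsm : SmoothOfRelativeDimension e (subschemeToSpec S)) (σ : Frame n) (k : Fin (n + 1))
    {p : Ideal (MvPolynomial (Fin n) ℂ)} [p.IsPrime]
    (hp : (σ.chartEquiv k).symm (σ.dehom k hF) ∈ p) :
    (1 : p.ResidueField) ⊗ₜ[MvPolynomial (Fin n) ℂ]
      D ℂ (MvPolynomial (Fin n) ℂ) ((σ.chartEquiv k).symm (σ.dehom k hF)) ≠ 0 := by
  have hJ : σ.chartIdeal k S = Ideal.span {(σ.chartEquiv k).symm (σ.dehom k hF)} := by
    unfold chartIdeal
    rw [hS.ideal_eq σ k, Set.range_const]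
    have h1 := Ideal.comap_symm (I := Ideal.span {σ.dehom k hF}) (σ.chartEquiv k).symm
    rw [Ideal.map_span, Set.image_singleton] at h1
    exact h1
  have h1 := formallySmooth_quotient hsm σ k
  rw [hJ] at h1
  refine NormalBundleLines.tmul_D_ne_zero ?_ hp
  rw [Ne, EmbeddingLike.map_eq_zero_iff]
  exact frac_ne_zero (σ.coord_mem k) (σ.coord_ne_zero k) hF hF0

end SmoothCharts

/-! ### The geometry of a secant line in a frame -/

section SecantGeometry

open TensorProduct KaehlerDifferential

lemma exists_linearMap_residueField_ne_zero {k P : Type u} [CommRing k] [CommRing P] [Algebra k P]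
    {J p : Ideal P} [p.IsPrime] (hJp : J ≤ p) {n : ℕ} (hn : 0 < n)
    (h : RingHom.Locally (RingHom.IsStandardSmoothOfRelativeDimension n) (algebraMap k (P ⧸ J))) :
    ∃ δ : Ω[P⁄k] →ₗ[P] p.ResidueField, δ ≠ 0 ∧ ∀ j ∈ J, δ (D k P j) = 0 := by
  let : Algebra (P ⧸ J) p.ResidueField :=
    (Ideal.Quotient.lift _ (algebraMap P p.ResidueField)
      fun a ha => Ideal.algebraMap_residueField_eq_zero.mpr (hJp ha)).toAlgebra
  have : IsScalarTower P (P ⧸ J) p.ResidueField := IsScalarTower.of_algebraMap_eq fun x => rfl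
  obtain ⟨δ, hδ, hδJ⟩ := exists_linearMap_kaehler_ne_zero (k := k) (P := P) (Q := P ⧸ J)
    (K := p.ResidueField) Ideal.Quotient.mk_surjective hn h
  exact ⟨δ, hδ, fun j hj => hδJ j (Ideal.Quotient.eq_zero_iff_mem.mpr hj)⟩

/-- By the Leibniz rule every term keeps a factor in p. Geometrically, a common zero of y₂, y₃, A
and B is a critical point of y₂A + y₃B. -/
lemma tmul_D_eq_zero {k P : Type u} [CommRing k] [CommRing P] [Algebra k P] {p : Ideal P} [p.IsPrime]
    {x a y b : P} (hx : x ∈ p) (ha : a ∈ p) (hy : y ∈ p) (hb : b ∈ p) :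
    (1 : p.ResidueField) ⊗ₜ[P] D k P (x * a + y * b) = 0 := by
  rw [map_add, Derivation.leibniz, Derivation.leibniz, TensorProduct.tmul_add,
    TensorProduct.tmul_add, TensorProduct.tmul_add, tmul_smul_eq_zero hx,
    tmul_smul_eq_zero ha, tmul_smul_eq_zero hy, tmul_smul_eq_zero hb, add_zero, add_zero]

/-- The generic point of projective space. -/
def genericPt (n : ℕ) : PSpace n := ⟨⟨⊥, Ideal.IsHomogeneous.bot _⟩, Ideal.isPrime_bot, fun h => by
    have : (MvPolynomial.X 0 : MvPolynomial (Fin (n + 1)) ℂ) ∈ (⊥ : Ideal _) := h (by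
      exact HomogeneousIdeal.mem_irrelevant_of_mem (coordGrading n) one_pos (X_mem_coordGrading 0))
    exact MvPolynomial.X_ne_zero 0 this⟩

lemma mem_genericPt_iff {n : ℕ} (s : MvPolynomial (Fin (n + 1)) ℂ) :
    s ∈ (pt (genericPt n)).asHomogeneousIdeal.toIdeal ↔ s = 0 := Iff.rfl

lemma dehomogenize_ne_zero {n d : ℕ} (k : Fin (n + 1)) {s : MvPolynomial (Fin (n + 1)) ℂ}
    (hs : s ∈ coordGrading n d) (h : s ≠ 0) : dehomogenize k s hs ≠ 0 :=
  frac_ne_zero (X_mem_coordGrading k) (MvPolynomial.X_ne_zero k) hs h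

lemma isEffectiveCartier_of_isZeroScheme {n d : ℕ} {Z : (PSpace n).IdealSheafData}
    {s : MvPolynomial (Fin (n + 1)) ℂ} {hs : s ∈ coordGrading n d}
    (hZ : IsZeroScheme Z (fun _ : Fin 1 => s) (fun _ => hs)) (h : s ≠ 0) : IsEffectiveCartier Z := by
  intro x
  obtain ⟨k, hk⟩ := exists_mem_chart x
  have : IsDomain Γ(PSpace n, (chart k).1) := (Frame.std n).isDomain k
  refine ⟨chart k, hk, dehomogenize k s hs,
    mem_nonZeroDivisors_of_ne_zero (dehomogenize_ne_zero k hs h), ?_⟩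
  rw [hZ k, Set.range_const]

lemma span_pair_eq_top_of_map {R T : Type*} [CommRing R] [CommRing T] (φ : R →+* T) {v : Fin 4 → R}
    (h : Ideal.span (Set.range v) = ⊤) (h0 : φ (v 0) = 0) (h1 : φ (v 1) = 0) {a b : T}
    (ha : φ (v 2) = a) (hb : φ (v 3) = b) : Ideal.span {a, b} = ⊤ := by
  have h2 := congrArg (Ideal.map φ) h
  rw [Ideal.map_top, Ideal.map_span, ← Set.range_comp] at h2
  rw [eq_top_iff, ← h2, Ideal.span_le]
  rintro _ ⟨j, rfl⟩
  rw [SetLike.mem_coe, Function.comp_apply]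
  revert j
  simp only [Fin.forall_fin_succ, IsEmpty.forall_iff, and_true]
  exact ⟨h0 ▸ zero_mem _, h1 ▸ zero_mem _, Ideal.subset_span (by simp [← ha]),
    Ideal.subset_span (by simp [← hb])⟩

namespace Frame

variable {σ : Frame 3} {S C : (PSpace 3).IdealSheafData} {F : MvPolynomial (Fin 4) ℂ}

lemma line_appLE_chart {k : Fin 2} {d : ℕ} {f : MvPolynomial (Fin 4) ℂ} (hf : f ∈ coordGrading 3 d) :
    (σ.line.appLE _ (chart k).1 (σ.line_preimage k).ge).hom (σ.dehom (idx k) hf) =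
      dehomogenize k (σ.toLine f) (σ.toLine_mem hf) := by
  rw [σ.line_appLE hf (σ.toLine_mem hf) rfl _ le_rfl, rs_self]

open Polynomial in
/-- A form vanishing on a closed subscheme that meets a line in a scheme of length greater than its
degree vanishes on the line. -/
lemma toLine_eq_zero {d m : ℕ} (hF : F ∈ coordGrading 3 d)
    (hS : IsZeroScheme S (fun _ : Fin 1 => F) (fun _ => hF)) (hSC : S ≤ C)
    {s : MvPolynomial (Fin 2) ℂ} {hs : s ∈ coordGrading 1 m}
    (hsm : (MvPolynomial.aeval ![X, (1 : ℂ[X])] s).natDegree = m)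
    (hC : IsZeroScheme (C.comap σ.line) (fun _ : Fin 1 => s) (fun _ => hs)) (hdm : d < m) :
    σ.toLine F = 0 := by
  have h1 : σ.dehom (idx 1) hF ∈ C.ideal (σ.U (idx 1)) := by
    refine hSC (σ.U (idx 1)) ?_
    rw [hS.ideal_eq σ, Set.range_const]
    exact Ideal.mem_span_singleton_self _
  have h2 := Ideal.mem_map_of_mem (σ.line.appLE _ (chart (n := 1) 1).1 (σ.line_preimage 1).ge).hom h1
  rw [← ideal_comap C σ.line (σ.U (idx 1)) (chart 1) (σ.line_preimage 1).ge, hC 1, Set.range_const,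
    Ideal.mem_span_singleton, line_appLE_chart, ← lineChart_aeval, ← lineChart_aeval,
    map_dvd_iff] at h2
  -- The ideal of C restricts to (s) on the line and contains F, so s divides the restriction of F,
  -- whose degree is smaller than m.
  have h3 := Polynomial.eq_zero_of_dvd_of_natDegree_lt h2 (by
    rw [hsm]
    exact (natDegree_aeval_le (σ.toLine_mem hF)).trans_lt hdm)
  have h4 := homogenize_aeval (σ.toLine_mem hF)
  rw [h3, Polynomial.homogenize_zero] at h4
  exact h4.symm

lemma toLine_eq_zero_of_le {d : ℕ} (hF : F ∈ coordGrading 3 d) {L : (PSpace 3).IdealSheafData}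
    (hS : IsZeroScheme S (fun _ : Fin 1 => F) (fun _ => hF)) (hSL : S ≤ L)
    {f : Fin 2 → MvPolynomial (Fin 4) ℂ} {hf : ∀ j, f j ∈ coordGrading 3 1}
    (hL : IsZeroScheme L f hf) (h2 : σ.coord 2 = f 0) (h3 : σ.coord 3 = f 1) : σ.toLine F = 0 := by
  have h1 : σ.dehom (idx 1) hF ∈ L.ideal (σ.U (idx 1)) := by
    refine hSL (σ.U (idx 1)) ?_
    rw [hS.ideal_eq σ, Set.range_const]
    exact Ideal.mem_span_singleton_self _
  rw [← ker_toAffineLine hL h2 h3, RingHom.mem_ker, toAffineLine_eq_zero_iff] at h1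
  exact (σ.line_app_eq_zero_iff hF).mp h1

variable {d e : ℕ} {hF : F ∈ coordGrading 3 (d + 1)}

/-- On a line in a smooth surface, the derivatives of the equation of the surface in the normal
directions have no common zero. -/
theorem span_dehomogenize_eq_top (hS : IsZeroScheme S (fun _ : Fin 1 => F) (fun _ => hF))
    (hF0 : F ≠ 0) (hsm : SmoothOfRelativeDimension e (subschemeToSpec S))
    {A B : MvPolynomial (Fin 4) ℂ} (hA : A ∈ coordGrading 3 d) (hB : B ∈ coordGrading 3 d)
    (hAB : F = σ.coord 2 * A + σ.coord 3 * B) (k : Fin 2) :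
    Ideal.span {dehomogenize k (σ.toLine A) (σ.toLine_mem hA),
      dehomogenize k (σ.toLine B) (σ.toLine_mem hB)} = ⊤ := by
  let κ := σ.chartEquiv (idx k)
  let v : Fin 4 → Γ(PSpace 3, (σ.U (idx k)).1) := ![σ.dehom (idx k) (σ.coord_mem 2),
    σ.dehom (idx k) (σ.coord_mem 3), σ.dehom (idx k) hA, σ.dehom (idx k) hB]
  -- A maximal ideal containing y₂, y₃, A and B would be a point of S at which the differential of F
  -- vanishes.
  have htop : Ideal.span (Set.range v) = ⊤ := by
    by_contra hne
    obtain ⟨M, hM, hle⟩ := Ideal.exists_le_maximal _ hne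
    have hv : ∀ j, κ.symm (v j) ∈ M.comap κ := fun j => by
      rw [Ideal.mem_comap, RingEquiv.apply_symm_apply]
      exact hle (Ideal.subset_span ⟨j, rfl⟩)
    have : (M.comap κ).IsPrime := Ideal.IsPrime.comap κ
    have hFe : κ.symm (σ.dehom (idx k) hF) =
        κ.symm (v 0) * κ.symm (v 2) + κ.symm (v 1) * κ.symm (v 3) := by
      rw [← map_mul, ← map_mul, ← map_add]
      exact congrArg κ.symm (σ.dehom_eq hF hA hB hAB)
    have hFM : κ.symm (σ.dehom (idx k) hF) ∈ M.comap κ := by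
      rw [hFe]
      exact add_mem (Ideal.mul_mem_right _ _ (hv 0)) (Ideal.mul_mem_right _ _ (hv 1))
    exact Frame.tmul_D_ne_zero hS hF0 hsm σ (idx k) hFM
      (hFe ▸ tmul_D_eq_zero (hv 0) (hv 2) (hv 1) (hv 3))
  have h0 : ∀ {f : MvPolynomial (Fin 4) ℂ} (hf : f ∈ coordGrading 3 1), σ.toLine f = 0 →
      (σ.line.appLE _ (chart k).1 (σ.line_preimage k).ge).hom (σ.dehom (idx k) hf) = 0 := by
    intro f hf h
    exact (congrArg (rs (σ.line_preimage k).ge) ((σ.line_app_eq_zero_iff (k := k) hf).mpr h)).trans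
      (map_zero _)
  exact span_pair_eq_top_of_map _ htop (h0 (σ.coord_mem 2) σ.toLine_coord_two)
    (h0 (σ.coord_mem 3) σ.toLine_coord_three) (line_appLE_chart hA) (line_appLE_chart hB)

/-- There are adapted charts along a line in a smooth surface. -/
theorem exists_isAdapted (hS : IsZeroScheme S (fun _ : Fin 1 => F) (fun _ => hF))
    (hF0 : F ≠ 0) (hsm : SmoothOfRelativeDimension e (subschemeToSpec S)) (hSC : S ≤ C)
    (hC : SmoothOfRelativeDimension 1 (subschemeToSpec C)) (hFL : σ.toLine F = 0)
    {m : ℕ} {s : MvPolynomial (Fin 2) ℂ} {hs : s ∈ coordGrading 1 m} (hs0 : s ≠ 0)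
    (hCL : IsZeroScheme (C.comap σ.line) (fun _ : Fin 1 => s) (fun _ => hs))
    {k : Fin 2} {x : PSpace 1} (hx : x ∈ (chart k).1) :
    ∃ g a : Γ(PSpace 3, (σ.U (idx k)).1), σ.line x ∈ (PSpace 3).basicOpen a ∧
      IsAdapted C σ.line (σ.U (idx k)) (σ.dehom (idx k) hF) g a := by
  have hFC : σ.dehom (idx k) hF ∈ C.ideal (σ.U (idx k)) := by
    refine hSC (σ.U (idx k)) ?_
    rw [hS.ideal_eq σ, Set.range_const]
    exact Ideal.mem_span_singleton_self _
  have hF' := (σ.line_app_eq_zero_iff (k := k) hF).mpr hFL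
  have hy : σ.line x ∈ (σ.U (idx k)).1 := by
    have : x ∈ σ.line ⁻¹ᵁ (σ.U (idx k)).1 := by rw [σ.line_preimage]; exact hx
    exact this
  have hxU : Nonempty (σ.line ⁻¹ᵁ (σ.U (idx k)).1) := ⟨⟨x, hy⟩⟩
  by_cases hyC : σ.line x ∈ C.support
  · let κ := σ.chartEquiv (idx k)
    let γ := ((PSpace 3).presheaf.germ _ _ hy).hom
    let p : Ideal (MvPolynomial (Fin 3) ℂ) :=
      (IsLocalRing.maximalIdeal ((PSpace 3).presheaf.stalk (σ.line x))).comap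
        (γ.comp κ.toRingHom)
    have : p.IsPrime := Ideal.IsPrime.comap _
    have hp : ∀ q, q ∈ p ↔ σ.line x ∉ (PSpace 3).basicOpen (κ q) := by
      intro q
      rw [Scheme.mem_basicOpen _ _ _ hy]
      exact IsLocalRing.mem_maximalIdeal _
    have hJp : σ.chartIdeal (idx k) C ≤ p := by
      intro q hq
      rw [hp]
      rw [Scheme.IdealSheafData.mem_support_iff_of_mem hy, Scheme.mem_zeroLocus_iff] at hyC
      exact hyC _ hq
    have hFJ : κ.symm (σ.dehom (idx k) hF) ∈ σ.chartIdeal (idx k) C := by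
      rw [Ideal.mem_comap]
      exact (κ.apply_symm_apply _).symm ▸ hFC
    have hsmC := formallySmooth_quotient hC σ (idx k)
    have hst := algebraMap_quotient_chartIdeal (P := @SmoothOfRelativeDimension 1)
      (Q := RingHom.Locally (RingHom.IsStandardSmoothOfRelativeDimension 1)) hC σ (idx k)
    -- δ is a tangent vector of the curve C at the point.
    obtain ⟨δ, hδ, hδJ⟩ := exists_linearMap_residueField_ne_zero hJp one_pos hst
    have : Module.Finite (MvPolynomial (Fin 3) ℂ) Ω[MvPolynomial (Fin 3) ℂ⁄ℂ] :=
      Module.Finite.of_basis (mvPolynomialBasis ℂ (Fin 3))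
    have hrank : Module.finrank (MvPolynomial (Fin 3) ℂ) Ω[MvPolynomial (Fin 3) ℂ⁄ℂ] = 3 := by
      rw [Module.finrank_eq_card_basis (mvPolynomialBasis ℂ (Fin 3)), Fintype.card_fin]
    obtain ⟨g, hg, a, ha, hga⟩ := exists_generator_of_smooth (k := ℂ) hrank hJp hFJ
      (Frame.tmul_D_ne_zero hS hF0 hsm σ (idx k) (hJp hFJ)) δ hδ
      hδJ
    have hya : σ.line x ∈ (PSpace 3).basicOpen (κ a) := by
      rw [hp, not_not] at ha; exact ha
    have hgen : ∀ c ∈ C.ideal (σ.U (idx k)), κ a * c ∈ Ideal.span {σ.dehom (idx k) hF, κ g} := by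
      intro c hc
      have h1 := hga (κ.symm c) (by
        rw [Ideal.mem_comap]
        exact (κ.apply_symm_apply c).symm ▸ hc)
      have h2 := Ideal.mem_map_of_mem κ h1
      rwa [Ideal.map_span, Set.image_pair, map_mul, κ.apply_symm_apply, κ.apply_symm_apply] at h2
    refine ⟨κ g, κ a, hya, ⟨⟨Ideal.mul_mem_left _ _ hFC, Ideal.mul_mem_left _ _ hg, hgen⟩, hF', ?_⟩⟩
    -- If g vanished on the line, so would the whole ideal of C, because a does not; but this ideal
    -- restricts to (s), and s ≠ 0.
    intro hg0
    have ha0 : σ.line.app _ (κ a) ≠ 0 := by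
      intro h0
      have h1 : x ∈ σ.line ⁻¹ᵁ (PSpace 3).basicOpen (κ a) := hya
      rw [Scheme.preimage_basicOpen, h0, Scheme.basicOpen_zero] at h1
      exact h1
    have hzero : ∀ c ∈ C.ideal (σ.U (idx k)), σ.line.app _ c = 0 := by
      intro c hc
      obtain ⟨α, β, h⟩ := Ideal.mem_span_pair.mp (hgen c hc)
      have h1 := congrArg (σ.line.app (σ.U (idx k)).1) h
      rw [map_add, map_mul, map_mul, hF', hg0, mul_zero, mul_zero, add_zero, map_mul] at h1
      exact (mul_eq_zero.mp h1.symm).resolve_left ha0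
    have h1 : dehomogenize k s hs ∈ (C.comap σ.line).ideal (chart k) := by
      rw [hCL k]
      exact Ideal.subset_span ⟨0, rfl⟩
    rw [ideal_comap C σ.line (σ.U (idx k)) (chart k) (σ.line_preimage k).ge] at h1
    have h2 : (C.ideal (σ.U (idx k))).map
        (σ.line.appLE _ (chart k).1 (σ.line_preimage k).ge).hom ≤ ⊥ := by
      rw [Ideal.map_le_iff_le_comap]
      intro c hc
      rw [Ideal.mem_comap]
      exact (congrArg (rs (σ.line_preimage k).ge) (hzero c hc)).trans (map_zero _)
    exact dehomogenize_ne_zero k hs hs0 (h2 h1)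
  -- At a point outside C some a in the ideal of C is invertible. Where a is invertible the ideal is
  -- the unit ideal, and g = 1 serves.
  · rw [Scheme.IdealSheafData.mem_support_iff_of_mem hy, Scheme.mem_zeroLocus_iff] at hyC
    push Not at hyC
    obtain ⟨a, haC, hya⟩ := hyC
    refine ⟨1, a, hya, ⟨⟨Ideal.mul_mem_left _ _ hFC, by rwa [mul_one], fun c _ => ?_⟩, hF', ?_⟩⟩
    · have : Ideal.span {σ.dehom (idx k) hF, 1} = ⊤ :=
        Ideal.eq_top_of_isUnit_mem _ (Ideal.subset_span (by simp)) isUnit_one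
      rw [this]
      trivial
    · rw [map_one]
      exact one_ne_zero

end Frame

end SecantGeometry

/-! ### Sections of the twisting sheaves on a chart -/

section TwistCharts

variable {R A : Type u} [CommRing R] [CommRing A] [Algebra R A]
variable {𝒜 : ℕ → Submodule R A} [GradedAlgebra 𝒜]

/-- A fraction of degree 0 already lies in the degree zero part of the localization, so 𝒪(0) is the
structure sheaf. -/
lemma exists_valueAt_eq {O : (Proj 𝒜).Opens} {f : ∀ x : O, LocAt 𝒜 (pt x.1)}
    (hf : IsLocallyFractionOfDegree 𝒜 0 O f) : ∃ s : Γ(Proj 𝒜, O), ∀ x, valueAt 𝒜 O x s = f x := by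
  have h1 : ∀ x : O, ∃ z : HomogeneousLocalization.AtPrime 𝒜 (pt x.1).asHomogeneousIdeal.toIdeal,
      z.val = f x := by
    intro x
    obtain ⟨V, hxV, hV, p, q, hpq, a, b, ha, hb, hbV, hab⟩ := hf x
    obtain rfl : p = q := by omega
    let D : HomogeneousLocalization.NumDenSameDeg 𝒜
        (pt x.1).asHomogeneousIdeal.toIdeal.primeCompl := ⟨p, ⟨a, ha⟩, ⟨b, hb⟩, hbV ⟨x.1, hxV⟩⟩
    exact ⟨.mk D, (HomogeneousLocalization.val_mk D).trans (hab ⟨x.1, hxV⟩).symm⟩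
  choose z hz using h1
  refine ⟨⟨z, fun x => ?_⟩, hz⟩
  obtain ⟨V, hxV, hV, p, q, hpq, a, b, ha, hb, hbV, hab⟩ := hf x
  obtain rfl : p = q := by omega
  refine ⟨V, hxV, homOfLE hV, p, ⟨a, ha⟩, ⟨b, hb⟩, fun y => hbV y, fun y => ?_⟩
  apply HomogeneousLocalization.val_injective
  let D : HomogeneousLocalization.NumDenSameDeg 𝒜
      (pt y.1).asHomogeneousIdeal.toIdeal.primeCompl := ⟨p, ⟨a, ha⟩, ⟨b, hb⟩, hbV y⟩
  exact (hz _).trans ((hab y).trans (HomogeneousLocalization.val_mk D).symm)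

variable {y : A} (hy : y ∈ 𝒜 1) {O : (Proj 𝒜).Opens} (hO : O ≤ Proj.basicOpen 𝒜 y) {d : ℤ} {n : ℕ}
  (hd : d = -(n : ℤ))

include hy hO hd

/-- On `D₊(y)`, the sections of `𝒪(-n)` are the functions divided by `yⁿ`. -/
lemma exists_twistSection (s : Γ(Proj 𝒜, O)) : ∃ t : twistSections 𝒜 d O,
    ∀ x, t.1 x * algebraMap A (LocAt 𝒜 (pt x.1)) y ^ n = valueAt 𝒜 O x s := by
  have hyx : ∀ x : O, y ^ n ∈ (pt x.1).asHomogeneousIdeal.toIdeal.primeCompl := fun x =>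
    pow_mem (show y ∈ (pt x.1).asHomogeneousIdeal.toIdeal.primeCompl from hO x.2) n
  have h1 : IsLocallyFractionOfDegree 𝒜 d O
      (fun x => Localization.mk (1 : A) ⟨y ^ n, hyx x⟩) := fun x =>
    ⟨O, x.2, le_rfl, 0, n, by simp [hd], 1, y ^ n, SetLike.GradedOne.one_mem, by
      simpa using SetLike.pow_mem_graded n hy, hyx, fun x => rfl⟩
  have h2 := (valueAt_isLocallyFraction 𝒜 O s).mul h1
  rw [zero_add] at h2
  refine ⟨⟨fun x => valueAt 𝒜 O x s * Localization.mk 1 ⟨y ^ n, hyx x⟩, h2⟩, fun x => ?_⟩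
  have h3 : Localization.mk (1 : A) ⟨y ^ n, hyx x⟩ * algebraMap A (LocAt 𝒜 (pt x.1)) y ^ n = 1 := by
    rw [← map_pow, ← Localization.mk_one_eq_algebraMap, Localization.mk_mul, ← Localization.mk_one,
      Localization.mk_eq_mk_iff, Localization.r_iff_exists]
    exact ⟨1, by simp⟩
  dsimp only
  rw [mul_assoc, h3, mul_one]

omit hO in
lemma exists_valueAt_eq_mul (t : twistSections 𝒜 d O) : ∃ s : Γ(Proj 𝒜, O),
    ∀ x, t.1 x * algebraMap A (LocAt 𝒜 (pt x.1)) y ^ n = valueAt 𝒜 O x s := by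
  have hone : ∀ x : O, (1 : A) ∈ (pt x.1).asHomogeneousIdeal.toIdeal.primeCompl :=
    fun x => one_mem _
  have h1 : IsLocallyFractionOfDegree 𝒜 n O
      (fun x => Localization.mk (y ^ n) ⟨1, hone x⟩) := fun x =>
    ⟨O, x.2, le_rfl, n, 0, by simp, y ^ n, 1, by
      simpa using SetLike.pow_mem_graded n hy, SetLike.GradedOne.one_mem, hone, fun x => rfl⟩
  have h2 := IsLocallyFractionOfDegree.mul t.2 h1
  have e : d + n = 0 := by omega
  rw [e] at h2
  obtain ⟨s, hs⟩ := exists_valueAt_eq h2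
  refine ⟨s, fun x => ?_⟩
  rw [hs, ← map_pow, ← Localization.mk_one_eq_algebraMap]
  rfl

omit hy hd in
lemma eq_of_mul_pow_eq {t t' : twistSections 𝒜 d O}
    (h : ∀ x, t.1 x * algebraMap A (LocAt 𝒜 (pt x.1)) y ^ n =
      t'.1 x * algebraMap A (LocAt 𝒜 (pt x.1)) y ^ n) : t = t' :=
  Subtype.ext (funext fun x => ((isUnit_algebraMap_locAt (hO x.2)).pow n).mul_right_cancel (h x))

end TwistCharts

/-! ### Sections of a direct sum -/

section Biprod

variable {X : Scheme.{u}} (M N : X.Modules)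

lemma biprod_section_ext {U : X.Opens} {s t : Γ(M ⊞ N, U)}
    (h₁ : (biprod.fst : M ⊞ N ⟶ M).app U s = (biprod.fst : M ⊞ N ⟶ M).app U t)
    (h₂ : (biprod.snd : M ⊞ N ⟶ N).app U s = (biprod.snd : M ⊞ N ⟶ N).app U t) : s = t := by
  have h : ∀ s : Γ(M ⊞ N, U), s = (biprod.inl : M ⟶ M ⊞ N).app U ((biprod.fst : M ⊞ N ⟶ M).app U s) +
      (biprod.inr : N ⟶ M ⊞ N).app U ((biprod.snd : M ⊞ N ⟶ N).app U s) := fun s =>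
    (congrArg (fun f : M ⊞ N ⟶ M ⊞ N => f.app U s) (biprod.total (X := M) (Y := N))).symm
  rw [h s, h t, h₁, h₂]

lemma exists_biprod_section {U : X.Opens} (s : Γ(M, U)) (t : Γ(N, U)) : ∃ r : Γ(M ⊞ N, U),
    (biprod.fst : M ⊞ N ⟶ M).app U r = s ∧ (biprod.snd : M ⊞ N ⟶ N).app U r = t := by
  refine ⟨(biprod.inl : M ⟶ M ⊞ N).app U s + (biprod.inr : N ⟶ M ⊞ N).app U t, ?_, ?_⟩
  · rw [map_add]
    have h1 := congrArg (fun f : M ⟶ M => f.app U s) (biprod.inl_fst (X := M) (Y := N))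
    have h2 := congrArg (fun f : N ⟶ M => f.app U t) (biprod.inr_fst (X := M) (Y := N))
    exact (congrArg₂ (· + ·) h1 h2).trans (add_zero s)
  · rw [map_add]
    have h1 := congrArg (fun f : M ⟶ N => f.app U s) (biprod.inl_snd (X := M) (Y := N))
    have h2 := congrArg (fun f : N ⟶ N => f.app U t) (biprod.inr_snd (X := M) (Y := N))
    exact (congrArg₂ (· + ·) h1 h2).trans (zero_add t)

end Biprod

/-! ### The graph of the isomorphism on a chart of the projective line -/

section TwistGraph

lemma ne_zero_of_mul_add_mul_eq_one {R S : Type*} [CommRing R] [CommRing S] [Nontrivial S]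
    (f : R →+* S) {a b α β : R} (h : α * a + β * b = 1) (ha : f a = 0) : f b ≠ 0 := by
  intro hb
  have h1 := congrArg f h
  rw [map_add, map_mul, map_mul, map_one, ha, hb, mul_zero, mul_zero, add_zero] at h1
  exact zero_ne_one h1

-- A nonzero vector c is a point of the chart of any k with cₖ ≠ 0. Evaluating there an expression
-- of 1 through the two dehomogenized forms excludes a common zero.
open MvPolynomial in
lemma eval_ne_zero_of_span_eq_top {d e : ℕ} {a b : MvPolynomial (Fin 2) ℂ}
    (ha : a ∈ coordGrading 1 d) (hb : b ∈ coordGrading 1 e)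
    (h : ∀ k, Ideal.span {dehomogenize k a ha, dehomogenize k b hb} = ⊤) {c : Fin 2 → ℂ}
    (hc : c ≠ 0) (hca : eval c a = 0) : eval c b ≠ 0 := by
  intro hcb
  obtain ⟨k, hk⟩ := Function.ne_iff.mp hc
  let κ := (Frame.std 1).chartEquiv k
  let ev : MvPolynomial (Fin 1) ℂ →+* ℂ := eval fun i => c (k.succAbove i) / c k
  have hev : ∀ {d : ℕ} {f : MvPolynomial (Fin 2) ℂ} (hf : f ∈ coordGrading 1 d), eval c f = 0 →
      ev (κ.symm (dehomogenize k f hf)) = 0 := by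
    intro d f hf h0
    have h1 : κ.symm (dehomogenize k f hf) = Frame.subst k f :=
      (congrArg κ.symm ((Frame.std 1).chartEquiv_subst k hf).symm).trans
        (κ.symm_apply_apply _)
    rw [h1]
    have h2 : ev.comp (Frame.subst k : MvPolynomial (Fin 2) ℂ →+* _) =
        eval₂Hom (RingHom.id ℂ) fun i => c i / c k := by
      refine ringHom_ext (fun r => by simp [ev, Frame.subst]) fun i => ?_
      induction i using Fin.succAboveCases k with
      | x => simp [ev, Frame.subst, div_self hk]
      | p i => simp [ev, Frame.subst]
    have h3 := RingHom.congr_fun h2 f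
    have h4 := aeval_mul_pow (e := RingHom.id ℂ) (g := c) (h := fun i => c i / c k) (u := c k)
      (fun i => div_mul_cancel₀ _ hk) hf
    have h5 : ev (Frame.subst k f) * c k ^ d = 0 := by
      refine Eq.trans (congrArg (· * c k ^ d) h3) (h4.trans ?_)
      exact h0
    exact (mul_eq_zero.mp h5).resolve_right (pow_ne_zero _ hk)
  obtain ⟨α, β, hαβ⟩ := Ideal.mem_span_pair.mp ((h k).ge (Submodule.mem_top (x := 1)))
  exact ne_zero_of_mul_add_mul_eq_one (ev.comp κ.symm.toRingHom) hαβ (hev ha hca) (hev hb hcb)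

/-- The relation between a pair of functions on a chart of the projective line and a pair of
sections of twisting sheaves, given by the matrix with entries `b`, `p`, `-a`, `q`. -/
def IsTwistRel (a b p q : MvPolynomial (Fin 2) ℂ) (k : Fin 2) {O : (PSpace 1).Opens}
    (u v : Γ(PSpace 1, O)) (t w : ∀ x : O, LocAt (coordGrading 1) (pt x.1)) : Prop :=
  ∀ x : O, valueAt (coordGrading 1) O x u * algebraMap (MvPolynomial (Fin 2) ℂ) (LocAt (coordGrading 1) (pt x.1)) (MvPolynomial.X k) =
      algebraMap (MvPolynomial (Fin 2) ℂ) _ b * t x + algebraMap (MvPolynomial (Fin 2) ℂ) _ p * w x ∧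
    valueAt (coordGrading 1) O x v * algebraMap (MvPolynomial (Fin 2) ℂ) (LocAt (coordGrading 1) (pt x.1)) (MvPolynomial.X k) =
      -(algebraMap (MvPolynomial (Fin 2) ℂ) _ a * t x) + algebraMap (MvPolynomial (Fin 2) ℂ) _ q * w x

variable {a b p q s : MvPolynomial (Fin 2) ℂ} {n : ℕ} (ha : a ∈ coordGrading 1 2)
  (hb : b ∈ coordGrading 1 2) (hp : p ∈ coordGrading 1 (n + 1)) (hq : q ∈ coordGrading 1 (n + 1))
  (hs : s ∈ coordGrading 1 (n + 3)) (hspq : s = a * p + b * q) {k : Fin 2} {O : (PSpace 1).Opens}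
  (hO : O ≤ (chart k).1)

/-- Trivializing the twisting sheaves by powers of xₖ turns the relation into a matrix identity
between functions. The degrees match: both sides have degree 1 = 2 − 1 = (n + 1) − n. -/
lemma isTwistRel_iff {u v t' w' : Γ(PSpace 1, O)}
    {t w : ∀ x : O, LocAt (coordGrading 1) (pt x.1)}
    (ht : ∀ x, t x * algebraMap (MvPolynomial (Fin 2) ℂ) (LocAt (coordGrading 1) (pt x.1)) (MvPolynomial.X k) ^ 1 =
      valueAt (coordGrading 1) O x t')
    (hw : ∀ x, w x * algebraMap (MvPolynomial (Fin 2) ℂ) (LocAt (coordGrading 1) (pt x.1)) (MvPolynomial.X k) ^ n =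
      valueAt (coordGrading 1) O x w') :
    IsTwistRel a b p q k u v t w ↔
      u = rs hO (dehomogenize k b hb) * t' + rs hO (dehomogenize k p hp) * w' ∧
      v = -(rs hO (dehomogenize k a ha) * t') + rs hO (dehomogenize k q hq) * w' := by
  have e : ∀ {d : ℕ} {f : MvPolynomial (Fin 2) ℂ} (hf : f ∈ coordGrading 1 d) (x : O),
      valueAt (coordGrading 1) O x (rs hO (dehomogenize k f hf)) *
        algebraMap (MvPolynomial (Fin 2) ℂ) (LocAt (coordGrading 1) (pt x.1)) (MvPolynomial.X k) ^ d = algebraMap (MvPolynomial (Fin 2) ℂ) _ f :=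
    fun hf x => valueAt_frac_mul (X_mem_coordGrading k) hf ⟨x.1, hO x.2⟩
  have hu : ∀ x : O, IsUnit (algebraMap (MvPolynomial (Fin 2) ℂ) (LocAt (coordGrading 1) (pt x.1)) (MvPolynomial.X k)) :=
    fun x => isUnit_algebraMap_locAt (hO x.2)
  have key : ∀ x : O,
      valueAt (coordGrading 1) O x (rs hO (dehomogenize k b hb) * t' + rs hO (dehomogenize k p hp) * w') *
        algebraMap (MvPolynomial (Fin 2) ℂ) (LocAt (coordGrading 1) (pt x.1)) (MvPolynomial.X k) =
        algebraMap (MvPolynomial (Fin 2) ℂ) _ b * t x + algebraMap (MvPolynomial (Fin 2) ℂ) _ p * w x ∧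
      valueAt (coordGrading 1) O x (-(rs hO (dehomogenize k a ha) * t') + rs hO (dehomogenize k q hq) * w') *
        algebraMap (MvPolynomial (Fin 2) ℂ) (LocAt (coordGrading 1) (pt x.1)) (MvPolynomial.X k) =
        -(algebraMap (MvPolynomial (Fin 2) ℂ) _ a * t x) + algebraMap (MvPolynomial (Fin 2) ℂ) _ q * w x := by
    intro x
    rw [← e ha x, ← e hb x, ← e hp x, ← e hq x]
    simp only [map_add, map_mul, map_neg, ← ht x, ← hw x]
    constructor <;> ring
  constructor
  · intro h
    constructor
    · exact valueAt_injective _ fun x => (hu x).mul_right_cancel ((h x).1.trans (key x).1.symm)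
    · exact valueAt_injective _ fun x => (hu x).mul_right_cancel ((h x).2.trans (key x).2.symm)
  · rintro ⟨rfl, rfl⟩ x
    exact key x

include hspq in
lemma rs_dehomogenize_eq : rs hO (dehomogenize k s hs) =
    rs hO (dehomogenize k a ha) * rs hO (dehomogenize k p hp) +
      rs hO (dehomogenize k b hb) * rs hO (dehomogenize k q hq) := by
  rw [← map_mul, ← map_mul, ← map_add]
  congr 1
  refine eq_of_valueAt_mul_pow (U := (chart k).1) (y := MvPolynomial.X k) le_rfl (n + 3) fun x => ?_
  have e : ∀ {d : ℕ} {f : MvPolynomial (Fin 2) ℂ} (hf : f ∈ coordGrading 1 d),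
      valueAt (coordGrading 1) (chart k).1 x (dehomogenize k f hf) *
        algebraMap (MvPolynomial (Fin 2) ℂ) (LocAt (coordGrading 1) (pt x.1)) (MvPolynomial.X k) ^ d = algebraMap (MvPolynomial (Fin 2) ℂ) _ f :=
    fun hf => valueAt_frac_mul (X_mem_coordGrading k) hf x
  rw [e hs, hspq, map_add, map_mul, map_mul, ← e ha, ← e hb, ← e hp, ← e hq, map_add, map_mul,
    map_mul]
  ring

variable {d : ℤ} (hd : d = -(n : ℤ))
  (hab : Ideal.span {dehomogenize k a ha, dehomogenize k b hb} = ⊤) (hs0 : s ≠ 0)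

include ha hb hp hq hd hO in
lemma exists_isTwistRel (t : twistSections (coordGrading 1) (-1) O)
    (w : twistSections (coordGrading 1) d O) :
    ∃ u v : Γ(PSpace 1, O), IsTwistRel a b p q k u v t.1 w.1 := by
  obtain ⟨t', ht⟩ := exists_valueAt_eq_mul (X_mem_coordGrading k) (n := 1) (by simp) t
  obtain ⟨w', hw⟩ := exists_valueAt_eq_mul (X_mem_coordGrading k) hd w
  exact ⟨_, _, (isTwistRel_iff ha hb hp hq hO ht hw).mpr ⟨rfl, rfl⟩⟩

include hO in
lemma IsTwistRel.eq {u v u' v' : Γ(PSpace 1, O)} {t w : ∀ x : O, LocAt (coordGrading 1) (pt x.1)}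
    (h : IsTwistRel a b p q k u v t w) (h' : IsTwistRel a b p q k u' v' t w) : u = u' ∧ v = v' :=
  ⟨valueAt_injective _ fun x => (isUnit_algebraMap_locAt (hO x.2)).mul_right_cancel
      ((h x).1.trans (h' x).1.symm),
    valueAt_injective _ fun x => (isUnit_algebraMap_locAt (hO x.2)).mul_right_cancel
      ((h x).2.trans (h' x).2.symm)⟩

-- Multiplying the two rows by a and b and adding cancels t and leaves (ap + bq)w = sw.
include hp hq hspq hd in
lemma IsTwistRel.exists_eq {u v : Γ(PSpace 1, O)} {t : twistSections (coordGrading 1) (-1) O}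
    {w : twistSections (coordGrading 1) d O} (h : IsTwistRel a b p q k u v t.1 w.1) :
    ∃ w', rs hO (dehomogenize k a ha) * u + rs hO (dehomogenize k b hb) * v =
      rs hO (dehomogenize k s hs) * w' := by
  obtain ⟨t', ht⟩ := exists_valueAt_eq_mul (X_mem_coordGrading k) (n := 1) (by simp) t
  obtain ⟨w', hw⟩ := exists_valueAt_eq_mul (X_mem_coordGrading k) hd w
  obtain ⟨rfl, rfl⟩ := (isTwistRel_iff ha hb hp hq hO ht hw).mp h
  refine ⟨w', ?_⟩
  rw [rs_dehomogenize_eq ha hb hp hq hs hspq hO]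
  ring

-- Since au + bv = sw and s is not zero, w must be w₀. Then (u − pw₀, v − qw₀) is annihilated by (a,
-- b), and αa + βb = 1 shows that it is (b, −a) times t = β(u − pw₀) − α(v − qw₀), with no other
-- choice for t.
include hp hq hspq hd hab hs0 in
lemma existsUnique_isTwistRel {u v w₀ : Γ(PSpace 1, O)}
    (h : rs hO (dehomogenize k a ha) * u + rs hO (dehomogenize k b hb) * v =
      rs hO (dehomogenize k s hs) * w₀) :
    ∃ (t : twistSections (coordGrading 1) (-1) O) (w : twistSections (coordGrading 1) d O),
      IsTwistRel a b p q k u v t.1 w.1 ∧ ∀ (t₁ : twistSections (coordGrading 1) (-1) O)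
        (w₁ : twistSections (coordGrading 1) d O), IsTwistRel a b p q k u v t₁.1 w₁.1 →
          t₁ = t ∧ w₁ = w := by
  have es := rs_dehomogenize_eq ha hb hp hq hs hspq hO
  obtain ⟨α, β, hαβ⟩ := Ideal.mem_span_pair.mp (hab.ge (Submodule.mem_top (x := 1)))
  have hαβ' := congrArg (rs hO) hαβ
  rw [map_add, map_mul, map_mul, map_one] at hαβ'
  have hcancel : ∀ w w' : Γ(PSpace 1, O), rs hO (dehomogenize k s hs) * w =
      rs hO (dehomogenize k s hs) * w' → w = w' := by
    intro w w' h
    rcases (O : Set (PSpace 1)).eq_empty_or_nonempty with hemp | hne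
    · have hbot : O = ⊥ := by ext1; exact hemp
      have : Subsingleton Γ(PSpace 1, O) := by rw [hbot]; infer_instance
      exact Subsingleton.elim _ _
    · have : Nonempty O := hne.to_subtype
      refine mul_left_cancel₀ (fun h0 => ?_) h
      exact dehomogenize_ne_zero k hs hs0
        (map_injective_of_isIntegral (PSpace 1) (homOfLE hO) (h0.trans (map_zero (rs hO)).symm))
  obtain ⟨t, ht⟩ := exists_twistSection (X_mem_coordGrading k) hO (d := -1) (n := 1) (by simp)
    (rs hO β * (u - rs hO (dehomogenize k p hp) * w₀) -
      rs hO α * (v - rs hO (dehomogenize k q hq) * w₀))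
  obtain ⟨w, hw⟩ := exists_twistSection (X_mem_coordGrading k) hO hd w₀
  refine ⟨t, w, (isTwistRel_iff ha hb hp hq hO ht hw).mpr ⟨?_, ?_⟩, fun t₁ w₁ h₁ => ?_⟩
  · linear_combination rs hO α * h + (rs hO α * w₀) * es -
      (u - rs hO (dehomogenize k p hp) * w₀) * hαβ'
  · linear_combination rs hO β * h + (rs hO β * w₀) * es -
      (v - rs hO (dehomogenize k q hq) * w₀) * hαβ'
  · obtain ⟨t', ht'⟩ := exists_valueAt_eq_mul (X_mem_coordGrading k) (n := 1) (by simp) t₁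
    obtain ⟨w', hw'⟩ := exists_valueAt_eq_mul (X_mem_coordGrading k) hd w₁
    obtain ⟨hu, hv⟩ := (isTwistRel_iff ha hb hp hq hO ht' hw').mp h₁
    have hww : w' = w₀ := by
      apply hcancel
      rw [← h, es, hu, hv]
      ring
    subst hww
    have htt : t' = rs hO β * (u - rs hO (dehomogenize k p hp) * w') -
        rs hO α * (v - rs hO (dehomogenize k q hq) * w') := by
      rw [hu, hv]
      linear_combination (-t') * hαβ'
    exact ⟨eq_of_mul_pow_eq hO fun x => by rw [ht', ht, htt],
      eq_of_mul_pow_eq hO fun x => by rw [hw', hw]⟩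

end TwistGraph

/-! ### Normal sections of the strict transform, locally -/

section NormalValue

variable {X Z : Scheme.{u}}

/-- The value of a section of the normal sheaf at a local section of the ideal sheaf. -/
def normalValue (i : Z ⟶ X) {N : Z.Opens} (φ : NormalSections i N) {W : X.Opens}
    (h : N ≤ i ⁻¹ᵁ W) (η : Γ(idealModule i, W)) : Γ(Z, N) :=
  rs (le_inf le_rfl h) (normalEval i φ W η)

lemma normalEval_res_eq (i : Z ⟶ X) {N : Z.Opens} (φ : NormalSections i N) {W W' : X.Opens}
    (hW : W' ≤ W) (h : N ≤ i ⁻¹ᵁ W) (η : Γ(idealModule i, W)) :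
    normalEval i φ W' (res _ hW η) = rs inf_le_left (normalValue i φ h η) := by
  rw [normalEval_res, normalValue, rs_rs]

lemma rs_normalEval_res (i : Z ⟶ X) {N : Z.Opens} (φ : NormalSections i N) {W W' : X.Opens}
    (hW : W' ≤ W) (h : N ≤ i ⁻¹ᵁ W) (h' : N ≤ i ⁻¹ᵁ W') (η : Γ(idealModule i, W)) :
    rs (le_inf le_rfl h') (normalEval i φ W' (res _ hW η)) = normalValue i φ h η := by
  rw [normalEval_res_eq i φ hW h, rs_rs, rs_self]

end NormalValue

section NormalChart

variable {X Y Z P : Scheme.{u}} {C : Y.IdealSheafData} {π : X ⟶ Y} {i : Z ⟶ X} {U : Y.affineOpens}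
  {F g a y₁ y₂ a₁ a₂ : Γ(Y, U.1)}

/-- The description in a chart of the blowup, restated with y₁ and y₂ as sections of the ideal sheaf
over all of π⁻¹(U), so that the values no longer depend on the small chart V. -/
lemma exists_normalSections_chart [AlgebraicGeometry.IsIntegral Z] (hπ : IsBlowup C π)
    [IsDomain Γ(Y, U.1)] (hA : IsAdapted C (i ≫ π) U F g a) (hY : IsConormalFrame (i ≫ π) U y₁ y₂)
    (hF : F = y₁ * a₁ + y₂ * a₂) {η₁ η₂ : Γ(idealModule i, π ⁻¹ᵁ U.1)}
    (hη₁ : idealVal i _ η₁ = π.app U.1 y₁) (hη₂ : idealVal i _ η₂ = π.app U.1 y₂) {z : Z}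
    (hz : π (i z) ∈ Y.basicOpen a) :
    ∃ (V : Z.Opens) (hV : V ≤ (i ≫ π) ⁻¹ᵁ U.1), z ∈ V ∧ ∀ (N : Z.Opens) (hN : N ≤ V),
      IsUnit (((i ≫ π).appLE U.1 N (hN.trans hV)).hom a) ∧
      (∀ φ : NormalSections i N, ∃ w,
        ((i ≫ π).appLE U.1 N (hN.trans hV)).hom a₁ * normalValue i (W := π ⁻¹ᵁ U.1) φ (hN.trans hV) η₁ +
          ((i ≫ π).appLE U.1 N (hN.trans hV)).hom a₂ * normalValue i (W := π ⁻¹ᵁ U.1) φ (hN.trans hV) η₂ =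
        ((i ≫ π).appLE U.1 N (hN.trans hV)).hom g * w) ∧
      ∀ u₁ u₂ w : Γ(Z, N), ((i ≫ π).appLE U.1 N (hN.trans hV)).hom a₁ * u₁ +
          ((i ≫ π).appLE U.1 N (hN.trans hV)).hom a₂ * u₂ =
          ((i ≫ π).appLE U.1 N (hN.trans hV)).hom g * w →
        ∃! φ : NormalSections i N, normalValue i (W := π ⁻¹ᵁ U.1) φ (hN.trans hV) η₁ = u₁ ∧
          normalValue i (W := π ⁻¹ᵁ U.1) φ (hN.trans hV) η₂ = u₂ := by
  obtain ⟨V, hzV, hV⟩ := exists_inChart_of_mem_closure hπ.1 hA hz (subset_closure ⟨z, rfl⟩)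
  have hg0 : g ≠ 0 := fun h => hA.app_ne_zero (by rw [h, map_zero])
  have ha0 : a ≠ 0 := fun h => by
    rw [h, Scheme.basicOpen_zero] at hz; exact hz
  obtain ⟨B, _, _, ι, v, hB⟩ := exists_isBlowupAlgebra F g a hg0 ha0
  obtain ⟨h, hh⟩ := exists_blowupChart hπ hg0 hA.isGeneratedBy hB
  obtain ⟨ψ, hψ, hψo, -⟩ := hh V hV.le hV.ideal_eq hV.mem_nonZeroDivisors hV.isUnit
  obtain ⟨ν, hν⟩ := (exact_idealVal i V.1).2 (ψ v)
    ((ConcreteCategory.congr_hom (Scheme.Hom.appLE_eq_app (f := i) (U := V.1)) _).symm.trans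
      (appLE_eq_zero hA hB.mul_eq hV.le hψ le_rfl))
  have hη₁' : idealVal i V.1 (res _ hV.le η₁) = (π.appLE U.1 V.1 hV.le).hom y₁ :=
    (idealVal_res i hV.le η₁).trans (congrArg (rs hV.le) hη₁)
  have hη₂' : idealVal i V.1 (res _ hV.le η₂) = (π.appLE U.1 V.1 hV.le).hom y₂ :=
    (idealVal_res i hV.le η₂).trans (congrArg (rs hV.le) hη₂)
  refine ⟨i ⁻¹ᵁ V.1, i.preimage_mono hV.le, hzV, fun N hN => ⟨?_, fun φ => ?_, fun u₁ u₂ w huw => ?_⟩⟩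
  · rw [← appLE_appLE i π hV.le hN]
    exact hV.isUnit.map _
  · have h1 := normalEval_relation hB.mul_eq hV.le hψ hF hη₁' hη₂' hν φ
      (inf_le_left.trans (hN.trans (i.preimage_mono hV.le)))
    have h2 := congrArg (rs (le_inf le_rfl hN)) h1
    rw [map_add, map_mul, map_mul, map_mul, rs_appLE, rs_appLE, rs_appLE,
      rs_normalEval_res i φ hV.le (hN.trans (i.preimage_mono hV.le)) hN,
      rs_normalEval_res i φ hV.le (hN.trans (i.preimage_mono hV.le)) hN] at h2
    exact ⟨_, h2⟩
  · have h1 := existsUnique_normalSection_of_chart hA hB hV.le hψ hψo hY hF hη₁' hη₂' hν hN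
      (hN.trans (i.preimage_mono hV.le)) u₁ u₂ w huw
    have key : ∀ (φ : NormalSections i N) (η : Γ(idealModule i, π ⁻¹ᵁ U.1)) (u : Γ(Z, N)),
        normalEval i φ V.1 (res _ hV.le η) = rs inf_le_left u ↔
          normalValue i φ (hN.trans (i.preimage_mono hV.le)) η = u := by
      intro φ η u
      rw [normalEval_res_eq i φ hV.le (hN.trans (i.preimage_mono hV.le))]
      refine ⟨fun h => ?_, fun h => by rw [h]⟩
      have h3 := congrArg (rs (le_inf le_rfl hN)) h
      rwa [rs_rs, rs_rs, rs_self, rs_self] at h3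
    simpa only [key] using h1

lemma app_injective_of_iso (e : P ≅ Z) (N : Z.Opens) : Function.Injective (e.hom.app N) :=
  (ConcreteCategory.isIso_iff_bijective (e.hom.app N)).mp inferInstance |>.1

lemma IsAdapted.of_iso {f : Z ⟶ Y} (e : P ≅ Z) (h : IsAdapted C (e.hom ≫ f) U F g a) :
    IsAdapted C f U F g a where
  isGeneratedBy := h.isGeneratedBy
  app_eq_zero := app_injective_of_iso e _ (h.app_eq_zero.trans (map_zero _).symm)
  app_ne_zero h0 := h.app_ne_zero ((congrArg (e.hom.app _) h0).trans (map_zero _))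

lemma IsConormalFrame.of_iso {f : Z ⟶ Y} (e : P ≅ Z) (h : IsConormalFrame (e.hom ≫ f) U y₁ y₂) :
    IsConormalFrame f U y₁ y₂ where
  app₁ := app_injective_of_iso e _ (h.app₁.trans (map_zero _).symm)
  app₂ := app_injective_of_iso e _ (h.app₂.trans (map_zero _).symm)
  exists_eq r hr := h.exists_eq r ((congrArg (e.hom.app _) hr).trans (map_zero _))
  indep α β hαβ := by
    obtain ⟨h1, h2⟩ := h.indep α β hαβ
    exact ⟨app_injective_of_iso e _ (h1.trans (map_zero _).symm),
      app_injective_of_iso e _ (h2.trans (map_zero _).symm)⟩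

/-- On the locus where `a` is invertible, the ideal of `C` pulls back to the one generated by the
pullback of `g`. -/
lemma IsAdapted.exists_mul_eq {j : P ⟶ Y} (hA : IsAdapted C j U F g a) {D : P.Opens}
    (hD : D ≤ j ⁻¹ᵁ U.1) {s : Γ(P, D)}
    (hs : (C.ideal U).map (j.appLE U.1 D hD).hom = Ideal.span {s}) :
    ∃ γ δ : Γ(P, D), (j.appLE U.1 D hD).hom a * s = γ * (j.appLE U.1 D hD).hom g ∧
      (j.appLE U.1 D hD).hom a * (j.appLE U.1 D hD).hom g = δ * s := by
  have hF0 : (j.appLE U.1 D hD).hom F = 0 :=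
    (congrArg (rs hD) hA.app_eq_zero).trans (map_zero _)
  have h1 : ∀ r ∈ (C.ideal U).map (j.appLE U.1 D hD).hom,
      (j.appLE U.1 D hD).hom a * r ∈ Ideal.span {(j.appLE U.1 D hD).hom g} := by
    have h2 : (C.ideal U).map (j.appLE U.1 D hD).hom ≤
        Submodule.comap (LinearMap.mulLeft _ ((j.appLE U.1 D hD).hom a))
          (Ideal.span {(j.appLE U.1 D hD).hom g}) := by
      refine Ideal.span_le.mpr ?_
      rintro _ ⟨c, hc, rfl⟩
      obtain ⟨x, y, hxy⟩ := Ideal.mem_span_pair.mp (hA.isGeneratedBy.2.2 c hc)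
      change (j.appLE U.1 D hD).hom a * (j.appLE U.1 D hD).hom c ∈
        Ideal.span {(j.appLE U.1 D hD).hom g}
      rw [← map_mul, ← hxy, map_add, map_mul, map_mul, hF0, mul_zero, zero_add]
      exact Ideal.mul_mem_left _ _ (Ideal.mem_span_singleton_self _)
    exact fun r hr => h2 hr
  obtain ⟨γ, hγ⟩ := Ideal.mem_span_singleton'.mp (h1 s (hs.ge (Ideal.mem_span_singleton_self s)))
  have h3 := Ideal.mem_map_of_mem (j.appLE U.1 D hD).hom hA.isGeneratedBy.2.1
  rw [hs, map_mul] at h3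
  obtain ⟨δ, hδ⟩ := Ideal.mem_span_singleton'.mp h3
  exact ⟨γ, δ, hγ.symm, hδ.symm⟩

lemma app_appLE {j : P ⟶ Y} {f : Z ⟶ Y} {e : P ⟶ Z} (hj : e ≫ f = j) {U : Y.Opens} {D : P.Opens}
    (hD : D ≤ j ⁻¹ᵁ U) {N : Z.Opens} (hN : N ≤ f ⁻¹ᵁ U) (hND : e ⁻¹ᵁ N ≤ D) (r : Γ(Y, U)) :
    e.app N ((f.appLE U N hN).hom r) = rs hND ((j.appLE U D hD).hom r) := by
  subst hj
  rw [rs_appLE]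
  exact (ConcreteCategory.congr_hom (Scheme.Hom.appLE_eq_app (f := e) (U := N)) _).symm.trans
    (appLE_appLE e f hN le_rfl _ r)

/-- The sections of the normal sheaf near a point, as pairs of functions on `P`. -/
theorem exists_normalSections_chart_of_iso [AlgebraicGeometry.IsIntegral P] (hπ : IsBlowup C π)
    [IsDomain Γ(Y, U.1)] (e : P ≅ Z) {j : P ⟶ Y} (hj : e.hom ≫ i ≫ π = j)
    (hA : IsAdapted C j U F g a) (hY : IsConormalFrame j U y₁ y₂)
    (hF : F = y₁ * a₁ + y₂ * a₂) {η₁ η₂ : Γ(idealModule i, π ⁻¹ᵁ U.1)}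
    (hη₁ : idealVal i _ η₁ = π.app U.1 y₁) (hη₂ : idealVal i _ η₂ = π.app U.1 y₂)
    {D : P.Opens} (hD : D ≤ j ⁻¹ᵁ U.1) (hD' : j ⁻¹ᵁ U.1 ≤ D) {s : Γ(P, D)}
    (hs : (C.ideal U).map (j.appLE U.1 D hD).hom = Ideal.span {s}) {α₁ α₂ : Γ(P, D)}
    (hα₁ : (j.appLE U.1 D hD).hom a₁ = α₁) (hα₂ : (j.appLE U.1 D hD).hom a₂ = α₂)
    {x : P} (hx : j x ∈ Y.basicOpen a) :
    ∃ (V : Z.Opens) (hV : V ≤ (i ≫ π) ⁻¹ᵁ U.1), e.hom x ∈ V ∧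
      ∀ (N : Z.Opens) (hN : N ≤ V) (hND : e.hom ⁻¹ᵁ N ≤ D),
      (∀ φ : NormalSections i N, ∃ w,
        rs hND α₁ * e.hom.app N (normalValue i (W := π ⁻¹ᵁ U.1) φ (hN.trans hV) η₁) +
          rs hND α₂ * e.hom.app N (normalValue i (W := π ⁻¹ᵁ U.1) φ (hN.trans hV) η₂) = rs hND s * w) ∧
      ∀ u₁ u₂ w : Γ(P, e.hom ⁻¹ᵁ N), rs hND α₁ * u₁ + rs hND α₂ * u₂ = rs hND s * w →
        ∃! φ : NormalSections i N, e.hom.app N (normalValue i (W := π ⁻¹ᵁ U.1) φ (hN.trans hV) η₁) = u₁ ∧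
          e.hom.app N (normalValue i (W := π ⁻¹ᵁ U.1) φ (hN.trans hV) η₂) = u₂ := by
  have hZ : AlgebraicGeometry.IsIntegral Z := by
    have : Nonempty Z := ⟨e.hom (Classical.arbitrary P)⟩
    exact isIntegral_of_isOpenImmersion e.inv
  -- Where a is invertible, g and s divide each other, so divisibility by the auxiliary function g
  -- can be replaced by divisibility by s.
  obtain ⟨γ, δ, hγ, hδ⟩ := hA.exists_mul_eq hD hs
  have hz : π (i (e.hom x)) ∈ Y.basicOpen a := by
    rw [← hj] at hx; simpa using hx
  have hA' : IsAdapted C (i ≫ π) U F g a := by subst hj; exact hA.of_iso e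
  have hY' : IsConormalFrame (i ≫ π) U y₁ y₂ := by subst hj; exact hY.of_iso e
  obtain ⟨V, hV, hzV, h⟩ := exists_normalSections_chart hπ hA' hY' hF hη₁ hη₂ hz
  refine ⟨V, hV, hzV, fun N hN hND => ?_⟩
  obtain ⟨hu, h1, h2⟩ := h N hN
  have tr : ∀ r, e.hom.app N (((i ≫ π).appLE U.1 N (hN.trans hV)).hom r) =
      rs hND ((j.appLE U.1 D hD).hom r) := fun r => app_appLE hj hD (hN.trans hV) hND r
  have hu' := hu.map (e.hom.app N).hom
  rw [tr] at hu'
  obtain ⟨b, hb⟩ := hu'.exists_left_inv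
  have hγ' := congrArg (rs hND) hγ
  have hδ' := congrArg (rs hND) hδ
  rw [map_mul, map_mul] at hγ' hδ'
  constructor
  · intro φ
    obtain ⟨w, hw⟩ := h1 φ
    have hw' := congrArg (e.hom.app N) hw
    rw [map_add, map_mul, map_mul, map_mul, tr, tr, tr, hα₁, hα₂] at hw'
    refine ⟨b * rs hND δ * e.hom.app N w, hw'.trans ?_⟩
    linear_combination (-(rs hND ((j.appLE U.1 D hD).hom g)) * e.hom.app N w) * hb +
      (b * e.hom.app N w) * hδ'
  · intro u₁ u₂ w huw
    have hbij : ∀ u : Γ(P, e.hom ⁻¹ᵁ N), ∃ u', e.hom.app N u' = u :=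
      ((ConcreteCategory.isIso_iff_bijective (e.hom.app N)).mp inferInstance).2
    obtain ⟨u₁, rfl⟩ := hbij u₁
    obtain ⟨u₂, rfl⟩ := hbij u₂
    obtain ⟨w', hw'⟩ := hbij (b * rs hND γ * w)
    have h3 := h2 u₁ u₂ w' (by
      apply app_injective_of_iso e N
      rw [map_add, map_mul, map_mul, map_mul, tr, tr, tr, hα₁, hα₂, hw', huw]
      linear_combination (-(rs hND s) * w) * hb + (b * w) * hγ')
    simpa only [(app_injective_of_iso e N).eq_iff] using h3

end NormalChart

/-! ### The normal sheaf of the strict transform of a line -/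

section TwistRel

variable {a b p q : MvPolynomial (Fin 2) ℂ} {k : Fin 2} {O : (PSpace 1).Opens}
  {u v u' v' : Γ(PSpace 1, O)} {t w t' w' : ∀ x : O, LocAt (coordGrading 1) (pt x.1)}

lemma IsTwistRel.add (h : IsTwistRel a b p q k u v t w) (h' : IsTwistRel a b p q k u' v' t' w') :
    IsTwistRel a b p q k (u + u') (v + v') (fun x => t x + t' x) (fun x => w x + w' x) := by
  intro x
  rw [map_add, map_add]
  constructor
  · linear_combination (h x).1 + (h' x).1
  · linear_combination (h x).2 + (h' x).2

lemma IsTwistRel.smul (r : Γ(PSpace 1, O)) (h : IsTwistRel a b p q k u v t w) :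
    IsTwistRel a b p q k (r * u) (r * v) (fun x => valueAt (coordGrading 1) O x r * t x)
      (fun x => valueAt (coordGrading 1) O x r * w x) := by
  intro x
  rw [map_mul, map_mul]
  constructor
  · linear_combination valueAt (coordGrading 1) O x r * (h x).1
  · linear_combination valueAt (coordGrading 1) O x r * (h x).2

lemma IsTwistRel.restrict {O' : (PSpace 1).Opens} (hO : O' ≤ O)
    (h : IsTwistRel a b p q k u v t w) :
    IsTwistRel a b p q k (rs hO u) (rs hO v) (fun x => t ⟨x.1, hO x.2⟩)
      (fun x => w ⟨x.1, hO x.2⟩) := fun x => h ⟨x.1, hO x.2⟩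

end TwistRel

namespace Frame

variable (σ : Frame 3) {X Z : Scheme.{0}} {π : X ⟶ PSpace 3} (i : Z ⟶ X) (e : PSpace 1 ≅ Z)

lemma rs_dehom_eq {k k' : Fin 4} {c : MvPolynomial (Fin 4) ℂ} (hc : c ∈ coordGrading 3 1) :
    rs (inf_le_left : (σ.U k).1 ⊓ (σ.U k').1 ≤ _) (σ.dehom k hc) =
      rs inf_le_left (σ.dehom k (σ.coord_mem k')) * rs inf_le_right (σ.dehom k' hc) := by
  refine eq_of_valueAt_mul_pow (y := σ.coord k) inf_le_left 1 fun x => ?_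
  have e1 := valueAt_frac_mul (σ.coord_mem k) hc ⟨x.1, x.2.1⟩
  have e2 := valueAt_frac_mul (σ.coord_mem k') hc ⟨x.1, x.2.2⟩
  have e3 := valueAt_frac_mul (σ.coord_mem k) (σ.coord_mem k') ⟨x.1, x.2.1⟩
  refine Eq.trans ?_ (congrArg (· * _) (map_mul (valueAt (coordGrading 3) _ x) _ _).symm)
  rw [pow_one] at e2
  refine Eq.trans e1 (e2.symm.trans (Eq.trans ?_ (mul_right_comm _ _ _)))
  exact (mul_comm _ _).trans (congrArg (· * _) e3.symm)

variable {σ i e}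

/-- The values of a section of the normal sheaf at the equations of the line, in the two charts. -/
lemma valueAt_normalEval_mul (hj : e.hom ≫ i ≫ π = σ.line) {c : MvPolynomial (Fin 4) ℂ}
    (hc : c ∈ coordGrading 3 1) (η : ∀ k : Fin 2, Γ(idealModule i, π ⁻¹ᵁ (σ.U (idx k)).1))
    (hη : ∀ k, idealVal i _ (η k) = π.app _ (σ.dehom (idx k) hc)) {N : Z.Opens}
    (φ : NormalSections i N) {k k' : Fin 2} {x : PSpace 1}
    (hk : x ∈ e.hom ⁻¹ᵁ (N ⊓ i ⁻¹ᵁ π ⁻¹ᵁ (σ.U (idx k)).1))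
    (hk' : x ∈ e.hom ⁻¹ᵁ (N ⊓ i ⁻¹ᵁ π ⁻¹ᵁ (σ.U (idx k')).1)) :
    valueAt (coordGrading 1) _ ⟨x, hk⟩ (e.hom.app _ (normalEval i φ _ (η k))) *
        algebraMap (MvPolynomial (Fin 2) ℂ) (LocAt (coordGrading 1) (pt x)) (MvPolynomial.X k) =
      valueAt (coordGrading 1) _ ⟨x, hk'⟩ (e.hom.app _ (normalEval i φ _ (η k'))) *
        algebraMap (MvPolynomial (Fin 2) ℂ) (LocAt (coordGrading 1) (pt x)) (MvPolynomial.X k') := by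
  let D : (PSpace 3).Opens := (σ.U (idx k)).1 ⊓ (σ.U (idx k')).1
  have hD : π ⁻¹ᵁ D ≤ π ⁻¹ᵁ (σ.U (idx k)).1 := π.preimage_mono inf_le_left
  have hD' : π ⁻¹ᵁ D ≤ π ⁻¹ᵁ (σ.U (idx k')).1 := π.preimage_mono inf_le_right
  let r := σ.dehom (idx k) (σ.coord_mem (idx k'))
  -- The equations c/yₖ and c/yₖ' differ by the factor yₖ'/yₖ, so the values of φ at them, times the
  -- coordinate, agree: they form a section of 𝒪(1).
  have h1 : res _ hD (η k) = π.app D (rs inf_le_left r) • res _ hD' (η k') := by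
    apply (exact_idealVal i _).1
    rw [idealVal_smul]
    refine (idealVal_res i hD _).trans (Eq.trans ?_ (congrArg _ (idealVal_res i hD' _).symm))
    rw [hη, hη]
    refine (app_rs π (inf_le_left : D ≤ _) _).symm.trans ?_
    rw [σ.rs_dehom_eq hc, map_mul]
    exact congrArg _ (app_rs π (inf_le_right : D ≤ _) _)
  have h2 := congrArg (normalEval i φ _) h1
  rw [normalEval_smul, normalEval_res, normalEval_res] at h2
  let N' : Z.Opens := N ⊓ i ⁻¹ᵁ π ⁻¹ᵁ D
  have hx : x ∈ e.hom ⁻¹ᵁ N' := ⟨hk.1, hk.2, hk'.2⟩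
  have h3 := congrArg (fun s => valueAt (coordGrading 1) (e.hom ⁻¹ᵁ N') ⟨x, hx⟩ (e.hom.app N' s)) h2
  dsimp only at h3
  rw [map_mul, map_mul] at h3
  have h0 : ∀ {M : Z.Opens} (hM : N' ≤ M) (y : Γ(Z, M)),
      valueAt (coordGrading 1) (e.hom ⁻¹ᵁ N') ⟨x, hx⟩ (e.hom.app N' (rs hM y)) =
        valueAt (coordGrading 1) (e.hom ⁻¹ᵁ M) ⟨x, hM hx⟩ (e.hom.app M y) := fun hM y => by
    rw [app_rs]; rfl
  have hN' : N' ≤ (i ≫ π) ⁻¹ᵁ (σ.U (idx k)).1 := inf_le_right.trans (i.preimage_mono hD)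
  have hND : e.hom ⁻¹ᵁ N' ≤ (chart k).1 := by
    rw [← σ.line_preimage k, ← hj]
    exact e.hom.preimage_mono hN'
  have h4 : rs (inf_le_right : N' ≤ i ⁻¹ᵁ π ⁻¹ᵁ D) (i.app _ (π.app D (rs inf_le_left r))) =
      ((i ≫ π).appLE _ N' hN').hom r := by
    rw [app_rs, app_rs, rs_rs]
    rfl
  have h5 := valueAt_frac_mul (X_mem_coordGrading k) (σ.toLine_mem (σ.coord_mem (idx k'))) ⟨x, hND hx⟩
  rw [pow_one] at h5
  replace h5 := h5.trans (congrArg (algebraMap (MvPolynomial (Fin 2) ℂ) _) (σ.toLine_coord k'))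
  have h6 : valueAt (coordGrading 1) (e.hom ⁻¹ᵁ N') ⟨x, hx⟩ (e.hom.app N'
      (rs inf_le_right (i.app _ (π.app D (rs inf_le_left r))))) =
      valueAt (coordGrading 1) (chart k).1 ⟨x, hND hx⟩
        (dehomogenize k _ (σ.toLine_mem (σ.coord_mem (idx k')))) := by
    rw [h4, app_appLE hj (σ.line_preimage k).ge hN' hND, σ.line_appLE_chart]
    rfl
  refine (congrArg (· * _) ((h0 _ _).symm.trans (h3.trans (congrArg₂ (· * ·) h6 (h0 _ _))))).trans ?_
  refine Eq.trans ?_ (congrArg (_ * ·) h5)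
  exact (congrArg (· * _) (mul_comm _ _)).trans (mul_assoc _ _ _)

end Frame

namespace Frame

variable {σ : Frame 3} {X Z : Scheme.{0}} {π : X ⟶ PSpace 3} {i : Z ⟶ X} {e : PSpace 1 ≅ Z}

/-- The graph of the isomorphism between the normal sheaf and the sum of two twisting sheaves. -/
def NormalTwistRel (σ : Frame 3) {X Z : Scheme.{0}} {π : X ⟶ PSpace 3} (i : Z ⟶ X)
    (e : PSpace 1 ≅ Z) (a b p q : MvPolynomial (Fin 2) ℂ)
    (η₁ η₂ : ∀ k : Fin 2, Γ(idealModule i, π ⁻¹ᵁ (σ.U (idx k)).1)) (N : Z.Opens)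
    (φ : NormalSections i N) (t w : ∀ x : e.hom ⁻¹ᵁ N, LocAt (coordGrading 1) (pt x.1)) : Prop :=
  ∀ k : Fin 2, IsTwistRel a b p q k (O := e.hom ⁻¹ᵁ (N ⊓ i ⁻¹ᵁ π ⁻¹ᵁ (σ.U (idx k)).1))
    (e.hom.app _ (normalEval i φ _ (η₁ k))) (e.hom.app _ (normalEval i φ _ (η₂ k)))
    (fun x => t ⟨x.1, x.2.1⟩) (fun x => w ⟨x.1, x.2.1⟩)

variable {a b p q : MvPolynomial (Fin 2) ℂ}
  {η₁ η₂ : ∀ k : Fin 2, Γ(idealModule i, π ⁻¹ᵁ (σ.U (idx k)).1)} {N : Z.Opens}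
  {φ φ' : NormalSections i N} {t w t' w' : ∀ x : e.hom ⁻¹ᵁ N, LocAt (coordGrading 1) (pt x.1)}

lemma NormalTwistRel.add (h : σ.NormalTwistRel i e a b p q η₁ η₂ N φ t w)
    (h' : σ.NormalTwistRel i e a b p q η₁ η₂ N φ' t' w') :
    σ.NormalTwistRel i e a b p q η₁ η₂ N (φ + φ') (fun x => t x + t' x) (fun x => w x + w' x) := by
  intro k
  have h1 := (h k).add (h' k)
  rw [normalEval_add_left, normalEval_add_left, map_add, map_add]
  exact h1

lemma NormalTwistRel.smul (r : Γ(Z, N)) (h : σ.NormalTwistRel i e a b p q η₁ η₂ N φ t w) :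
    σ.NormalTwistRel i e a b p q η₁ η₂ N (r • φ)
      (fun x => valueAt (coordGrading 1) _ x (e.hom.app N r) * t x)
      (fun x => valueAt (coordGrading 1) _ x (e.hom.app N r) * w x) := by
  intro k
  have h1 := (h k).smul (rs (e.hom.preimage_mono inf_le_left) (e.hom.app N r))
  rw [normalEval_smul_left, normalEval_smul_left, map_mul, map_mul, app_rs]
  exact h1

lemma NormalTwistRel.restrict {N' : Z.Opens} (hN : N' ≤ N)
    (h : σ.NormalTwistRel i e a b p q η₁ η₂ N φ t w) :
    σ.NormalTwistRel i e a b p q η₁ η₂ N' (homRestrict _ _ hN φ)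
      (fun x => t ⟨x.1, hN x.2⟩) (fun x => w ⟨x.1, hN x.2⟩) := by
  intro k
  have h1 := (h k).restrict (e.hom.preimage_mono (inf_le_inf_right _ hN))
  rw [normalEval_restrict, normalEval_restrict, app_rs, app_rs]
  exact h1

lemma normalTwistRel_of_local (h : ∀ x ∈ N, ∃ (V : Z.Opens) (hV : V ≤ N), x ∈ V ∧
      σ.NormalTwistRel i e a b p q η₁ η₂ V (homRestrict _ _ hV φ)
        (fun x => t ⟨x.1, hV x.2⟩) (fun x => w ⟨x.1, hV x.2⟩)) :
    σ.NormalTwistRel i e a b p q η₁ η₂ N φ t w := by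
  intro k x
  obtain ⟨V, hV, hxV, h1⟩ := h (e.hom x.1) x.2.1
  have h2 := h1 k
  rw [normalEval_restrict, normalEval_restrict, app_rs, app_rs] at h2
  exact h2 ⟨x.1, hxV, x.2.2⟩

/-- By `valueAt_normalEval_mul` the relation in one chart implies it on the overlap with the other,
so over an open set inside the k-th chart the index k alone suffices. -/
lemma normalTwistRel_iff (hj : e.hom ≫ i ≫ π = σ.line)
    (hη₁ : ∀ k, idealVal i _ (η₁ k) = π.app _ (σ.dehom (idx k) (σ.coord_mem 2)))
    (hη₂ : ∀ k, idealVal i _ (η₂ k) = π.app _ (σ.dehom (idx k) (σ.coord_mem 3))) {k : Fin 2}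
    (hN : N ≤ i ⁻¹ᵁ π ⁻¹ᵁ (σ.U (idx k)).1) :
    σ.NormalTwistRel i e a b p q η₁ η₂ N φ t w ↔
      IsTwistRel a b p q k (O := e.hom ⁻¹ᵁ N) (e.hom.app N (normalValue i φ hN (η₁ k)))
        (e.hom.app N (normalValue i φ hN (η₂ k))) t w := by
  unfold normalValue
  rw [app_rs, app_rs]
  constructor
  · intro h x
    exact h k ⟨x.1, x.2, hN x.2⟩
  · intro h k' x
    have h1 := h ⟨x.1, x.2.1⟩
    rw [valueAt_normalEval_mul hj (σ.coord_mem 2) η₁ hη₁ φ x.2 (k' := k) ⟨x.2.1, hN x.2.1⟩,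
      valueAt_normalEval_mul hj (σ.coord_mem 3) η₂ hη₂ φ x.2 (k' := k) ⟨x.2.1, hN x.2.1⟩]
    exact h1

/-- The normal sheaf of the strict transform of a line, in terms of the equation
`y₂ A + y₃ B` of a smooth surface through the line and of the binary form `s` of the intersection
with the centre, written as a combination of the restrictions of `A` and `B`. -/
theorem nonempty_iso_normalModule {C : (PSpace 3).IdealSheafData} (hπ : IsBlowup C π)
    (hj : e.hom ≫ i ≫ π = σ.line) {F A B : MvPolynomial (Fin 4) ℂ} (hF : F ∈ coordGrading 3 (2 + 1))
    (hA : A ∈ coordGrading 3 2) (hB : B ∈ coordGrading 3 2)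
    (hAB : F = σ.coord 2 * A + σ.coord 3 * B)
    (htop : ∀ k, Ideal.span {dehomogenize k (σ.toLine A) (σ.toLine_mem hA),
      dehomogenize k (σ.toLine B) (σ.toLine_mem hB)} = ⊤) {n : ℕ} {s : MvPolynomial (Fin 2) ℂ}
    (hs : s ∈ coordGrading 1 (n + 3)) (hs0 : s ≠ 0)
    (hCL : IsZeroScheme (C.comap σ.line) (fun _ : Fin 1 => s) (fun _ => hs))
    (hp : p ∈ coordGrading 1 (n + 1)) (hq : q ∈ coordGrading 1 (n + 1))
    (hspq : s = σ.toLine A * p + σ.toLine B * q)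
    (had : ∀ (k : Fin 2) (x : PSpace 1), x ∈ (chart k).1 →
      ∃ g a : Γ(PSpace 3, (σ.U (idx k)).1), σ.line x ∈ (PSpace 3).basicOpen a ∧
        IsAdapted C σ.line (σ.U (idx k)) (σ.dehom (idx k) hF) g a) {d : ℤ} (hd : d = -(n : ℤ)) :
    Nonempty ((Scheme.Modules.pullback e.hom).obj (normalModule i) ≅
      twistModule (coordGrading 1) (-1) ⊞ twistModule (coordGrading 1) d) := by
  apply nonempty_pullback_iso
  -- The equations y₂, y₃ of the line, pulled back to X, lie in the ideal of l; normal sections are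
  -- recorded by their values at these.
  have hη : ∀ {c : MvPolynomial (Fin 4) ℂ} (hc : c ∈ coordGrading 3 1) (_ : σ.toLine c = 0)
      (k : Fin 2), ∃ η : Γ(idealModule i, π ⁻¹ᵁ (σ.U (idx k)).1),
        idealVal i _ η = π.app _ (σ.dehom (idx k) hc) := by
    intro c hc h0 k
    apply (exact_idealVal i _).2
    apply app_injective_of_iso e
    refine Eq.trans ?_ (map_zero _).symm
    have h1 := (σ.line_app_eq_zero_iff (k := k) hc).mpr h0
    have h2 : (e.hom ≫ i ≫ π).app (σ.U (idx k)).1 (σ.dehom (idx k) hc) = 0 := by rw [hj]; exact h1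
    exact h2
  choose η₁ hη₁ using hη (σ.coord_mem 2) σ.toLine_coord_two
  choose η₂ hη₂ using hη (σ.coord_mem 3) σ.toLine_coord_three
  let Q₁ := twistModule (coordGrading 1) (-1)
  let Q₂ := twistModule (coordGrading 1) d
  let T : ∀ {N : Z.Opens}, Γ(Q₁ ⊞ Q₂, e.hom ⁻¹ᵁ N) → twistSections (coordGrading 1) (-1) (e.hom ⁻¹ᵁ N) :=
    fun n => (biprod.fst : Q₁ ⊞ Q₂ ⟶ Q₁).app _ n
  let W : ∀ {N : Z.Opens}, Γ(Q₁ ⊞ Q₂, e.hom ⁻¹ᵁ N) → twistSections (coordGrading 1) d (e.hom ⁻¹ᵁ N) :=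
    fun n => (biprod.snd : Q₁ ⊞ Q₂ ⟶ Q₂).app _ n
  have hTW : ∀ {N : Z.Opens} (n n' : Γ(Q₁ ⊞ Q₂, e.hom ⁻¹ᵁ N)), T n = T n' → W n = W n' → n = n' :=
    fun n n' h h' => biprod_section_ext Q₁ Q₂ h h'
  have hTres : ∀ {N N' : Z.Opens} (hN : N' ≤ N) (n : Γ(Q₁ ⊞ Q₂, e.hom ⁻¹ᵁ N)),
      T (N := N') (res ((Scheme.Modules.pushforward e.hom).obj (Q₁ ⊞ Q₂)) hN n) =
        twistRestrict (coordGrading 1) (-1) (e.hom.preimage_mono hN) (T n) := fun hN n =>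
    app_res (biprod.fst : Q₁ ⊞ Q₂ ⟶ Q₁) (e.hom.preimage_mono hN) n
  have hWres : ∀ {N N' : Z.Opens} (hN : N' ≤ N) (n : Γ(Q₁ ⊞ Q₂, e.hom ⁻¹ᵁ N)),
      W (N := N') (res ((Scheme.Modules.pushforward e.hom).obj (Q₁ ⊞ Q₂)) hN n) =
        twistRestrict (coordGrading 1) d (e.hom.preimage_mono hN) (W n) := fun hN n =>
    app_res (biprod.snd : Q₁ ⊞ Q₂ ⟶ Q₂) (e.hom.preimage_mono hN) n
  let R : ∀ N : Z.Opens, Γ(normalModule i, N) →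
      Γ((Scheme.Modules.pushforward e.hom).obj (Q₁ ⊞ Q₂), N) → Prop :=
    fun N φ n => σ.NormalTwistRel i e (σ.toLine A) (σ.toLine B) p q η₁ η₂ N φ (T (N := N) n).1 (W (N := N) n).1
  have hRres : ∀ {N N' : Z.Opens} (hN : N' ≤ N) (φ : Γ(normalModule i, N))
      (n : Γ((Scheme.Modules.pushforward e.hom).obj (Q₁ ⊞ Q₂), N)),
      R N' (res (normalModule i) hN φ)
          (res ((Scheme.Modules.pushforward e.hom).obj (Q₁ ⊞ Q₂)) hN n) ↔
        σ.NormalTwistRel i e (σ.toLine A) (σ.toLine B) p q η₁ η₂ N' (homRestrict _ _ hN φ)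
          (twistRestrict (coordGrading 1) (-1) (e.hom.preimage_mono hN) (T (N := N) n)).1
          (twistRestrict (coordGrading 1) d (e.hom.preimage_mono hN) (W (N := N) n)).1 := by
    intro N N' hN φ n
    exact iff_of_eq (congrArg₂
      (fun (t : twistSections (coordGrading 1) (-1) (e.hom ⁻¹ᵁ N'))
        (w : twistSections (coordGrading 1) d (e.hom ⁻¹ᵁ N')) =>
        σ.NormalTwistRel i e (σ.toLine A) (σ.toLine B) p q η₁ η₂ N' (homRestrict _ _ hN φ) t.1 w.1)
      (hTres hN n) (hWres hN n))
  refine nonempty_iso_of_local_graph _ _ R ?_ ?_ ?_ ?_ ?_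
  · intro N φ φ' n n' h h'
    have hT : T (N := N) (n + n') = T (N := N) n + T (N := N) n' := map_add _ _ _
    have hW : W (N := N) (n + n') = W (N := N) n + W (N := N) n' := map_add _ _ _
    change σ.NormalTwistRel i e _ _ p q η₁ η₂ N (φ + φ') (T (N := N) (n + n')).1 (W (N := N) (n + n')).1
    rw [hT, hW]
    exact NormalTwistRel.add h h'
  · intro N r φ n h
    have hT : T (N := N) (r • n) = e.hom.app N r • T (N := N) n := Scheme.Modules.Hom.app_smul (biprod.fst : Q₁ ⊞ Q₂ ⟶ Q₁) _ _
    have hW : W (N := N) (r • n) = e.hom.app N r • W (N := N) n := Scheme.Modules.Hom.app_smul (biprod.snd : Q₁ ⊞ Q₂ ⟶ Q₂) _ _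
    change σ.NormalTwistRel i e _ _ p q η₁ η₂ N (r • φ) (T (N := N) (r • n)).1 (W (N := N) (r • n)).1
    rw [hT, hW]
    exact NormalTwistRel.smul r h
  · intro N N' hN φ n h
    exact (hRres hN φ n).mpr (NormalTwistRel.restrict hN h)
  · intro N φ n h
    refine normalTwistRel_of_local fun x hx => ?_
    obtain ⟨V, hV, hxV, h1⟩ := h x hx
    exact ⟨V, hV, hxV, (hRres hV φ n).mp h1⟩
  · intro z
    obtain ⟨x, rfl⟩ : ∃ x, e.hom x = z := ⟨e.inv z, by simp⟩
    obtain ⟨k, hk⟩ := exists_mem_chart x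
    obtain ⟨g, a, hx, had⟩ := had k x hk
    have : IsDomain Γ(PSpace 3, (σ.U (idx k)).1) := σ.isDomain (idx k)
    have hCk : (C.ideal (σ.U (idx k))).map
        (σ.line.appLE _ (chart k).1 (σ.line_preimage k).ge).hom = Ideal.span {dehomogenize k s hs} := by
      rw [← ideal_comap C σ.line (σ.U (idx k)) (chart k) (σ.line_preimage k).ge, hCL k,
        Set.range_const]
    obtain ⟨V, hV, hxV, h⟩ := exists_normalSections_chart_of_iso hπ e hj had (σ.isConormalFrame k)
      (σ.dehom_eq hF hA hB hAB) (hη₁ k) (hη₂ k) (σ.line_preimage k).ge (σ.line_preimage k).le hCk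
      (σ.line_appLE_chart hA) (σ.line_appLE_chart hB) hx
    refine ⟨V, hxV, fun N hN => ?_⟩
    have hND : e.hom ⁻¹ᵁ N ≤ (chart k).1 := by
      -- The isomorphism e identifies the part of l over the k-th chart of ℙ³ with the k-th chart of
      -- ℙ¹.
      rw [← σ.line_preimage k, ← hj]
      exact e.hom.preimage_mono (hN.trans hV)
    obtain ⟨h1, h2⟩ := h N hN hND
    have hR : ∀ φ n, R N φ n ↔ IsTwistRel (σ.toLine A) (σ.toLine B) p q k (O := e.hom ⁻¹ᵁ N)
        (e.hom.app N (normalValue i (W := π ⁻¹ᵁ (σ.U (idx k)).1) φ (hN.trans hV) (η₁ k)))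
        (e.hom.app N (normalValue i (W := π ⁻¹ᵁ (σ.U (idx k)).1) φ (hN.trans hV) (η₂ k)))
        (T (N := N) n).1 (W (N := N) n).1 := fun φ n => normalTwistRel_iff hj hη₁ hη₂ (hN.trans hV)
    constructor
    · intro φ
      obtain ⟨w₀, hw₀⟩ := h1 φ
      obtain ⟨t, w, htw, huniq⟩ := existsUnique_isTwistRel (σ.toLine_mem hA) (σ.toLine_mem hB) hp hq
        hs hspq hND hd (htop k) hs0 hw₀
      obtain ⟨r, hr1, hr2⟩ := exists_biprod_section Q₁ Q₂ (U := e.hom ⁻¹ᵁ N) t w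
      refine ⟨r, (hR φ r).mpr ?_, fun r' hr' => ?_⟩
      · have e1 : T (N := N) r = t := hr1
        have e2 : W (N := N) r = w := hr2
        rw [e1, e2]
        exact htw
      · obtain ⟨e1, e2⟩ := huniq _ _ ((hR φ r').mp hr')
        exact hTW (N := N) r' r (e1.trans hr1.symm) (e2.trans hr2.symm)
    · intro r
      obtain ⟨u, v, huv⟩ := exists_isTwistRel (σ.toLine_mem hA) (σ.toLine_mem hB) hp hq hND hd
        (T (N := N) r) (W (N := N) r)
      obtain ⟨w', hw'⟩ := huv.exists_eq (σ.toLine_mem hA) (σ.toLine_mem hB) hp hq hs hspq hND hd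
      obtain ⟨φ, ⟨hφ₁, hφ₂⟩, huniq⟩ := h2 u v w' hw'
      refine ⟨φ, (hR φ r).mpr ?_, fun φ' hφ' => huniq φ' ?_⟩
      · rw [hφ₁, hφ₂]
        exact huv
      · exact ((hR φ' r).mp hφ').eq hND huv

end Frame

end NormalBundleLines

end

/-! ### The normal bundle of the strict transform -/

theorem mainTheorem9
    (S C L : (NormalBundleLines.PSpace 3).IdealSheafData) (m : ℕ)
    (hS : NormalBundleLines.IsSmoothCubicSurface S)
    (hC : NormalBundleLines.IsSmoothCurve C)
    (hCS : S ≤ C)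
    (hL : NormalBundleLines.IsSecantLine C L m)
    (hm : 3 ≤ m)
    (hLS : m = 3 → S ≤ L)
    (X : Scheme.{0}) (π : X ⟶ NormalBundleLines.PSpace 3)
    (hπ : NormalBundleLines.IsBlowup C π) :
    ∃ e : NormalBundleLines.PSpace 1 ≅
        (NormalBundleLines.strictTransform π C L).subscheme,
      e.hom ≫ (NormalBundleLines.strictTransform π C L).subschemeι ≫ π ≫
          NormalBundleLines.PSpace.toSpec 3 = NormalBundleLines.PSpace.toSpec 1 ∧
      Nonempty ((Scheme.Modules.pullback e.hom).obj
          (NormalBundleLines.normalModule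
            (NormalBundleLines.strictTransform π C L).subschemeι) ≅
        NormalBundleLines.twistModule (NormalBundleLines.coordGrading 1) (-1) ⊞
          NormalBundleLines.twistModule (NormalBundleLines.coordGrading 1) (3 - (m : ℤ))) := by
  open NormalBundleLines in
  obtain ⟨⟨F, hF, hF0, hSF⟩, hSsm⟩ := hS
  obtain ⟨⟨f, hf, hli, hLf⟩, hlen⟩ := hL
  have hTf : ∀ x ∈ ((C ⊔ L).support : Set (PSpace 3)), ∀ j,
      f j ∈ (pt x).asHomogeneousIdeal.toIdeal := by
    intro x hx
    rw [SetLike.mem_coe, Scheme.IdealSheafData.support_sup] at hx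
    exact (hLf.mem_support_iff x).mp hx.2
  obtain ⟨σ, h2, h3, hU⟩ := exists_frame_of_line hf hli (finite_support_of_hasLength hlen) hTf
  obtain ⟨s, hs, hsm, hsk⟩ := Frame.exists_form hLf h2 h3 (by omega) hlen hU
  have hCL : IsZeroScheme (C.comap σ.line) (fun _ : Fin 1 => s) (fun _ => hs) := fun k => by
    rw [hsk k, Set.range_const]
  have hs0 : s ≠ 0 := by
    rintro rfl
    simp at hsm
    omega
  -- A length of at least 4 exceeds the degree of the cubic; length 3 does not, which is why L ⊂ S
  -- is assumed in that case.
  have hFL : σ.toLine F = 0 := by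
    by_cases h : m = 3
    · exact Frame.toLine_eq_zero_of_le hF hSF (hLS h) hLf h2 h3
    · exact Frame.toLine_eq_zero hF hSF hCS hsm hCL (by omega)
  obtain ⟨A, hA, B, hB, hAB⟩ := σ.exists_eq_of_toLine_eq_zero (d := 2) hF hFL
  have htop := Frame.span_dehomogenize_eq_top (d := 2) hSF hF0 hSsm hA hB hAB
  obtain ⟨p, q, hp, hq, hspq⟩ := exists_eq_mul_add_mul (σ.toLine_mem hA) (σ.toLine_mem hB) hm hs
    fun c hc => eval_ne_zero_of_span_eq_top (σ.toLine_mem hA) (σ.toLine_mem hB) htop hc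
  have had : ∀ (k : Fin 2) (x : PSpace 1), x ∈ (chart k).1 →
      ∃ g a : Γ(PSpace 3, (σ.U (Frame.idx k)).1), σ.line x ∈ (PSpace 3).basicOpen a ∧
        IsAdapted C σ.line (σ.U (Frame.idx k)) (σ.dehom (Frame.idx k) hF) g a := fun k x hx =>
    Frame.exists_isAdapted (d := 2) hSF hF0 hSsm hCS hC.2 hFL hs0 hCL hx
  have hcharts : HasAdaptedCharts C σ.line := fun x => by
    obtain ⟨k, hk⟩ := exists_mem_chart x
    obtain ⟨g, a, hx, hA⟩ := had k x hk
    exact ⟨_, _, g, a, σ.isDomain (Frame.idx k), hx, hA⟩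
  -- The generic point of the line is outside C because s is not the zero form.
  have hne : ∃ x, σ.line x ∉ C.support := by
    refine ⟨genericPt 1, fun h => hs0 ?_⟩
    have h1 : genericPt 1 ∈ (C.comap σ.line).support := by
      rw [Scheme.IdealSheafData.support_comap]
      exact h
    exact (mem_genericPt_iff s).mp ((hCL.mem_support_iff _).mp h1 0)
  have : AlgebraicGeometry.IsIntegral (PSpace 1) := inferInstance
  obtain ⟨e, he⟩ := exists_iso_strictTransform hπ σ.line (isEffectiveCartier_of_isZeroScheme hCL hs0)
    hcharts L (Frame.support_eq_range_line hLf h2 h3) hne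
  -- With n = m − 3 the second twist 3 − m is −n, a twist by a nonpositive integer.
  obtain ⟨n, rfl⟩ := Nat.exists_eq_add_of_le' hm
  refine ⟨e, ?_, Frame.nonempty_iso_normalModule hπ he hF hA hB hAB htop hs hs0 hCL hp hq hspq had ?_⟩
  · rw [← σ.line_toSpec, ← he, Category.assoc, Category.assoc]
  · push_cast
    ring
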